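/- **Setting.** Let $\mathcal T_h$ be a finite conforming triangulation of a closed polygonal region $\overline\Omega\subset\mathbb R^2$ without pinch points (the triangles around each vertex are connected through common edges). Put $h_T=\mathrm{area}(T)^{1/2}$ and assume shape regularity, $\operatorname{diam}(T)\le\kappa h_T$ for all $T\in\mathcal T_h$. Each vertex $z$ is assigned a patch $\Omega_z$, a union of at most $N$ triangles of $\mathcal T_h$ connected through common edges, as follows. If $z$ is an interior vertex, $\Omega_z$ contains all triangles with vertex $z$ (and possibly a few more). If $z$ is a boundary vertex joined by an edge to some interior vertex, then $\Omega_z=\Omega_{z'}$ for an interior vertex $z'$ joined to $z$ by an edge. If $z$ is any other boundary vertex, then $\Omega_z$ contains $z$ and $\Omega_{z'}$ for some interior vertex $z'$ (for example, $\Omega_z$ is the smallest such patch). For a symmetric matrix field $\tau$ write $\tau_{nn}=n_e^{\mathsf T}\tau n_e$ on an edge $e$ with unit normal $n_e$ and midpoint $m_e$. For $\tau$ with single-valued $\tau_{nn}(m_e)$, let $\tau_z$ be the minimizer of $\sum_{e\subset\Omega_z}\big(p(m_e)_{nn}-\tau(m_e)_{nn}\big)^2$ over symmetric-matrix-valued polynomials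 $p$ of degree at most $1$. Then $R_h\tau$ is the continuous field, affine on each triangle, with $R_h\tau(z)=\tau_z(z)$ at every vertex $z$. Let $\Sigma_h^1$ be the space of piecewise constant symmetric matrix fields $\tau_h$ whose component $(\tau_h)_{nn}$ is single-valued on every edge and vanishes on the edges of a prescribed (arbitrary) part of the boundary. For $T\in\mathcal T_h$ let $\Omega_T$ be the union of all triangles that meet $T$ and of the patches $\Omega_z$ of the three vertices $z$ of $T$. **Well-posedness condition** at an interior vertex $z$, with $n_z$ the number of vertices joined to $z$ by an edge: $n_z\ge4$; the sum of any two adjacent angles in $\Omega_z$ is at most $\pi$ (two angles are adjacent if they have a common vertex and lie in two triangles sharing an edge that contains this vertex); and if $n_z=4$, then the vertices in $\Omega_z$ do not lie on two lines. **Theorem.** Assume the well-posedness condition at all interior vertices. Then for every vertex $z$ the least-squares problem on $\Omega_z$ has exactly one minimizer, for arbitrary edge data, so $R_h$ is well defined. Moreover, for every $\delta>0$ there is a constant $C=C(\kappa,N,\delta)>0$, independent of the region, the triangulation and the patches, such that the following holds for every $T\in\mathcal T_h$ satisfying (*) for each boundary vertex $z$ of $T$ whose associated interior vertex $z'$ has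 $n_{z'}=4$, and for any two lines, some vertex in $\Omega_{z'}$ has distance at least $\delta\cdot\operatorname{diam}(\text{vertices in }\Omega_{z'})$ from both of them. 1. $\|R_h\tau_h\|_{L^2(T)}\le C\,\|\tau_h\|_{L^2(\Omega_T)}$ for all $\tau_h\in\Sigma_h^1$. 2. $\|\sigma-R_h\sigma\|_{L^2(T)}\le C\,h_T^2\,|\sigma|_{H^2(\Omega_T)}$ for every symmetric matrix field $\sigma$ that is continuous on $\Omega_T$ and belongs to $H^2$ of the interior of $\Omega_T$. (Condition (*) is void, so that $C$ depends only on $\kappa$ and $N$, unless $T$ has a boundary vertex whose patch is inherited from an interior vertex with exactly four neighbours; and by the well-posedness condition, it always holds for some $\delta>0$.) -/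

import Mathlib

open MeasureTheory EuclideanGeometry
open scoped ContDiff

noncomputable section

namespace Plate

abbrev Plane : Type := EuclideanSpace ℝ (Fin 2)

abbrev Mat : Type := Matrix (Fin 2) (Fin 2) ℝ

/-- Two triangles (given by their vertex sets) share an edge. -/
def ShareEdge (T T' : Finset Plane) : Prop :=
  ∃ a b : Plane, a ≠ b ∧ a ∈ T ∧ a ∈ T' ∧ b ∈ T ∧ b ∈ T' ∧ T ≠ T'

/-- Any two triangles of `S` are joined by a chain of triangles of `S` in which consecutive
ones share an edge. -/
def EdgeConnected (S : Finset (Finset Plane)) : Prop :=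
  ∀ T ∈ S, ∀ T' ∈ S, Relation.ReflTransGen (fun A B => B ∈ S ∧ ShareEdge A B) T T'

/-- A conforming triangulation of the closed polygonal region `space`: a finite planar simplicial
complex (simplices are given by their vertex sets) in which each simplex lies in a triangle.
The last condition says that the region has no pinch point at a vertex, as is the case for a
Lipschitz polygonal domain. -/
structure Triangulation extends Geometry.SimplicialComplex ℝ Plane where
  finite_faces : faces.Finite
  exists_triangle : ∀ s ∈ faces, ∃ T ∈ faces, s ⊆ T ∧ T.card = 3
  no_pinch : ∀ z : Plane,
    EdgeConnected (finite_faces.toFinset.filter (fun T => T.card = 3 ∧ z ∈ T))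

namespace Triangulation

variable (K : Triangulation)

def triangles : Finset (Finset Plane) :=
  K.finite_faces.toFinset.filter (fun T => T.card = 3)

/-- The vertices of the mesh. -/
def nodes : Set Plane := {z | {z} ∈ K.faces}

/-- The closed region that is triangulated. -/
def region : Set Plane := K.toSimplicialComplex.space

def interiorNodes : Set Plane := {z | z ∈ K.nodes ∧ z ∈ interior K.region}

def boundaryNodes : Set Plane := {z | z ∈ K.nodes ∧ z ∉ interior K.region}

/-- `z` and `w` are the two endpoints of an edge of the mesh. -/
def DirectlyConnected (z w : Plane) : Prop :=
  z ≠ w ∧ ∃ e ∈ K.faces, e.card = 2 ∧ z ∈ e ∧ w ∈ e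

/-- The number of vertices directly connected to `z`. -/
def valence (z : Plane) : ℕ := {w | K.DirectlyConnected z w}.ncard

end Triangulation

/-- The mesh size `h_T`, the square root of the area of `T`. -/
def meshSize (T : Finset Plane) : ℝ :=
  Real.sqrt (volume (convexHull ℝ (T : Set Plane))).toReal

/-- Shape regularity with parameter `κ`. -/
def Triangulation.ShapeRegular (K : Triangulation) (κ : ℝ) : Prop :=
  ∀ T ∈ K.triangles, Metric.diam (convexHull ℝ (T : Set Plane)) ≤ κ * meshSize T

/-! ### Vertex patches -/

/-- An assignment of a vertex patch (a set of triangles) to each vertex `z` of the mesh.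
`source z` is the interior vertex from which the patch of a boundary vertex `z` is inherited. -/
structure PatchAssignment (K : Triangulation) where
  patch : Plane → Finset (Finset Plane)
  source : Plane → Plane
  patch_subset : ∀ z ∈ K.nodes, patch z ⊆ K.triangles
  patch_connected : ∀ z ∈ K.nodes, EdgeConnected (patch z)
  /-- An interior vertex: all the triangles around `z`, and possibly some more. -/
  star_subset : ∀ z ∈ K.interiorNodes, ∀ T ∈ K.triangles, z ∈ T → T ∈ patch z
  source_mem : ∀ z ∈ K.boundaryNodes, source z ∈ K.interiorNodes
  /-- A boundary vertex that is directly connected to an interior vertex. -/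
  direct : ∀ z ∈ K.boundaryNodes, (∃ w ∈ K.interiorNodes, K.DirectlyConnected z w) →
    K.DirectlyConnected z (source z) ∧ patch z = patch (source z)
  /-- The other boundary vertices: a patch that contains `z` and the patch of `source z`. -/
  indirect : ∀ z ∈ K.boundaryNodes, (¬ ∃ w ∈ K.interiorNodes, K.DirectlyConnected z w) →
    (∃ T ∈ patch z, z ∈ T) ∧ patch (source z) ⊆ patch z

/-- A line in the plane. -/
def IsLine (L : AffineSubspace ℝ Plane) : Prop := Module.finrank ℝ L.direction = 1

namespace PatchAssignment

variable {K : Triangulation} (P : PatchAssignment K)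

/-- The vertices of the patch of `z`. -/
def patchNodes (z : Plane) : Set Plane := {w | ∃ T ∈ P.patch z, w ∈ T}

/-- Each patch consists of at most `N` triangles. -/
def BoundedBy (N : ℕ) : Prop := ∀ z ∈ K.nodes, (P.patch z).card ≤ N

/-- The sum of any two adjacent angles in the patch of `z` is at most `π`; two angles are adjacent
if they have the same vertex `a` and belong to two triangles that share an edge `ab`. -/
def AngleCondition (z : Plane) : Prop :=
  ∀ T ∈ P.patch z, ∀ T' ∈ P.patch z, T ≠ T' → ∀ a b c d : Plane, a ≠ b →
    a ∈ T → b ∈ T → a ∈ T' → b ∈ T' →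
    c ∈ T → c ≠ a → c ≠ b → d ∈ T' → d ≠ a → d ≠ b → ∠ c a b + ∠ b a d ≤ Real.pi

def OnTwoLines (z : Plane) : Prop :=
  ∃ L₁ L₂ : AffineSubspace ℝ Plane, IsLine L₁ ∧ IsLine L₂ ∧ ∀ w ∈ P.patchNodes z, w ∈ L₁ ∨ w ∈ L₂

/-- The well-posedness condition at an interior vertex `z`. -/
def WellPosedAt (z : Plane) : Prop :=
  4 ≤ K.valence z ∧ P.AngleCondition z ∧ (K.valence z = 4 → ¬ P.OnTwoLines z)

/-- The vertices of the patch of `z` are not within relative distance `δ` of lying on two lines.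
Since the patch is finite, `¬ P.OnTwoLines z` gives this for some `δ > 0`. -/
def AwayFromTwoLines (δ : ℝ) (z : Plane) : Prop :=
  ∀ L₁ L₂ : AffineSubspace ℝ Plane, IsLine L₁ → IsLine L₂ → ∃ w ∈ P.patchNodes z,
    δ * Metric.diam (P.patchNodes z) ≤ Metric.infDist w (L₁ : Set Plane) ∧
    δ * Metric.diam (P.patchNodes z) ≤ Metric.infDist w (L₂ : Set Plane)

open Classical in
/-- The neighbourhood of a triangle `T`: the triangles that meet `T`, and those in the
patches of the vertices of `T`. -/
def neighborhood (T : Finset Plane) : Finset (Finset Plane) :=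
  K.triangles.filter (fun T' =>
    (convexHull ℝ (T' : Set Plane) ∩ convexHull ℝ (T : Set Plane)).Nonempty ∨
      ∃ z ∈ T, T' ∈ P.patch z)

end PatchAssignment

/-- The closed region covered by a set of triangles. -/
def cover (S : Finset (Finset Plane)) : Set Plane := ⋃ T ∈ S, convexHull ℝ (T : Set Plane)

/-! ### Fields and the recovery operator -/

/-- A piecewise defined matrix field: `τ T` is the restriction of the field to the triangle `T`
(only its values on `T` matter). A field `σ` on the whole region is `fun _ => σ`. -/
abbrev BrokenField : Type := Finset Plane → Plane → Mat

/-- The `L²` norm of a field over the region covered by the triangles in `S`. -/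
def l2Norm (S : Finset (Finset Plane)) (τ : BrokenField) : ℝ :=
  Real.sqrt (∑ T ∈ S, ∫ x in convexHull ℝ (T : Set Plane), ∑ i, ∑ j, (τ T x i j) ^ 2)

def edgeMidpoint (e : Finset Plane) : Plane := (2 : ℝ)⁻¹ • ∑ x ∈ e, x

/-- A unit normal to the edge `e` (its sign has no influence on `normalNormal`). -/
def edgeNormal (e : Finset Plane) : Plane :=
  Classical.epsilon (fun n : Plane => ‖n‖ = 1 ∧ ∀ a ∈ e, ∀ b ∈ e, inner ℝ n (b - a) = 0)

/-- The normal-normal component `nᵀ A n` on the edge `e`. -/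
def normalNormal (e : Finset Plane) (A : Mat) : ℝ :=
  ∑ i, ∑ j, edgeNormal e i * A i j * edgeNormal e j

/-- The value at the midpoint of the edge `e` of the normal-normal component of `τ`, taken from
any triangle that contains `e` (for the fields below, the component is single-valued on `e`). -/
def edgeValue (K : Triangulation) (τ : BrokenField) (e : Finset Plane) : ℝ :=
  normalNormal e
    (τ (Classical.epsilon (fun T : Finset Plane => T ∈ K.triangles ∧ e ⊆ T)) (edgeMidpoint e))

open Classical in
/-- The edges of the triangles in `S`. -/
def edgesOf (S : Finset (Finset Plane)) : Finset (Finset Plane) :=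
  S.biUnion (fun T => T.powersetCard 2)

/-- The least-squares functional of the edge data `d` over the edges in `S`. -/
def lsq (S : Finset (Finset Plane)) (d : Finset Plane → ℝ) (p : Plane →ᵃ[ℝ] Mat) : ℝ :=
  ∑ e ∈ edgesOf S, (normalNormal e (p (edgeMidpoint e)) - d e) ^ 2

/-- `p` is a symmetric-matrix-valued polynomial of degree at most one that minimizes the
least-squares functional among all such polynomials. -/
def IsFit (S : Finset (Finset Plane)) (d : Finset Plane → ℝ) (p : Plane →ᵃ[ℝ] Mat) : Prop :=
  (∀ x, (p x).IsSymm) ∧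
    ∀ q : Plane →ᵃ[ℝ] Mat, (∀ x, (q x).IsSymm) → lsq S d p ≤ lsq S d q

/-- The least-squares polynomial at the vertex `z`. -/
def PatchAssignment.fit {K : Triangulation} (P : PatchAssignment K) (τ : BrokenField) (z : Plane) :
    Plane →ᵃ[ℝ] Mat :=
  Classical.epsilon (IsFit (P.patch z) (edgeValue K τ))

/-- The recovered field: on each triangle it is the polynomial of degree at most one whose
value at each vertex `z` is the value at `z` of the least-squares polynomial at `z`. -/
def PatchAssignment.recovery {K : Triangulation} (P : PatchAssignment K) (τ : BrokenField) :
    BrokenField :=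
  fun T x => (Classical.epsilon
    (fun p : Plane →ᵃ[ℝ] Mat => ∀ z ∈ T, p z = P.fit τ z z)) x

/-- The lowest order Hellan--Herrmann--Johnson space: piecewise constant symmetric matrix fields
whose normal-normal component is single-valued on each edge and vanishes on the edges in `G`
(the boundary edges on the simply supported and free parts of the boundary). -/
structure IsHHJ (K : Triangulation) (G : Set (Finset Plane)) (τ : BrokenField) : Prop where
  const : ∀ T ∈ K.triangles, ∃ A : Mat, A.IsSymm ∧
    ∀ x ∈ convexHull ℝ (T : Set Plane), τ T x = A
  single : ∀ e ∈ edgesOf K.triangles, ∀ T ∈ K.triangles, ∀ T' ∈ K.triangles, e ⊆ T → e ⊆ T' →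
    normalNormal e (τ T (edgeMidpoint e)) = normalNormal e (τ T' (edgeMidpoint e))
  vanish : ∀ e ∈ G, ∀ T ∈ K.triangles, e ∈ edgesOf {T} →
    normalNormal e (τ T (edgeMidpoint e)) = 0

/-! ### Weak derivatives -/

/-- `g` is the weak partial derivative of `f` in direction `i` on the open set `U`. -/
def IsWeakPartial (U : Set Plane) (i : Fin 2) (f g : Plane → ℝ) : Prop :=
  ∀ φ : Plane → ℝ, ContDiff ℝ ∞ φ → HasCompactSupport φ → tsupport φ ⊆ U →
    ∫ x in U, f x * fderiv ℝ φ x (EuclideanSpace.single i 1) = - ∫ x in U, g x * φ x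

/-- `f ∈ H²(U)`, with weak gradient `g` and weak Hessian `H`. -/
structure IsH2With (U : Set Plane) (f : Plane → ℝ) (g : Fin 2 → Plane → ℝ)
    (H : Fin 2 → Fin 2 → Plane → ℝ) : Prop where
  memLp : MemLp f 2 (volume.restrict U)
  memLp_grad : ∀ i, MemLp (g i) 2 (volume.restrict U)
  memLp_hess : ∀ i j, MemLp (H i j) 2 (volume.restrict U)
  weak_grad : ∀ i, IsWeakPartial U i f (g i)
  weak_hess : ∀ i j, IsWeakPartial U j (g i) (H i j)

/-- The `H²(U)` seminorm of a matrix field whose entries `k l` have weak Hessian `H k l`. -/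
def h2Seminorm (U : Set Plane) (H : Fin 2 → Fin 2 → Fin 2 → Fin 2 → Plane → ℝ) : ℝ :=
  Real.sqrt (∫ x in U, ∑ k, ∑ l, ∑ i, ∑ j, (H k l i j x) ^ 2)

end Plate

end

/-! Turn an affine symmetric field by a quarter turn, so that normals become tangents. Its second
derivatives vanish, so the compatibility conditions hold and it is the symmetric gradient of a
quadratic displacement, unique up to infinitesimal rigid motions (`exists_isStrain`). Increments of
quadratic polynomials are given exactly by the derivative at the midpoint. Hence the normal-normal
value at an edge midpoint is, up to the squared length, the first-order stretching of that edge
(`IsStrain.edge`, `normalForm_eq`). A patch is therefore a truss: if all its edge values vanish,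
each triangle moves rigidly, and so does the whole patch by connectedness through edges. After
normalization both components of the displacement vanish at all its vertices. The least-squares
problem is thus uniquely solvable if no conic contains all vertices of the patch.
`exists_displacement_bound` is the quantitative form.

Let the interior vertex `z` be the origin. A conic that is regular there reads `Y = A X² + B XY + C
Y²`, and then `(X/Y, 1/Y)` lies on a parabola. The angle condition makes the neighbours a locally
convex polygon that winds around `z`. On such a conic all of them would have the same sign of `Y`,
which is impossible (`no_conic`). A conic that is singular at `z` is a pair of lines and meets at
most four of the rays to the neighbours. So five neighbours suffice (`quad_eq_zero`), and
compactness of the set of admissible stars makes this uniform (`exists_quad_bound`). Four neighbours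
necessarily form a cross with `z` between opposite ones. They control the linear part of the
displacement, hence the field at `z`. The whole field is controlled once a further vertex of the
patch is off the cross (`exists_quad_cross_bound`). The fit of an inherited patch is evaluated at a
boundary vertex, away from the centre, and this is why (*) is needed there. `exists_stability`
collects these bounds.

The fit differs from any symmetric affine field by at most the misfit of the edge data, up to a
constant (`exists_recovery_bound`). Comparison with zero gives the stability in `L²`. For the
approximation estimate the comparison field is the interpolant of `σ` at the vertices of `T`. That
it is close to `σ` on the whole neighbourhood is shown without an extension or a Bramble-Hilbert
argument. Weak second derivatives, tested with products of cutoffs, bound mixed second differences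
over parallelograms (`abs_mixed_difference_le`). These bound the interpolation error on one
triangle, and second differences across an edge carry the bound to the adjacent triangle
(`HasMixedBound.abs_le_across`). Chains of triangles of bounded length reach the whole neighbourhood
(`neighborhood_bound`). -/

noncomputable section

namespace Plate

/-! ### Vertices around a vertex do not lie on a conic -/

/-- The cross product of two vectors of the plane. -/
def cr (x y : Plane) : ℝ := x 0 * y 1 - x 1 * y 0

/-- The scalar product of two vectors of the plane, in coordinates. -/
def dt (x y : Plane) : ℝ := x 0 * y 0 + x 1 * y 1

/-- The quadratic polynomial without constant term with the coefficients `c`. -/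
def quad (c : Fin 5 → ℝ) (y : Plane) : ℝ :=
  c 0 * y 0 + c 1 * y 1 + c 2 * (y 0) ^ 2 + c 3 * (y 0 * y 1) + c 4 * (y 1) ^ 2

/-- A cyclically ordered locally convex polygon cannot lie, together with the origin, on a conic
that is written as `Y = A X ^ 2 + B X Y + C Y ^ 2`, if `A` is positive. -/
theorem no_conic_of_pos {ι : Type*} [Finite ι] [Nonempty ι] (X Y : ι → ℝ) (s : ι → ι)
    {A B C : ℝ} (hA : 0 < A) (hq : ∀ i, Y i = A * X i ^ 2 + B * (X i * Y i) + C * Y i ^ 2)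
    (h1 : ∀ i, 0 < X i * Y (s i) - Y i * X (s i))
    (h2 : ∀ i, 0 ≤ X i * Y (s (s i)) - Y i * X (s (s i)))
    (h3 : ∀ i, X i * Y (s (s i)) - Y i * X (s (s i)) ≤ (X i * Y (s i) - Y i * X (s i)) +
      (X (s i) * Y (s (s i)) - Y (s i) * X (s (s i)))) : False := by
  have hY : ∀ i, Y i ≠ 0 := by
    intro i hi
    have h := hq i
    rw [hi] at h
    have hX : X i = 0 := by
      have : A * X i ^ 2 = 0 := by linarith
      simpa [hA.ne'] using this
    have := h1 i
    rw [hi, hX] at this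
    simp at this
  -- With `t = X/Y` and `w = 1/Y` the conic is the parabola `w = A t² + B t + C`. The identity is
  -- the Vandermonde determinant of three consecutive points on it, cleared of denominators.
  have key : ∀ i, Y i * Y (s i) * Y (s (s i)) *
      ((X i * Y (s i) - Y i * X (s i)) + (X (s i) * Y (s (s i)) - Y (s i) * X (s (s i))) -
        (X i * Y (s (s i)) - Y i * X (s (s i)))) =
      A * (X i * Y (s i) - Y i * X (s i)) * (X (s i) * Y (s (s i)) - Y (s i) * X (s (s i))) *
        (X i * Y (s (s i)) - Y i * X (s (s i))) := by
    intro i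
    linear_combination (X i * Y (s i) - Y i * X (s i)) * Y i * Y (s i) * hq (s (s i)) +
      (X (s i) * Y (s (s i)) - Y (s i) * X (s (s i))) * Y (s i) * Y (s (s i)) * hq i -
      (X i * Y (s (s i)) - Y i * X (s (s i))) * Y i * Y (s (s i)) * hq (s i)
  have hprod : ∀ i, 0 < Y i * Y (s i) * Y (s (s i)) := by
    intro i
    have hne : Y i * Y (s i) * Y (s (s i)) ≠ 0 :=
      mul_ne_zero (mul_ne_zero (hY _) (hY _)) (hY _)
    rcases (h2 i).eq_or_lt with hE | hE
    · have hk := key i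
      rw [← hE] at hk
      have hp : 0 < (X i * Y (s i) - Y i * X (s i)) +
        (X (s i) * Y (s (s i)) - Y (s i) * X (s (s i))) - 0 := by linarith [h1 i, h1 (s i)]
      rw [mul_zero] at hk
      exact absurd hk (mul_ne_zero hne hp.ne')
    · by_contra hneg
      have hneg' : Y i * Y (s i) * Y (s (s i)) < 0 := lt_of_le_of_ne (not_lt.1 hneg) hne
      have hr : 0 < A * (X i * Y (s i) - Y i * X (s i)) *
          (X (s i) * Y (s (s i)) - Y (s i) * X (s (s i))) *
          (X i * Y (s (s i)) - Y i * X (s (s i))) :=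
        mul_pos (mul_pos (mul_pos hA (h1 i)) (h1 (s i))) hE
      rw [← key i] at hr
      have := mul_nonpos_of_nonpos_of_nonneg hneg'.le (sub_nonneg.2 (h3 i))
      linarith
  -- The middle vector lies in the cone of its two neighbours in the cycle, so a half plane that
  -- contains these contains it too.
  have hiso : ∀ i, Y i < 0 → Y (s (s i)) < 0 → Y (s i) < 0 := by
    intro i h h'
    by_contra hp
    have e : (X i * Y (s i) - Y i * X (s i)) * Y (s (s i)) +
        (X (s i) * Y (s (s i)) - Y (s i) * X (s (s i))) * Y i =
        (X i * Y (s (s i)) - Y i * X (s (s i))) * Y (s i) := by ring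
    have a1 := mul_neg_of_pos_of_neg (h1 i) h'
    have a2 := mul_neg_of_pos_of_neg (h1 (s i)) h
    have a3 := mul_nonneg (h2 i) (not_lt.1 hp)
    linarith
  -- By `hprod` a negative value is followed by one negative and one positive value. Either order
  -- produces a positive value between two negative ones, which `hiso` excludes.
  have hpos : ∀ i, 0 < Y i := by
    intro i
    by_contra hi
    have hi : Y i < 0 := lt_of_le_of_ne (not_lt.1 hi) (hY i)
    have p0 := hprod i
    have p1 := hprod (s i)
    rcases lt_or_gt_of_ne (hY (s i)) with h | h
    · have : 0 < Y (s (s i)) := by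
        have := mul_pos_of_neg_of_neg hi h
        exact pos_of_mul_pos_right p0 this.le
      have h4 : Y (s (s (s i))) < 0 := by
        have := mul_neg_of_neg_of_pos h this
        by_contra hc
        have := mul_nonpos_of_nonpos_of_nonneg this.le (not_lt.1 hc)
        linarith
      linarith [hiso (s i) h h4]
    · have : Y (s (s i)) < 0 := by
        have := mul_neg_of_neg_of_pos hi h
        by_contra hc
        have := mul_nonpos_of_nonpos_of_nonneg this.le (not_lt.1 hc)
        linarith
      linarith [hiso i hi this]
  -- All points lie in an open half plane, where `X / Y` strictly decreases from each point to its
  -- successor; on a finite set this cannot go on.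
  obtain ⟨i, hi⟩ := Finite.exists_min (fun i => X i / Y i)
  have := hi (s i)
  rw [div_le_div_iff₀ (hpos _) (hpos _)] at this
  linarith [h1 i, mul_comm (X (s i)) (Y i)]

/-- A half turn changes the sign of `A`. If `A = 0`, the conic splits into the lines `Y = 0` and `B
X + C Y = 1`. A successor on the first line has both its predecessor and its own successor on the
second one, so all successors lie in the half plane `B X + C Y > 0`, and a projective coordinate
increases forever there. -/
theorem no_conic {ι : Type*} [Finite ι] [Nonempty ι] (X Y : ι → ℝ) (s : ι → ι)
    {A B C : ℝ} (hq : ∀ i, Y i = A * X i ^ 2 + B * (X i * Y i) + C * Y i ^ 2)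
    (h1 : ∀ i, 0 < X i * Y (s i) - Y i * X (s i))
    (h2 : ∀ i, 0 ≤ X i * Y (s (s i)) - Y i * X (s (s i)))
    (h3 : ∀ i, X i * Y (s (s i)) - Y i * X (s (s i)) ≤ (X i * Y (s i) - Y i * X (s i)) +
      (X (s i) * Y (s (s i)) - Y (s i) * X (s (s i)))) : False := by
  rcases lt_trichotomy A 0 with hA | hA | hA
  · refine no_conic_of_pos (fun i => -X i) (fun i => -Y i) s (A := -A) (B := -B) (C := -C)
      (by linarith) ?_ ?_ ?_ ?_
    · intro i
      linear_combination -hq i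
    · intro i
      simpa using h1 i
    · intro i
      simpa using h2 i
    · intro i
      simpa using h3 i
  · subst hA
    have hmu : ∀ i, Y i = 0 ∨ B * X i + C * Y i = 1 := by
      intro i
      have : Y i * (1 - (B * X i + C * Y i)) = 0 := by linear_combination hq i
      rcases mul_eq_zero.1 this with h | h
      · exact Or.inl h
      · right; linarith
    have hpos : ∀ i, 0 < B * X (s i) + C * Y (s i) := by
      intro i
      rcases hmu (s i) with h | h
      · have hi : B * X i + C * Y i = 1 := by
          refine (hmu i).resolve_left fun h0 => ?_
          have := h1 i
          rw [h, h0] at this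
          simp at this
        have hi' : B * X (s (s i)) + C * Y (s (s i)) = 1 := by
          refine (hmu _).resolve_left fun h0 => ?_
          have := h1 (s i)
          rw [h, h0] at this
          simp at this
        have e : (X i * Y (s (s i)) - Y i * X (s (s i))) * (B * X (s i) + C * Y (s i)) =
            (X i * Y (s i) - Y i * X (s i)) * (B * X (s (s i)) + C * Y (s (s i))) +
            (X (s i) * Y (s (s i)) - Y (s i) * X (s (s i))) * (B * X i + C * Y i) := by ring
        rw [hi, hi'] at e
        have : 0 < (X i * Y (s (s i)) - Y i * X (s (s i))) * (B * X (s i) + C * Y (s i)) := by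
          linarith [h1 i, h1 (s i)]
        exact pos_of_mul_pos_right this (h2 i)
      · rw [h]; exact one_pos
    have hBC : 0 < B ^ 2 + C ^ 2 := by
      obtain ⟨i⟩ := ‹Nonempty ι›
      by_contra h
      have hB : B = 0 := by nlinarith [sq_nonneg B, sq_nonneg C]
      have hC : C = 0 := by nlinarith [sq_nonneg B, sq_nonneg C]
      have := hpos i
      simp [hB, hC] at this
    obtain ⟨i, hi⟩ := Finite.exists_max
      (fun i => (B * Y (s i) - C * X (s i)) / (B * X (s i) + C * Y (s i)))
    have := hi (s i)
    rw [div_le_div_iff₀ (hpos _) (hpos _)] at this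
    have h := mul_pos hBC (h1 (s i))
    linarith [h, this]
  · exact no_conic_of_pos X Y s hA hq h1 h2 h3

/-- If five or more points lie on different rays from the origin and form a locally convex
polygon around it, then no conic contains them and the origin. -/
theorem quad_eq_zero {ι : Type*} [Finite ι] (a : ι → Plane) (s : ι → ι) (hcard : 5 ≤ Nat.card ι)
    (h1 : ∀ i, 0 < cr (a i) (a (s i))) (h2 : ∀ i, 0 ≤ cr (a i) (a (s (s i))))
    (h3 : ∀ i, cr (a i) (a (s (s i))) ≤ cr (a i) (a (s i)) + cr (a (s i)) (a (s (s i))))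
    (h5 : ∀ i j, i ≠ j → dt (a i) (a j) ≤ 0 ∨ cr (a i) (a j) ≠ 0)
    (c : Fin 5 → ℝ) (hq : ∀ i, quad c (a i) = 0) : c = 0 := by
  have hne : Nonempty ι := by
    by_contra h
    rw [not_nonempty_iff] at h
    simp at hcard
  by_cases hl : c 0 = 0 ∧ c 1 = 0
  · obtain ⟨h0, h1'⟩ := hl
    obtain ⟨i₀⟩ := hne
    set e := a i₀ with he
    set f := a (s i₀) with hf
    have hD : 0 < cr e f := h1 i₀
    have hQ : ∀ i, c 2 * (a i 0) ^ 2 + c 3 * (a i 0 * a i 1) + c 4 * (a i 1) ^ 2 = 0 := by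
      intro i
      have := hq i
      simp only [quad, h0, h1'] at this
      linarith
    have hQe := hQ i₀
    have hQf := hQ (s i₀)
    rw [← he] at hQe
    rw [← hf] at hQf
    -- In the basis `e`, `f` the quadratic form has no squares, so this mixed coefficient decides:
    -- either the form is zero, or it vanishes exactly on the lines spanned by `e` and `f`.
    by_cases hb : 2 * c 2 * (e 0 * f 0) + c 3 * (e 0 * f 1 + e 1 * f 0) +
        2 * c 4 * (e 1 * f 1) = 0
    · have hv : ∀ x y : ℝ, cr e f ^ 2 * (c 2 * x ^ 2 + c 3 * (x * y) + c 4 * y ^ 2) = 0 := by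
        intro x y
        simp only [cr]
        linear_combination (x * f 1 - y * f 0) ^ 2 * hQe + (e 0 * y - e 1 * x) ^ 2 * hQf +
          (x * f 1 - y * f 0) * (e 0 * y - e 1 * x) * hb
      have hv' : ∀ x y : ℝ, c 2 * x ^ 2 + c 3 * (x * y) + c 4 * y ^ 2 = 0 := fun x y =>
        (mul_eq_zero.1 (hv x y)).resolve_left (by positivity)
      have e1 := hv' 1 0
      have e2 := hv' 0 1
      have e3 := hv' 1 1
      ext m
      fin_cases m <;> simp <;> linarith
    · exfalso
      have hz : ∀ i, cr (a i) f = 0 ∨ cr e (a i) = 0 := by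
        intro i
        have : cr (a i) f * cr e (a i) * (2 * c 2 * (e 0 * f 0) + c 3 * (e 0 * f 1 + e 1 * f 0) +
            2 * c 4 * (e 1 * f 1)) = 0 := by
          simp only [cr]
          linear_combination (e 0 * f 1 - e 1 * f 0) ^ 2 * hQ i -
            (a i 0 * f 1 - a i 1 * f 0) ^ 2 * hQe - (e 0 * a i 1 - e 1 * a i 0) ^ 2 * hQf
        exact mul_eq_zero.1 ((mul_eq_zero.1 this).resolve_right hb)
      classical
      -- Which of the two lines, and which side of the origin: four rays for at least five points.
      let F : ι → Bool × Bool := fun i =>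
        (decide (cr (a i) f = 0), if cr (a i) f = 0 then decide (0 < dt (a i) f)
          else decide (0 < dt (a i) e))
      have hF : ¬ Function.Injective F := by
        intro hinj
        have := Nat.card_le_card_of_injective F hinj
        simp at this
        omega
      simp only [Function.Injective, not_forall] at hF
      obtain ⟨i, j, hij, hne⟩ := hF
      have hai : ∀ i, 0 < dt (a i) (a i) := by
        intro i
        have := h1 i
        by_contra hc
        simp only [dt] at hc
        have x0 : a i 0 = 0 := by nlinarith [sq_nonneg (a i 0), sq_nonneg (a i 1)]
        have x1 : a i 1 = 0 := by nlinarith [sq_nonneg (a i 0), sq_nonneg (a i 1)]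
        simp [cr, x0, x1] at this
      have par : ∀ g : Plane, 0 < dt g g → cr (a i) g = 0 → cr (a j) g = 0 →
          (0 < dt (a i) g ↔ 0 < dt (a j) g) → False := by
        intro g hg hi hj hiff
        have c0 : cr (a i) (a j) = 0 := by
          have : dt g g * cr (a i) (a j) = 0 := by
            simp only [cr, dt] at hi hj ⊢
            linear_combination (a j 0 * g 0 + a j 1 * g 1) * hi - (a i 0 * g 0 + a i 1 * g 1) * hj
          exact (mul_eq_zero.1 this).resolve_left hg.ne'
        have d0 : 0 < dt (a i) (a j) := by
          have e1 : dt g g * dt (a i) (a j) = dt (a i) g * dt (a j) g := by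
            simp only [cr, dt] at hi hj ⊢
            linear_combination (a j 0 * g 1 - a j 1 * g 0) * hi
          have sq : ∀ k, cr (a k) g = 0 → dt (a k) g ≠ 0 := by
            intro k hk h0
            have : dt (a k) (a k) * dt g g = 0 := by
              have : dt (a k) (a k) * dt g g = cr (a k) g ^ 2 + dt (a k) g ^ 2 := by
                simp only [cr, dt]; ring
              rw [this, hk, h0]; ring
            exact (mul_pos (hai k) hg).ne' this
          have : 0 < dt (a i) g * dt (a j) g := by
            by_cases h : 0 < dt (a i) g
            · exact mul_pos h (hiff.1 h)
            · exact mul_pos_of_neg_of_neg (lt_of_le_of_ne (not_lt.1 h) (sq i hi))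
                (lt_of_le_of_ne (not_lt.1 (fun h' => h (hiff.2 h'))) (sq j hj))
          rw [← e1] at this
          exact pos_of_mul_pos_right this hg.le
        rcases h5 i j hne with h | h
        · linarith
        · exact h c0
      simp only [F, Prod.mk.injEq, decide_eq_decide] at hij
      obtain ⟨hij1, hij2⟩ := hij
      by_cases hi : cr (a i) f = 0
      · have hj := hij1.1 hi
        rw [if_pos hi, if_pos hj, decide_eq_decide] at hij2
        exact par f (hai _) hi hj hij2
      · have hj : ¬ cr (a j) f = 0 := fun h => hi (hij1.2 h)
        rw [if_neg hi, if_neg hj, decide_eq_decide] at hij2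
        have anti : ∀ x y : Plane, cr y x = - cr x y := fun x y => by simp only [cr]; ring
        refine par e (hai _) ?_ ?_ hij2
        · rw [anti, (hz i).resolve_left hi, neg_zero]
        · rw [anti, (hz j).resolve_left hj, neg_zero]
  · exfalso
    have hn : 0 < c 0 ^ 2 + c 1 ^ 2 := by
      by_contra h
      exact hl ⟨by nlinarith [sq_nonneg (c 0), sq_nonneg (c 1)],
        by nlinarith [sq_nonneg (c 0), sq_nonneg (c 1)]⟩
    have hc : ∀ i j, (-c 1 * a i 0 + c 0 * a i 1) * (-(c 0 * a j 0 + c 1 * a j 1)) -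
        (-(c 0 * a i 0 + c 1 * a i 1)) * (-c 1 * a j 0 + c 0 * a j 1) =
        (c 0 ^ 2 + c 1 ^ 2) * cr (a i) (a j) := by
      intro i j
      simp only [cr]
      ring
    -- Rotated and scaled coordinates in which `Y` is minus the linear part of the polynomial; cross
    -- products are multiplied by the positive number `c 0 ^ 2 + c 1 ^ 2`.
    refine no_conic (fun i => -c 1 * a i 0 + c 0 * a i 1)
      (fun i => -(c 0 * a i 0 + c 1 * a i 1)) s
      (A := (c 2 * c 1 ^ 2 - c 3 * (c 1 * c 0) + c 4 * c 0 ^ 2) / (c 0 ^ 2 + c 1 ^ 2) ^ 2)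
      (B := (2 * c 2 * c 0 * c 1 + c 3 * (c 1 ^ 2 - c 0 ^ 2) - 2 * c 4 * c 0 * c 1) /
        (c 0 ^ 2 + c 1 ^ 2) ^ 2)
      (C := (c 2 * c 0 ^ 2 + c 3 * (c 0 * c 1) + c 4 * c 1 ^ 2) / (c 0 ^ 2 + c 1 ^ 2) ^ 2)
      ?_ ?_ ?_ ?_
    · intro i
      have := hq i
      simp only [quad] at this
      field_simp
      linear_combination -(c 0 ^ 2 + c 1 ^ 2) ^ 2 * this
    · intro i
      simp only [hc]
      exact mul_pos hn (h1 i)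
    · intro i
      simp only [hc]
      exact mul_nonneg hn.le (h2 i)
    · intro i
      simp only [hc, ← mul_add]
      exact mul_le_mul_of_nonneg_left (h3 i) hn.le

/-! ### Compactness of the set of stars -/

theorem continuous_cr {α : Type*} [TopologicalSpace α] {f g : α → Plane} (hf : Continuous f)
    (hg : Continuous g) : Continuous fun x => cr (f x) (g x) := by
  unfold cr
  fun_prop

theorem continuous_dt {α : Type*} [TopologicalSpace α] {f g : α → Plane} (hf : Continuous f)
    (hg : Continuous g) : Continuous fun x => dt (f x) (g x) := by
  unfold dt
  fun_prop

/-- The conditions on the (scaled) edge vectors at an interior vertex; `s` maps each one to the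
next one in counterclockwise order. -/
structure IsStar {ι : Type*} (R c : ℝ) (a : ι → Plane) (s : ι → ι) : Prop where
  norm_le : ∀ i, ‖a i‖ ≤ R
  next : ∀ i, c ≤ cr (a i) (a (s i))
  angle : ∀ i, 0 ≤ cr (a i) (a (s (s i)))
  convex : ∀ i, cr (a i) (a (s (s i))) ≤ cr (a i) (a (s i)) + cr (a (s i)) (a (s (s i)))
  rays : ∀ i j, i ≠ j → dt (a i) (a j) ≤ 0 ∨ c ≤ |cr (a i) (a j)|

theorem isClosed_isStar {ι : Type*} (R c : ℝ) (s : ι → ι) :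
    IsClosed {a : ι → Plane | IsStar R c a s} := by
  have : {a : ι → Plane | IsStar R c a s} =
      (⋂ i, {a | ‖a i‖ ≤ R}) ∩ (⋂ i, {a | c ≤ cr (a i) (a (s i))}) ∩
      (⋂ i, {a | 0 ≤ cr (a i) (a (s (s i)))}) ∩
      (⋂ i, {a | cr (a i) (a (s (s i))) ≤
        cr (a i) (a (s i)) + cr (a (s i)) (a (s (s i)))}) ∩
      (⋂ i, ⋂ j, ⋂ (_ : i ≠ j), ({a | dt (a i) (a j) ≤ 0} ∪ {a | c ≤ |cr (a i) (a j)|})) := by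
    ext a
    simp only [Set.mem_ofPred_eq, Set.mem_inter_iff, Set.mem_iInter, Set.mem_union]
    constructor
    · rintro ⟨h1, h2, h3, h4, h5⟩
      exact ⟨⟨⟨⟨h1, h2⟩, h3⟩, h4⟩, h5⟩
    · rintro ⟨⟨⟨⟨h1, h2⟩, h3⟩, h4⟩, h5⟩
      exact ⟨h1, h2, h3, h4, h5⟩
  rw [this]
  have hc : ∀ i j, Continuous fun a : ι → Plane => cr (a i) (a j) := fun i j =>
    continuous_cr (continuous_apply i) (continuous_apply j)
  have hd : ∀ i j, Continuous fun a : ι → Plane => dt (a i) (a j) := fun i j =>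
    continuous_dt (continuous_apply i) (continuous_apply j)
  refine IsClosed.inter (IsClosed.inter (IsClosed.inter (IsClosed.inter ?_ ?_) ?_) ?_) ?_
  · exact isClosed_iInter fun i => isClosed_le (continuous_apply i).norm continuous_const
  · exact isClosed_iInter fun i => isClosed_le continuous_const (hc _ _)
  · exact isClosed_iInter fun i => isClosed_le continuous_const (hc _ _)
  · exact isClosed_iInter fun i => isClosed_le (hc _ _) ((hc _ _).add (hc _ _))
  · exact isClosed_iInter fun i => isClosed_iInter fun j => isClosed_iInter fun _ =>
      (isClosed_le (hd _ _) continuous_const).union (isClosed_le continuous_const (hc _ _).abs)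

theorem continuous_quad {α : Type*} [TopologicalSpace α] {f : α → Fin 5 → ℝ} {g : α → Plane}
    (hf : Continuous f) (hg : Continuous g) : Continuous fun x => quad (f x) (g x) := by
  unfold quad
  fun_prop

theorem quad_smul (t : ℝ) (c : Fin 5 → ℝ) (y : Plane) : quad (t • c) y = t * quad c y := by
  simp only [quad, Pi.smul_apply, smul_eq_mul]
  ring

/-- For fixed `n` and `s` the stars form a compact set, and so do the normalized coefficients. The
sum of the squared values has no zero there by `quad_eq_zero`, hence it has a positive minimum. -/
theorem exists_quad_bound_fin {n : ℕ} (hn : 5 ≤ n) (s : Fin n → Fin n) (R : ℝ) {c : ℝ}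
    (hc : 0 < c) : ∃ C : ℝ, 0 < C ∧ ∀ a : Fin n → Plane, IsStar R c a s →
      ∀ (k : Fin 5 → ℝ) (M : ℝ), (∀ i, |quad k (a i)| ≤ M) → ∀ m, |k m| ≤ C * M := by
  set S : Set ((Fin n → Plane) × (Fin 5 → ℝ)) :=
    {a | IsStar R c a s} ×ˢ Metric.sphere (0 : Fin 5 → ℝ) 1 with hS
  have hcomp : IsCompact S := by
    refine IsCompact.prod ?_ (isCompact_sphere _ _)
    refine Metric.isCompact_of_isClosed_isBounded (isClosed_isStar R c s) ?_
    rw [isBounded_iff_forall_norm_le]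
    refine ⟨max R 0, fun a ha => ?_⟩
    rw [pi_norm_le_iff_of_nonneg (le_max_right _ _)]
    exact fun i => (ha.norm_le i).trans (le_max_left _ _)
  set F : (Fin n → Plane) × (Fin 5 → ℝ) → ℝ := fun p => ∑ i, (quad p.2 (p.1 i)) ^ 2 with hF
  have hFc : Continuous F := by
    refine continuous_finsetSum _ fun i _ => Continuous.pow ?_ 2
    exact continuous_quad continuous_snd ((continuous_apply i).comp continuous_fst)
  have hlow : ∃ m : ℝ, 0 < m ∧ ∀ p ∈ S, m ≤ F p := by
    rcases S.eq_empty_or_nonempty with he | hne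
    · exact ⟨1, one_pos, by simp [he]⟩
    · obtain ⟨p, hp, hmin⟩ := hcomp.exists_isMinOn hne hFc.continuousOn
      refine ⟨F p, ?_, fun q hq => hmin hq⟩
      have h0 : 0 ≤ F p := Finset.sum_nonneg fun i _ => sq_nonneg _
      refine lt_of_le_of_ne h0 fun h => ?_
      obtain ⟨hp1, hp2⟩ := hp
      have hz : ∀ i, quad p.2 (p.1 i) = 0 := by
        intro i
        have := (Finset.sum_eq_zero_iff_of_nonneg (fun i _ => sq_nonneg _)).1 h.symm i
          (Finset.mem_univ i)
        exact pow_eq_zero_iff (two_ne_zero) |>.1 this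
      have := quad_eq_zero p.1 s (by simpa using hn)
        (fun i => hc.trans_le (hp1.next i)) hp1.angle hp1.convex
        (fun i j hij => (hp1.rays i j hij).imp id fun h h' => by
          rw [h', abs_zero] at h; linarith) p.2 hz
      rw [this] at hp2
      simp at hp2
  obtain ⟨m, hm, hmF⟩ := hlow
  refine ⟨Real.sqrt (n / m), by positivity, fun a ha k M hM j => ?_⟩
  have hM0 : 0 ≤ M := (abs_nonneg _).trans (hM ⟨0, by omega⟩)
  refine (norm_le_pi_norm k j).trans ?_
  by_cases hk : k = 0
  · rw [hk, norm_zero]; positivity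
  have hk' : 0 < ‖k‖ := norm_pos_iff.2 hk
  have h1 : m ≤ F (a, ‖k‖⁻¹ • k) := by
    refine hmF _ ⟨ha, ?_⟩
    simp [norm_smul, hk'.ne']
  have h2 : F (a, ‖k‖⁻¹ • k) ≤ ‖k‖⁻¹ ^ 2 * (n * M ^ 2) := by
    simp only [hF, quad_smul, mul_pow, ← Finset.mul_sum]
    refine mul_le_mul_of_nonneg_left ?_ (by positivity)
    refine (Finset.sum_le_card_nsmul _ _ (M ^ 2) fun i _ => ?_).trans (by simp)
    exact sq_le_sq' (abs_le.1 (hM i)).1 (abs_le.1 (hM i)).2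
  have h3 : ‖k‖ ^ 2 ≤ n / m * M ^ 2 := by
    have := h1.trans h2
    field_simp at this ⊢
    linarith
  rw [← Real.sqrt_sq hM0, ← Real.sqrt_mul (by positivity)]
  exact Real.le_sqrt_of_sq_le h3

/-- The coefficients of a quadratic polynomial without constant term are bounded by its
values at the vertices around an interior vertex with at least five neighbours. -/
theorem exists_quad_bound (N : ℕ) (R : ℝ) {c : ℝ} (hc : 0 < c) :
    ∃ C : ℝ, 0 < C ∧ ∀ (ι : Type) [Finite ι] (a : ι → Plane) (s : ι → ι), 5 ≤ Nat.card ι →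
      Nat.card ι ≤ N → IsStar R c a s →
      ∀ (k : Fin 5 → ℝ) (M : ℝ), (∀ i, |quad k (a i)| ≤ M) → ∀ m, |k m| ≤ C * M := by
  have h : ∀ (n : ℕ) (s : Fin n → Fin n), ∃ C : ℝ, 0 < C ∧ (5 ≤ n → ∀ a : Fin n → Plane,
      IsStar R c a s → ∀ (k : Fin 5 → ℝ) (M : ℝ), (∀ i, |quad k (a i)| ≤ M) →
      ∀ m, |k m| ≤ C * M) := by
    intro n s
    by_cases hn : 5 ≤ n
    · obtain ⟨C, h, h'⟩ := exists_quad_bound_fin hn s R hc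
      exact ⟨C, h, fun _ => h'⟩
    · exact ⟨1, one_pos, fun h => absurd h hn⟩
  choose C hC0 hC using h
  -- There are only finitely many sizes and successor maps, and the sum dominates the constant of
  -- each of them.
  refine ⟨1 + ∑ n ∈ Finset.range (N + 1), ∑ s : Fin n → Fin n, C n s, ?_, ?_⟩
  · have : 0 ≤ ∑ n ∈ Finset.range (N + 1), ∑ s : Fin n → Fin n, C n s :=
      Finset.sum_nonneg fun n _ => Finset.sum_nonneg fun s _ => (hC0 n s).le
    linarith
  intro ι _ a s h5 hN hs k M hM m
  set n := Nat.card ι with hn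
  let e : ι ≃ Fin n := Finite.equivFin ι
  have hst : IsStar R c (a ∘ e.symm) (e ∘ s ∘ e.symm) := by
    refine ⟨fun i => hs.norm_le _, fun i => ?_, fun i => ?_, fun i => ?_, fun i j hij => ?_⟩
    · simpa using hs.next (e.symm i)
    · simpa using hs.angle (e.symm i)
    · simpa using hs.convex (e.symm i)
    · exact hs.rays _ _ (by simpa using hij)
  have h1 := hC n _ h5 _ hst k M (fun i => hM _) m
  have hM0 : 0 ≤ M := (abs_nonneg _).trans (hM (e.symm ⟨0, by omega⟩))
  refine h1.trans (mul_le_mul_of_nonneg_right ?_ hM0)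
  have h2 : C n (e ∘ s ∘ e.symm) ≤ ∑ s : Fin n → Fin n, C n s :=
    Finset.single_le_sum (f := fun s => C n s) (fun s _ => (hC0 n s).le) (Finset.mem_univ _)
  have h3 : ∑ s : Fin n → Fin n, C n s ≤
      ∑ n ∈ Finset.range (N + 1), ∑ s : Fin n → Fin n, C n s :=
    Finset.single_le_sum (f := fun n => ∑ s : Fin n → Fin n, C n s)
      (fun n _ => Finset.sum_nonneg fun s _ => (hC0 n s).le)
      (Finset.mem_range.2 (by omega))
  linarith

end Plate

namespace Plate

/-! ### Displacements with a given affine strain -/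

theorem abs_apply_le_norm (x : Plane) (i : Fin 2) : |x i| ≤ ‖x‖ := by
  simpa using PiLp.norm_apply_le x i

theorem norm_sq_eq (x : Plane) : ‖x‖ ^ 2 = x 0 ^ 2 + x 1 ^ 2 := by
  rw [EuclideanSpace.norm_sq_eq, Fin.sum_univ_two]
  simp

theorem abs_cr_le (x y : Plane) : |cr x y| ≤ ‖x‖ * ‖y‖ := by
  refine abs_le_of_sq_le_sq ?_ (by positivity)
  rw [mul_pow, norm_sq_eq, norm_sq_eq, cr]
  nlinarith [sq_nonneg (x 0 * y 0 + x 1 * y 1)]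

theorem plane_ext {x y : Plane} (h0 : x 0 = y 0) (h1 : x 1 = y 1) : x = y := by
  ext i
  fin_cases i
  · exact h0
  · exact h1

/-- `|d|²` times the normal-normal component of `A` on an edge with direction `d`. -/
def normalForm (A : Mat) (d : Plane) : ℝ :=
  A 0 0 * d 1 ^ 2 - (A 0 1 + A 1 0) * (d 0 * d 1) + A 1 1 * d 0 ^ 2

/-- The symmetric matrix field `y ↦ r (z + h y)`, rotated by a quarter turn, is the symmetric
gradient of the vector field with components `quad k` and `quad l`. -/
structure IsStrain (r : Plane →ᵃ[ℝ] Mat) (z : Plane) (h : ℝ) (k l : Fin 5 → ℝ) : Prop where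
  eq11 : ∀ y : Plane, r (z + h • y) 1 1 = k 0 + 2 * k 2 * y 0 + k 3 * y 1
  eq00 : ∀ y : Plane, r (z + h • y) 0 0 = l 1 + l 3 * y 0 + 2 * l 4 * y 1
  eq01 : ∀ y : Plane, r (z + h • y) 0 1 =
    -(k 1 + k 3 * y 0 + 2 * k 4 * y 1 + l 0 + 2 * l 2 * y 0 + l 3 * y 1) / 2
  symm : ∀ y : Plane, r (z + h • y) 1 0 = r (z + h • y) 0 1

theorem affine_apply (r : Plane →ᵃ[ℝ] Mat) (z : Plane) (h : ℝ) (y : Plane) (i j : Fin 2) :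
    r (z + h • y) i j = r z i j + h * (r.linear (EuclideanSpace.single 0 1) i j) * y 0 +
      h * (r.linear (EuclideanSpace.single 1 1) i j) * y 1 := by
  have e : z + h • y = (h • (y 0 • EuclideanSpace.single (0 : Fin 2) (1 : ℝ) +
      y 1 • EuclideanSpace.single (1 : Fin 2) (1 : ℝ)) : Plane) +ᵥ z := by
    rw [vadd_eq_add, add_comm]
    congr 2
    apply plane_ext <;> simp
  rw [e, AffineMap.map_vadd]
  simp only [map_smul, map_add, vadd_eq_add, Matrix.add_apply, Matrix.smul_apply, smul_eq_mul]
  ring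

/-- Nine parameters of the field face ten of the two quadratic polynomials. The surplus one, `w`, is
the infinitesimal rotation about `z`, and it is chosen such that the displacement at `a` is parallel
to `a`. -/
theorem exists_isStrain (r : Plane →ᵃ[ℝ] Mat) (hr : ∀ x, (r x).IsSymm) (z : Plane) (h : ℝ)
    (a : Plane) (ha : 0 < ‖a‖) :
    ∃ k l, IsStrain r z h k l ∧ quad l a * a 0 - quad k a * a 1 = 0 := by
  have hs : ∀ x, r x 1 0 = r x 0 1 := fun x => (hr x).apply 0 1
  have hr' := affine_apply r z h
  set L0 := r.linear (EuclideanSpace.single 0 1)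
  set L1 := r.linear (EuclideanSpace.single 1 1)
  set k : ℝ → Fin 5 → ℝ := fun w => ![r z 1 1, -2 * r z 0 1 - w, h * L0 1 1 / 2, h * L1 1 1,
    -(h * L1 0 1) - h * L0 0 0 / 2] with hk
  set l : ℝ → Fin 5 → ℝ := fun w => ![w, r z 0 0, -(h * L0 0 1) - h * L1 1 1 / 2, h * L0 0 0,
    h * L1 0 0 / 2] with hl
  have hst : ∀ w, IsStrain r z h (k w) (l w) := by
    intro w
    refine ⟨fun y => ?_, fun y => ?_, fun y => ?_, fun y => hs _⟩ <;> rw [hr'] <;>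
      simp [hk, hl, -mul_eq_mul_right_iff] <;> ring
  have hq : ∀ w, quad (l w) a * a 0 - quad (k w) a * a 1 =
      quad (l 0) a * a 0 - quad (k 0) a * a 1 + w * ‖a‖ ^ 2 := by
    intro w
    rw [norm_sq_eq]
    simp [quad, hk, hl]
    ring
  set w := -(quad (l 0) a * a 0 - quad (k 0) a * a 1) / ‖a‖ ^ 2
  refine ⟨k w, l w, hst w, ?_⟩
  rw [hq]
  simp only [w]
  field_simp
  ring

/-- The increment of a quadratic polynomial along a segment is its derivative at the midpoint. Of
the gradient of the displacement, only the symmetric part contributes to the component along the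
segment. -/
theorem IsStrain.edge {r : Plane →ᵃ[ℝ] Mat} {z : Plane} {h : ℝ} {k l : Fin 5 → ℝ}
    (hs : IsStrain r z h k l) (y y' : Plane) :
    (quad k y' - quad k y) * (y' 0 - y 0) + (quad l y' - quad l y) * (y' 1 - y 1) =
      normalForm (r (z + h • ((2 : ℝ)⁻¹ • (y + y')))) (y' - y) := by
  rw [normalForm, hs.symm, hs.eq00, hs.eq11, hs.eq01]
  simp [quad]
  ring

/-- Bound of a displacement at the third vertex of a triangle. -/
theorem rigid_step {R c η M : ℝ} (hR : 0 < R) (hc : 0 < c) (hη : η ≤ M)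
    {k l : Fin 5 → ℝ} {a b d : Plane} (ha : ‖d - a‖ ≤ R) (hb : ‖d - b‖ ≤ R)
    (hcr : c ≤ |cr (d - a) (d - b)|)
    (hka : |quad k a| ≤ M) (hla : |quad l a| ≤ M) (hkb : |quad k b| ≤ M) (hlb : |quad l b| ≤ M)
    (hda : |(quad k d - quad k a) * (d 0 - a 0) + (quad l d - quad l a) * (d 1 - a 1)| ≤ η)
    (hdb : |(quad k d - quad k b) * (d 0 - b 0) + (quad l d - quad l b) * (d 1 - b 1)| ≤ η) :
    |quad k d| ≤ (1 + 2 * (1 + 2 * R) * R / c) * M ∧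
      |quad l d| ≤ (1 + 2 * (1 + 2 * R) * R / c) * M := by
  have hM0 : 0 ≤ M := (abs_nonneg _).trans hka
  have hab : ∀ x : Plane, ‖x‖ ≤ R → ∀ i, |x i| ≤ R := fun x hx i => (abs_apply_le_norm x i).trans hx
  have side : ∀ e : Plane, ‖d - e‖ ≤ R → |quad k e| ≤ M → |quad l e| ≤ M →
      |(quad k d - quad k e) * (d 0 - e 0) + (quad l d - quad l e) * (d 1 - e 1)| ≤ η →
      |quad k d * (d - e) 0 + quad l d * (d - e) 1| ≤ (1 + 2 * R) * M := by
    intro e he hk hl hd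
    have e1 : quad k d * (d - e) 0 + quad l d * (d - e) 1 =
        ((quad k d - quad k e) * (d 0 - e 0) + (quad l d - quad l e) * (d 1 - e 1)) +
        quad k e * (d - e) 0 + quad l e * (d - e) 1 := by
      simp; ring
    rw [e1]
    have h1 : |quad k e * (d - e) 0| ≤ M * R := by
      rw [abs_mul]; exact mul_le_mul hk (hab _ he 0) (abs_nonneg _) hM0
    have h2 : |quad l e * (d - e) 1| ≤ M * R := by
      rw [abs_mul]; exact mul_le_mul hl (hab _ he 1) (abs_nonneg _) hM0
    have := abs_add_three ((quad k d - quad k e) * (d 0 - e 0) +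
      (quad l d - quad l e) * (d 1 - e 1)) (quad k e * (d - e) 0) (quad l e * (d - e) 1)
    linarith
  have sa := side a ha hka hla hda
  have sb := side b hb hkb hlb hdb
  set x := d - a
  set y := d - b
  -- Cramer's rule: the components along the two sides `x`, `y` determine the displacement at `d`,
  -- and the area keeps `cr x y` away from zero.
  have fin : ∀ g p q p' q' : ℝ, |p| ≤ (1 + 2 * R) * M → |q| ≤ (1 + 2 * R) * M → |p'| ≤ R →
      |q'| ≤ R → g * cr x y = p * p' + q * q' → |g| ≤ (1 + 2 * (1 + 2 * R) * R / c) * M := by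
    intro g p q p' q' hp hq hp' hq' he
    have h1 : |g| * c ≤ 2 * ((1 + 2 * R) * M * R) := by
      calc |g| * c ≤ |g| * |cr x y| := mul_le_mul_of_nonneg_left hcr (abs_nonneg _)
        _ = |p * p' + q * q'| := by rw [← abs_mul, he]
        _ ≤ |p| * |p'| + |q| * |q'| := by rw [← abs_mul, ← abs_mul]; exact abs_add_le _ _
        _ ≤ (1 + 2 * R) * M * R + (1 + 2 * R) * M * R := by gcongr
        _ = _ := by ring
    have h2 : |g| ≤ 2 * (1 + 2 * R) * R / c * M := by
      rw [div_mul_eq_mul_div, le_div_iff₀ hc]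
      linarith
    linarith
  constructor
  · exact fin _ (quad k d * x 0 + quad l d * x 1) (quad k d * y 0 + quad l d * y 1) (y 1) (-x 1)
      sa sb (hab _ hb 1) (by rw [abs_neg]; exact hab _ ha 1) (by simp only [cr]; ring)
  · exact fin _ (quad k d * x 0 + quad l d * x 1) (quad k d * y 0 + quad l d * y 1) (-y 0) (x 0)
      sa sb (by rw [abs_neg]; exact hab _ hb 0) (hab _ ha 0) (by simp only [cr]; ring)

/-- Bound of a displacement at an endpoint of an edge from the origin, if it has no component
orthogonal to this edge. -/
theorem rigid_base {R c η : ℝ} (hc : 0 < c) (hη : 0 ≤ η) {k l : Fin 5 → ℝ}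
    {a : Plane} (ha : ‖a‖ ≤ R) (hac : c ≤ ‖a‖) (h0 : quad l a * a 0 - quad k a * a 1 = 0)
    (he : |quad k a * a 0 + quad l a * a 1| ≤ η) :
    |quad k a| ≤ R / c ^ 2 * η ∧ |quad l a| ≤ R / c ^ 2 * η := by
  have hsq : c ^ 2 ≤ ‖a‖ ^ 2 := pow_le_pow_left₀ hc.le hac 2
  have fin : ∀ g p : ℝ, |p| ≤ R → g * ‖a‖ ^ 2 = (quad k a * a 0 + quad l a * a 1) * p →
      |g| ≤ R / c ^ 2 * η := by
    intro g p hp h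
    rw [div_mul_eq_mul_div, le_div_iff₀ (by positivity)]
    calc |g| * c ^ 2 ≤ |g| * ‖a‖ ^ 2 := mul_le_mul_of_nonneg_left hsq (abs_nonneg _)
      _ = |g * ‖a‖ ^ 2| := by rw [abs_mul, abs_of_nonneg (sq_nonneg ‖a‖)]
      _ = |quad k a * a 0 + quad l a * a 1| * |p| := by rw [h, abs_mul]
      _ ≤ η * R := mul_le_mul he hp (abs_nonneg _) hη
      _ = R * η := mul_comm _ _
  constructor
  · refine fin _ (a 0) ((abs_apply_le_norm _ _).trans ha) ?_
    rw [norm_sq_eq]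
    linear_combination -(a 1) * h0
  · refine fin _ (a 1) ((abs_apply_le_norm _ _).trans ha) ?_
    rw [norm_sq_eq]
    linear_combination (a 0) * h0

/-! ### Chains of triangles -/

theorem ShareEdge.symm {T T' : Finset Plane} (h : ShareEdge T T') : ShareEdge T' T := by
  obtain ⟨a, b, h1, h2, h3, h4, h5, h6⟩ := h
  exact ⟨a, b, h1, h3, h2, h5, h4, h6.symm⟩

/-- A bound that deteriorates by a factor `B` from a triangle to an adjacent one. -/
theorem EdgeConnected.chain_bound {S : Finset (Finset Plane)} (hS : EdgeConnected S) {n : ℕ}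
    (hn : S.card ≤ n) {P : ℝ → Finset Plane → Prop} {B M₀ : ℝ} (hB : 1 ≤ B) (hM₀ : 0 ≤ M₀)
    (mono : ∀ A M M', M ≤ M' → P M A → P M' A)
    (step : ∀ A ∈ S, ∀ A' ∈ S, ShareEdge A A' → ∀ M, M₀ ≤ M → P M A → P (B * M) A')
    {T T' : Finset Plane} (hT : T ∈ S) (hT' : T' ∈ S) {M : ℝ} (hM : M₀ ≤ M) (h : P M T) :
    P (B ^ n * M) T' := by
  classical
  let G : SimpleGraph {x // x ∈ S} :=
    { Adj := fun A A' => ShareEdge A.1 A'.1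
      symm := ⟨fun A A' h => h.symm⟩
      loopless := ⟨fun A h => by obtain ⟨a, b, _, _, _, _, _, h6⟩ := h; exact h6 rfl⟩ }
  have hreach : ∀ A' (hA' : A' ∈ S), G.Reachable ⟨T, hT⟩ ⟨A', hA'⟩ := by
    intro A' hA'
    have := hS T hT A' hA'
    induction this with
    | refl => exact SimpleGraph.Reachable.refl _
    | @tail b c hb hbc ih =>
      have hbS : b ∈ S := by
        rcases Relation.ReflTransGen.cases_tail hb with h | ⟨d, _, h⟩
        · rw [h]; exact hT
        · exact h.1
      refine (ih hbS).trans (SimpleGraph.Adj.reachable ?_)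
      exact hbc.2
  obtain ⟨p⟩ := hreach T' hT'
  have hM0 : 0 ≤ M := hM₀.trans hM
  have hw : ∀ (u v : {x // x ∈ S}) (q : G.Walk u v) (M : ℝ), M₀ ≤ M → P M u.1 →
      P (B ^ q.length * M) v.1 := by
    intro u v q
    induction q with
    | nil => intro M _ h; simpa using h
    | @cons u v w hadj q ih =>
      intro M hM h
      have h1 := step u.1 u.2 v.1 v.2 hadj M hM h
      have h2 := ih (B * M) (by nlinarith) h1
      rw [SimpleGraph.Walk.length_cons, pow_succ, mul_assoc]
      exact h2
  -- A chain without repeated triangles has fewer steps than there are triangles in `S`, so the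
  -- exponent does not depend on the given chain.
  have hlen : p.toPath.1.length ≤ n := by
    have := p.toPath.2.length_lt
    rw [Fintype.card_coe] at this
    omega
  refine mono _ _ _ ?_ (hw _ _ p.toPath.1 M hM h)
  exact mul_le_mul_of_nonneg_right (pow_le_pow_right₀ hB hlen) hM0

theorem ShareEdge.exists_vertices {T T' : Finset Plane} (h : ShareEdge T T') (hT : T.card = 3)
    (hT' : T'.card = 3) : ∃ a b c d : Plane, a ≠ b ∧ c ≠ a ∧ c ≠ b ∧ d ≠ a ∧ d ≠ b ∧ c ≠ d ∧
      T = {a, b, c} ∧ T' = {a, b, d} := by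
  classical
  obtain ⟨a, b, hab, ha, ha', hb, hb', hne⟩ := h
  have third : ∀ A : Finset Plane, A.card = 3 → a ∈ A → b ∈ A →
      ∃ c, c ≠ a ∧ c ≠ b ∧ A = {a, b, c} := by
    intro A hA ha hb
    have h2 : ({a, b} : Finset Plane) ⊆ A := by
      intro x hx
      simp only [Finset.mem_insert, Finset.mem_singleton] at hx
      rcases hx with rfl | rfl <;> assumption
    have h1 : (A \ {a, b}).card = 1 := by
      rw [Finset.card_sdiff_of_subset h2, hA, Finset.card_pair hab]
    obtain ⟨c, hc⟩ := Finset.card_eq_one.1 h1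
    have hcm : c ∈ A \ {a, b} := by rw [hc]; exact Finset.mem_singleton_self c
    simp only [Finset.mem_sdiff, Finset.mem_insert, Finset.mem_singleton, not_or] at hcm
    refine ⟨c, hcm.2.1, hcm.2.2, ?_⟩
    rw [← Finset.sdiff_union_of_subset h2, hc]
    ext x
    simp only [Finset.mem_union, Finset.mem_insert, Finset.mem_singleton]
    tauto
  obtain ⟨c, h1, h2, hTc⟩ := third T hT ha hb
  obtain ⟨d, h3, h4, hTd⟩ := third T' hT' ha' hb'
  refine ⟨a, b, c, d, hab, h1, h2, h3, h4, ?_, hTc, hTd⟩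
  rintro rfl
  exact hne (hTc.trans hTd.symm)

/-! ### Normal-normal components -/

/-- The quarter turn of the normalized edge vector shows that the choice in `edgeNormal` is not
void. -/
theorem edgeNormal_spec {a b : Plane} (hab : a ≠ b) :
    (edgeNormal {a, b} 0) ^ 2 + (edgeNormal {a, b} 1) ^ 2 = 1 ∧
      edgeNormal {a, b} 0 * (b - a) 0 + edgeNormal {a, b} 1 * (b - a) 1 = 0 := by
  have hex : ∃ n : Plane, ‖n‖ = 1 ∧ ∀ x ∈ ({a, b} : Finset Plane), ∀ y ∈ ({a, b} : Finset Plane),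
      inner ℝ n (y - x) = 0 := by
    have hn : 0 < ‖b - a‖ := norm_pos_iff.2 (sub_ne_zero.2 hab.symm)
    refine ⟨‖b - a‖⁻¹ • !₂[-(b - a) 1, (b - a) 0], ?_, ?_⟩
    · have : ‖(!₂[-(b - a) 1, (b - a) 0] : Plane)‖ = ‖b - a‖ := by
        rw [← sq_eq_sq₀ (norm_nonneg _) (norm_nonneg _), norm_sq_eq, norm_sq_eq]
        simp
        ring
      rw [norm_smul, this, norm_inv, norm_norm, inv_mul_cancel₀ hn.ne']
    · intro x hx y hy
      simp only [Finset.mem_insert, Finset.mem_singleton] at hx hy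
      rcases hx with rfl | rfl <;> rcases hy with rfl | rfl <;>
        simp [inner_smul_left, EuclideanSpace.inner_eq_star_dotProduct, dotProduct,
          Fin.sum_univ_two, -mul_eq_zero] <;> ring
  have hs := Classical.epsilon_spec hex
  change ‖edgeNormal {a, b}‖ = 1 ∧ _ at hs
  refine ⟨?_, ?_⟩
  · rw [← norm_sq_eq, hs.1, one_pow]
  · have := hs.2 a (by simp) b (by simp)
    rw [EuclideanSpace.inner_eq_star_dotProduct] at this
    change inner ℝ (edgeNormal {a, b}) (b - a) = 0 at this
    rw [PiLp.inner_apply, Fin.sum_univ_two] at this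
    simpa [mul_comm] using this

/-- Up to its sign the unit normal is the quarter turn of `(b - a) / ‖b - a‖`, so each product `n i
* n j` is known. -/
theorem normalForm_eq {a b : Plane} (hab : a ≠ b) (A : Mat) :
    normalForm A (b - a) = ‖b - a‖ ^ 2 * normalNormal {a, b} A := by
  obtain ⟨h1, h2⟩ := edgeNormal_spec hab
  rw [norm_sq_eq]
  simp only [normalNormal, normalForm, Fin.sum_univ_two]
  set n := edgeNormal {a, b}
  set d := b - a
  have e00 : n 0 ^ 2 * (d 0 ^ 2 + d 1 ^ 2) = d 1 ^ 2 := by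
    linear_combination (n 0 * d 0 - n 1 * d 1) * h2 + d 1 ^ 2 * h1
  have e11 : n 1 ^ 2 * (d 0 ^ 2 + d 1 ^ 2) = d 0 ^ 2 := by
    linear_combination (n 1 * d 1 - n 0 * d 0) * h2 + d 0 ^ 2 * h1
  have e01 : n 0 * n 1 * (d 0 ^ 2 + d 1 ^ 2) = - (d 0 * d 1) := by
    linear_combination (n 1 * d 0 + n 0 * d 1) * h2 - d 0 * d 1 * h1
  linear_combination -(A 0 0) * e00 - A 1 1 * e11 - (A 0 1 + A 1 0) * e01

theorem abs_normalNormal_le {a b : Plane} (hab : a ≠ b) (A : Mat) {M : ℝ}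
    (hA : ∀ i j, |A i j| ≤ M) : |normalNormal {a, b} A| ≤ 4 * M := by
  obtain ⟨h1, -⟩ := edgeNormal_spec hab
  have hM : 0 ≤ M := (abs_nonneg _).trans (hA 0 0)
  have hn : ∀ i, |edgeNormal {a, b} i| ≤ 1 := by
    rw [Fin.forall_fin_two, ← sq_le_one_iff_abs_le_one, ← sq_le_one_iff_abs_le_one]
    constructor <;> linarith [sq_nonneg (edgeNormal {a, b} 0), sq_nonneg (edgeNormal {a, b} 1)]
  have ht : ∀ i j, |edgeNormal {a, b} i * A i j * edgeNormal {a, b} j| ≤ M := by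
    intro i j
    rw [abs_mul, abs_mul]
    have := mul_le_mul (mul_le_mul (hn i) (hA i j) (abs_nonneg _) zero_le_one) (hn j)
      (abs_nonneg _) (by linarith)
    linarith
  simp only [normalNormal, Fin.sum_univ_two]
  have := abs_add_le (edgeNormal {a, b} 0 * A 0 0 * edgeNormal {a, b} 0 +
    edgeNormal {a, b} 0 * A 0 1 * edgeNormal {a, b} 1)
    (edgeNormal {a, b} 1 * A 1 0 * edgeNormal {a, b} 0 +
    edgeNormal {a, b} 1 * A 1 1 * edgeNormal {a, b} 1)
  have := abs_add_le (edgeNormal {a, b} 0 * A 0 0 * edgeNormal {a, b} 0)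
    (edgeNormal {a, b} 0 * A 0 1 * edgeNormal {a, b} 1)
  have := abs_add_le (edgeNormal {a, b} 1 * A 1 0 * edgeNormal {a, b} 0)
    (edgeNormal {a, b} 1 * A 1 1 * edgeNormal {a, b} 1)
  linarith [ht 0 0, ht 0 1, ht 1 0, ht 1 1]

theorem normalNormal_sub (e : Finset Plane) (A B : Mat) :
    normalNormal e (A - B) = normalNormal e A - normalNormal e B := by
  simp only [normalNormal, Fin.sum_univ_two, Matrix.sub_apply]
  ring

end Plate

namespace Plate

/-! ### Triangles -/

theorem mem_hull_triple {a b c x : Plane} :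
    x ∈ convexHull ℝ ((({a, b, c} : Finset Plane)) : Set Plane) ↔
      ∃ s t : ℝ, 0 ≤ s ∧ 0 ≤ t ∧ s + t ≤ 1 ∧ x = a + s • (b - a) + t • (c - a) := by
  have : ((({a, b, c} : Finset Plane)) : Set Plane) = insert a {b, c} := by simp
  rw [this, convexHull_insert (Set.insert_nonempty _ _), convexHull_pair,
    convexJoin_singleton_left]
  simp only [Set.mem_iUnion]
  constructor
  · rintro ⟨y, ⟨p, q, hp, hq, hpq, rfl⟩, ⟨p', q', hp', hq', hpq', rfl⟩⟩
    refine ⟨q' * p, q' * q, by positivity, by positivity, ?_, ?_⟩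
    · rw [← mul_add, hpq]; linarith
    · have e1 : p' = 1 - q' := by linarith
      have e2 : p = 1 - q := by linarith
      subst e1 e2
      module
  · rintro ⟨s, t, hs, ht, hst, rfl⟩
    rcases (add_nonneg hs ht).eq_or_lt with h | h
    · have h1 : s = 0 := by linarith
      have h2 : t = 0 := by linarith
      exact ⟨b, left_mem_segment _ _ _, 1, 0, by norm_num, by norm_num, by norm_num, by
        rw [h1, h2]; module⟩
    · refine ⟨(s / (s + t)) • b + (t / (s + t)) • c, ⟨s / (s + t), t / (s + t), by positivity,
        by positivity, by field_simp, rfl⟩, 1 - (s + t), s + t, by linarith, by linarith,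
        by ring, ?_⟩
      rw [smul_add, smul_smul, smul_smul, mul_div_cancel₀ _ h.ne', mul_div_cancel₀ _ h.ne']
      module

theorem mem_hull_pair {a b x : Plane} (hx : x ∈ convexHull ℝ ({a, b} : Set Plane)) :
    ∃ s : ℝ, x = a + s • (b - a) := by
  rw [convexHull_pair] at hx
  obtain ⟨p, q, hp, hq, hpq, rfl⟩ := hx
  refine ⟨q, ?_⟩
  have : p = 1 - q := by linarith
  subst this
  module

theorem isCompact_hull (T : Finset Plane) : IsCompact (convexHull ℝ (T : Set Plane)) :=
  Set.Finite.isCompact_convexHull ℝ T.finite_toSet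

/-- The linear map that takes the coordinate vectors to `u` and `v`. -/
def frame (u v : Plane) : Plane →ₗ[ℝ] Plane where
  toFun y := y 0 • u + y 1 • v
  map_add' x y := by simp only [PiLp.add_apply]; module
  map_smul' t x := by simp only [PiLp.smul_apply, smul_eq_mul, RingHom.id_apply]; module

theorem frame_apply (u v y : Plane) : frame u v y = y 0 • u + y 1 • v := rfl

theorem det_frame (u v : Plane) : LinearMap.det (frame u v) = cr u v := by
  rw [← LinearMap.det_toMatrix (EuclideanSpace.basisFun (Fin 2) ℝ).toBasis, Matrix.det_fin_two]
  simp [LinearMap.toMatrix_apply, frame_apply, cr]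
  ring

/-- The triangle lies in the parallelogram of its sides. The lost factor `1 / 2` is harmless, since
this only serves to bound cross products from below. -/
theorem volume_triangle_le (a b c : Plane) :
    (volume (convexHull ℝ ((({a, b, c} : Finset Plane)) : Set Plane))).toReal ≤
      |cr (b - a) (c - a)| := by
  set Q := parallelepiped (EuclideanSpace.basisFun (Fin 2) ℝ) with hQ
  have hQv : volume Q = 1 := OrthonormalBasis.volume_parallelepiped _
  have hsub : convexHull ℝ ((({a, b, c} : Finset Plane)) : Set Plane) ⊆
      (fun x => a + x) '' (frame (b - a) (c - a) '' Q) := by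
    intro x hx
    obtain ⟨s, t, hs, ht, hst, rfl⟩ := mem_hull_triple.1 hx
    refine ⟨s • (b - a) + t • (c - a), ⟨!₂[s, t], ?_, ?_⟩, ?_⟩
    · rw [hQ, mem_parallelepiped_iff]
      refine ⟨![s, t], ?_, ?_⟩
      · rw [Set.mem_Icc]
        constructor
        · intro i; fin_cases i <;> simpa
        · intro i; fin_cases i <;> simp <;> linarith
      · apply plane_ext <;> simp [Fin.sum_univ_two]
    · simp [frame_apply]
    · simp only []
      module
  have h1 := measure_mono (μ := volume) hsub
  rw [Set.image_add_left, measure_preimage_add,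
    Measure.addHaar_image_linearMap, hQv, mul_one, det_frame] at h1
  exact ENNReal.toReal_le_of_le_ofReal (abs_nonneg _) h1

theorem Triangulation.mem_triangles {K : Triangulation} {T : Finset Plane} :
    T ∈ K.triangles ↔ T ∈ K.faces ∧ T.card = 3 := by
  simp [Triangulation.triangles]

theorem dist_le_diam {T : Finset Plane} {x y : Plane}
    (hx : x ∈ convexHull ℝ (T : Set Plane)) (hy : y ∈ convexHull ℝ (T : Set Plane)) :
    dist x y ≤ Metric.diam (convexHull ℝ (T : Set Plane)) :=
  Metric.dist_le_diam_of_mem (isCompact_hull T).isBounded hx hy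

theorem mem_hull {T : Finset Plane} {x : Plane} (hx : x ∈ T) :
    x ∈ convexHull ℝ (T : Set Plane) := subset_convexHull ℝ _ (by simpa using hx)

variable {K : Triangulation} {κ : ℝ}

theorem Triangulation.ShapeRegular.mono (h : K.ShapeRegular κ) {κ' : ℝ} (hκ : κ ≤ κ') :
    K.ShapeRegular κ' := fun T hT =>
  (h T hT).trans (mul_le_mul_of_nonneg_right hκ (Real.sqrt_nonneg _))

theorem Triangulation.ShapeRegular.dist_le (h : K.ShapeRegular κ) {T : Finset Plane}
    (hT : T ∈ K.triangles) {x y : Plane} (hx : x ∈ convexHull ℝ (T : Set Plane))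
    (hy : y ∈ convexHull ℝ (T : Set Plane)) : dist x y ≤ κ * meshSize T :=
  (dist_le_diam hx hy).trans (h T hT)

theorem meshSize_nonneg (T : Finset Plane) : 0 ≤ meshSize T := Real.sqrt_nonneg _

theorem sq_meshSize (T : Finset Plane) :
    meshSize T ^ 2 = (volume (convexHull ℝ (T : Set Plane))).toReal :=
  Real.sq_sqrt ENNReal.toReal_nonneg

/-- Shape regularity alone excludes triangles without area: two distinct vertices have a positive
distance, which is at most `κ * meshSize T`. -/
theorem Triangulation.ShapeRegular.meshSize_pos (h : K.ShapeRegular κ) {T : Finset Plane}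
    (hT : T ∈ K.triangles) : 0 < meshSize T := by
  refine lt_of_le_of_ne (meshSize_nonneg T) fun h0 => ?_
  have hc := (Triangulation.mem_triangles.1 hT).2
  obtain ⟨a, ha, b, hb, hab⟩ := Finset.one_lt_card.1 (by omega : 1 < T.card)
  have := h.dist_le hT (mem_hull ha) (mem_hull hb)
  rw [← h0, mul_zero] at this
  exact hab (dist_le_zero.1 this)

theorem sq_meshSize_le (a b c : Plane) :
    meshSize {a, b, c} ^ 2 ≤ |cr (b - a) (c - a)| := by
  rw [sq_meshSize]
  exact volume_triangle_le a b c

theorem triple_perm {a b c : Plane} {T : Finset Plane} (hT : T.card = 3) (ha : a ∈ T) (hb : b ∈ T)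
    (hc : c ∈ T) (hab : a ≠ b) (hac : c ≠ a) (hbc : c ≠ b) : T = {a, b, c} := by
  classical
  symm
  apply Finset.eq_of_subset_of_card_le
  · intro x hx
    simp only [Finset.mem_insert, Finset.mem_singleton] at hx
    rcases hx with rfl | rfl | rfl <;> assumption
  · rw [hT, Finset.card_eq_three.2 ⟨a, b, c, hab, hac.symm, hbc.symm, rfl⟩]

theorem Triangulation.ShapeRegular.cr_ne_zero (h : K.ShapeRegular κ) {a b c : Plane}
    (hT : ({a, b, c} : Finset Plane) ∈ K.triangles) : cr (b - a) (c - a) ≠ 0 := by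
  intro h0
  have h1 := sq_meshSize_le a b c
  have h2 := h.meshSize_pos hT
  rw [h0, abs_zero] at h1
  nlinarith

/-- The area is at most the product of two side lengths, one of which is bounded by `κ * meshSize
T`. -/
theorem Triangulation.ShapeRegular.dist_ge (h : K.ShapeRegular κ)
    {T : Finset Plane} (hT : T ∈ K.triangles) {a b : Plane} (ha : a ∈ T) (hb : b ∈ T)
    (hab : a ≠ b) : meshSize T ≤ κ * ‖b - a‖ := by
  classical
  have hc := (Triangulation.mem_triangles.1 hT).2
  obtain ⟨c, hcT, hca, hcb⟩ : ∃ c ∈ T, c ≠ a ∧ c ≠ b := by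
    by_contra hcon
    push Not at hcon
    have : T ⊆ {a, b} := fun x hx => by
      by_cases hxa : x = a
      · simp [hxa]
      · simp [hcon x hx hxa]
    have := Finset.card_le_card this
    have := Finset.card_le_two (a := a) (b := b)
    omega
  have hT3 := triple_perm hc ha hb hcT hab hca hcb
  have h1 : meshSize T ^ 2 ≤ |cr (b - a) (c - a)| := by
    rw [hT3]; exact sq_meshSize_le a b c
  have h2 := abs_cr_le (b - a) (c - a)
  have h3 := h.dist_le hT (mem_hull hcT) (mem_hull ha)
  rw [dist_eq_norm] at h3
  have h4 := h.meshSize_pos hT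
  have h5 : meshSize T * meshSize T ≤ (κ * ‖b - a‖) * meshSize T := by
    have := mul_le_mul_of_nonneg_left h3 (norm_nonneg (b - a))
    nlinarith
  exact le_of_mul_le_mul_right h5 h4

theorem Triangulation.ShapeRegular.meshSize_adjacent (h : K.ShapeRegular κ) (hκ : 1 ≤ κ)
    {T T' : Finset Plane} (hT : T ∈ K.triangles) (hT' : T' ∈ K.triangles)
    (hs : ShareEdge T T') : meshSize T' ≤ κ ^ 2 * meshSize T := by
  obtain ⟨a, b, hab, ha, ha', hb, hb', -⟩ := hs
  have h1 := h.dist_ge hT' ha' hb' hab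
  have h2 := h.dist_le hT (mem_hull hb) (mem_hull ha)
  rw [dist_eq_norm] at h2
  nlinarith

/-! ### Conformity -/

theorem mem_hull_inter {T T' : Finset Plane} (hT : T ∈ K.faces) (hT' : T' ∈ K.faces) {x : Plane}
    (hx : x ∈ convexHull ℝ (T : Set Plane)) (hx' : x ∈ convexHull ℝ (T' : Set Plane)) :
    x ∈ convexHull ℝ ((T : Set Plane) ∩ T') :=
  K.inter_subset_convexHull hT hT' ⟨hx, hx'⟩

/-- If `d` lies in the sector of the first triangle at `a`, then a point near `a` on the segment to
`d` belongs to both triangles. By conformity it lies on the common edge, and so `d` would be on the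
line of that edge. -/
theorem not_sector_overlap {a b c d : Plane} (hT : ({a, b, c} : Finset Plane) ∈ K.faces)
    (hT' : ({a, b, d} : Finset Plane) ∈ K.faces) (hcd : c ≠ d) (hbd : cr (b - a) (d - a) ≠ 0)
    {α β : ℝ} (hα : 0 ≤ α) (hβ : 0 ≤ β) (hd : d - a = α • (b - a) + β • (c - a)) : False := by
  set t : ℝ := (1 + α + β)⁻¹ with ht
  have h1 : 0 < 1 + α + β := by positivity
  have ht0 : 0 < t := by positivity
  have ht1 : t ≤ 1 := inv_le_one_of_one_le₀ (by linarith)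
  have hxT' : a + t • (d - a) ∈ convexHull ℝ ((({a, b, d} : Finset Plane)) : Set Plane) :=
    mem_hull_triple.2 ⟨0, t, le_rfl, ht0.le, by linarith, by module⟩
  have hxT : a + t • (d - a) ∈ convexHull ℝ ((({a, b, c} : Finset Plane)) : Set Plane) := by
    refine mem_hull_triple.2 ⟨t * α, t * β, by positivity, by positivity, ?_, ?_⟩
    · rw [← mul_add, ht, inv_mul_le_iff₀ h1]; linarith
    · rw [hd]; module
  have hx := mem_hull_inter hT hT' hxT hxT'
  have hsub : (((({a, b, c} : Finset Plane)) : Set Plane) ∩ (({a, b, d} : Finset Plane))) ⊆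
      {a, b} := by
    intro x hx
    simp only [Finset.coe_insert, Finset.coe_singleton, Set.mem_inter_iff, Set.mem_insert_iff,
      Set.mem_singleton_iff] at hx ⊢
    obtain ⟨h1 | h1 | h1, h2 | h2 | h2⟩ := hx
    all_goals first | exact Or.inl h1 | exact Or.inr h1 | exact Or.inl h2 | exact Or.inr h2 | skip
    exact absurd (h1.symm.trans h2) hcd
  obtain ⟨s, hs⟩ := mem_hull_pair (convexHull_mono hsub hx)
  have h2 : t • (d - a) = s • (b - a) := by
    have := congrArg (fun y => y - a) hs
    simpa using this
  have h3 : t * cr (b - a) (d - a) = 0 := by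
    have e0 := congrArg (fun y : Plane => y 0) h2
    have e1 := congrArg (fun y : Plane => y 1) h2
    simp only [PiLp.smul_apply, smul_eq_mul] at e0 e1
    simp only [cr]
    linear_combination (b - a) 0 * e1 - (b - a) 1 * e0
  exact (mul_ne_zero ht0.ne' hbd) h3

theorem eq_combo {u p : Plane} (h : cr u p ≠ 0) (q : Plane) :
    q = (cr q p / cr u p) • u + (cr u q / cr u p) • p := by
  apply plane_ext <;> simp only [PiLp.add_apply, PiLp.smul_apply, smul_eq_mul] <;> field_simp <;>
    simp only [cr] <;> ring

/-- Two triangles with a common edge lie on opposite sides of it. -/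
theorem opposite_sides {a b c d : Plane} (hT : ({a, b, c} : Finset Plane) ∈ K.faces)
    (hT' : ({a, b, d} : Finset Plane) ∈ K.faces) (hcd : c ≠ d)
    (hc : cr (b - a) (c - a) ≠ 0) (hd : cr (b - a) (d - a) ≠ 0) :
    cr (b - a) (c - a) * cr (b - a) (d - a) < 0 := by
  by_contra hneg
  have hpos : 0 < cr (b - a) (c - a) * cr (b - a) (d - a) :=
    lt_of_le_of_ne (not_lt.1 hneg) (mul_ne_zero hc hd).symm
  set u := b - a
  set p := c - a
  set q := d - a
  have h1 := eq_combo hc q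
  have h2 := eq_combo hd p
  have hb1 : 0 < cr u q / cr u p := by
    rw [div_eq_mul_inv, ← mul_inv_cancel_left₀ hc (cr u q), mul_assoc, mul_comm]
    have : 0 < (cr u p)⁻¹ ^ 2 := by positivity
    nlinarith
  have hb2 : 0 < cr u p / cr u q := by
    have := inv_pos.2 hb1
    rwa [inv_div] at this
  -- On the same side, the third vertex seen from `a` at the smaller angle to the edge lies in the
  -- sector of the other triangle.
  rcases le_total 0 (cr q p / cr u p) with h | h
  · exact not_sector_overlap hT hT' hcd hd h hb1.le h1
  · refine not_sector_overlap hT' hT hcd.symm hc ?_ hb2.le h2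
    have anti : cr p q = - cr q p := by simp only [cr]; ring
    have e : cr p q / cr u q = -(cr q p / cr u p) * (cr u p / cr u q) := by
      rw [anti]; field_simp
    rw [e]
    exact mul_nonneg (by linarith) hb2.le

/-! ### The number of triangles at a vertex -/

/-- Distinct triangles have at most two common vertices, so by conformity they meet within a
segment, which is treated as the degenerate triangle `{a, b, b}`. -/
theorem volume_inter_eq_zero {T T' : Finset Plane} (hT : T ∈ K.triangles) (hT' : T' ∈ K.triangles)
    (hne : T ≠ T') : volume (convexHull ℝ (T : Set Plane) ∩ convexHull ℝ (T' : Set Plane)) = 0 := by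
  classical
  obtain ⟨hTf, hT3⟩ := Triangulation.mem_triangles.1 hT
  obtain ⟨hTf', hT3'⟩ := Triangulation.mem_triangles.1 hT'
  have hcard : (T ∩ T').card ≤ 2 := by
    by_contra h
    have h1 : T ∩ T' = T := Finset.eq_of_subset_of_card_le Finset.inter_subset_left (by omega)
    have h2 : T ∩ T' = T' := Finset.eq_of_subset_of_card_le Finset.inter_subset_right (by omega)
    exact hne (h1.symm.trans h2)
  obtain ⟨a, b, hab⟩ : ∃ a b, T ∩ T' ⊆ {a, b} := by
    rcases (T ∩ T').eq_empty_or_nonempty with h | ⟨a, ha⟩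
    · exact ⟨0, 0, by simp [h]⟩
    · have : ((T ∩ T').erase a).card ≤ 1 := by rw [Finset.card_erase_of_mem ha]; omega
      rw [Finset.card_le_one_iff_subset_singleton] at this
      obtain ⟨b, hb⟩ := this
      refine ⟨a, b, fun x hx => ?_⟩
      by_cases hxa : x = a
      · simp [hxa]
      · have := hb (Finset.mem_erase.2 ⟨hxa, hx⟩)
        simp only [Finset.mem_singleton] at this
        simp [this]
  refine measure_mono_null (t := convexHull ℝ ((({a, b, b} : Finset Plane)) : Set Plane)) ?_ ?_
  · intro x hx
    have h1 := mem_hull_inter hTf hTf' hx.1 hx.2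
    refine convexHull_mono ?_ h1
    rw [← Finset.coe_inter]
    refine Finset.coe_subset.2 (hab.trans ?_)
    simp
  · have h1 := volume_triangle_le a b b
    have h2 : cr (b - a) (b - a) = 0 := by simp only [cr]; ring
    rw [h2, abs_zero] at h1
    have h3 := le_antisymm h1 ENNReal.toReal_nonneg
    rcases (ENNReal.toReal_eq_zero_iff _).1 h3 with h | h
    · exact h
    · exact absurd h (isCompact_hull _).measure_lt_top.ne

/-- The number of triangles at a vertex is bounded in terms of the shape regularity. -/
theorem Triangulation.ShapeRegular.card_star_le (h : K.ShapeRegular κ) (hκ : 1 ≤ κ) (z : Plane)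
    {S : Finset (Finset Plane)} (hS : S ⊆ K.triangles) (hz : ∀ T ∈ S, z ∈ T) :
    S.card ≤ ⌈4 * κ ^ 2⌉₊ := by
  classical
  rcases S.eq_empty_or_nonempty with he | hne
  · simp [he]
  have hκ0 : 0 < κ := by linarith
  obtain ⟨T₀, hT₀, hmin⟩ := S.exists_min_image (fun T => κ * meshSize T) hne
  set r := κ * meshSize T₀ with hr
  have hr0 : 0 < r := mul_pos hκ0 (h.meshSize_pos (hS hT₀))
  -- Shrunk towards `z` to the scale of the smallest one, the triangles still overlap only in null
  -- sets. All copies lie in a ball of radius `r` and have the area `r ^ 2 / κ ^ 2`, which leaves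
  -- room for at most `π κ ^ 2` of them.
  set F : Finset Plane → Set Plane := fun T =>
    AffineMap.homothety z (r / (κ * meshSize T)) '' convexHull ℝ (T : Set Plane) with hF
  have hpos : ∀ T ∈ S, 0 < κ * meshSize T := fun T hT => mul_pos hκ0 (h.meshSize_pos (hS hT))
  have hratio : ∀ T ∈ S, 0 < r / (κ * meshSize T) ∧ r / (κ * meshSize T) ≤ 1 := fun T hT =>
    ⟨div_pos hr0 (hpos T hT), (div_le_one (hpos T hT)).2 (hmin T hT)⟩
  have hsub : ∀ T ∈ S, F T ⊆ convexHull ℝ (T : Set Plane) := by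
    rintro T hT _ ⟨x, hx, rfl⟩
    obtain ⟨h1, h2⟩ := hratio T hT
    rw [AffineMap.homothety_eq_lineMap]
    exact (convex_convexHull ℝ _).lineMap_mem (mem_hull (hz T hT)) hx ⟨h1.le, h2⟩
  have hball : ∀ T ∈ S, F T ⊆ Metric.closedBall z r := by
    rintro T hT _ ⟨x, hx, rfl⟩
    obtain ⟨h1, h2⟩ := hratio T hT
    rw [Metric.mem_closedBall, dist_homothety_center, dist_comm, Real.norm_of_nonneg h1.le]
    have := h.dist_le (hS hT) hx (mem_hull (hz T hT))
    calc r / (κ * meshSize T) * dist x z ≤ r / (κ * meshSize T) * (κ * meshSize T) :=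
          mul_le_mul_of_nonneg_left this h1.le
      _ = r := div_mul_cancel₀ _ (hpos T hT).ne'
  have hvol : ∀ T ∈ S, volume (F T) = ENNReal.ofReal (r ^ 2 / κ ^ 2) := by
    intro T hT
    have hm := h.meshSize_pos (hS hT)
    rw [hF]
    simp only []
    rw [Measure.addHaar_image_homothety, finrank_euclideanSpace_fin]
    have : volume (convexHull ℝ (T : Set Plane)) = ENNReal.ofReal (meshSize T ^ 2) := by
      rw [sq_meshSize, ENNReal.ofReal_toReal (isCompact_hull _).measure_lt_top.ne]
    rw [this, ← ENNReal.ofReal_mul (abs_nonneg _), abs_of_nonneg (by positivity)]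
    congr 1
    field_simp
  have hun : volume (⋃ T ∈ S, F T) = ∑ T ∈ S, volume (F T) := by
    refine measure_biUnion_finset₀ ?_ ?_
    · intro T hT T' hT' hTT'
      exact measure_mono_null (Set.inter_subset_inter (hsub T hT) (hsub T' hT'))
        (volume_inter_eq_zero (hS hT) (hS hT') hTT')
    · intro T _
      refine (IsCompact.image (isCompact_hull T) ?_).measurableSet.nullMeasurableSet
      exact AffineMap.continuous_of_finiteDimensional _
  have hle : volume (⋃ T ∈ S, F T) ≤ volume (Metric.closedBall z r) :=
    measure_mono (Set.iUnion₂_subset hball)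
  rw [hun, Finset.sum_congr rfl hvol, Finset.sum_const, nsmul_eq_mul] at hle
  rw [EuclideanSpace.volume_closedBall_fin_two _ _] at hle
  have hle' := ENNReal.toReal_mono (by finiteness) hle
  simp only [ENNReal.toReal_mul, ENNReal.toReal_natCast, ENNReal.toReal_pow] at hle'
  rw [ENNReal.toReal_ofReal (by positivity), ENNReal.toReal_ofReal hr0.le] at hle'
  have h4 : (S.card : ℝ) ≤ 4 * κ ^ 2 := by
    have hpi : (ENNReal.ofReal Real.pi).toReal ≤ 4 := by
      rw [ENNReal.toReal_ofReal Real.pi_pos.le]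
      exact Real.pi_le_four
    have : (S.card : ℝ) * (r ^ 2 / κ ^ 2) ≤ (4 * κ ^ 2) * (r ^ 2 / κ ^ 2) := by
      refine hle'.trans ?_
      have e : (4 * κ ^ 2) * (r ^ 2 / κ ^ 2) = r ^ 2 * 4 := by field_simp
      rw [e]
      exact mul_le_mul_of_nonneg_left hpi (by positivity)
    exact le_of_mul_le_mul_right this (by positivity)
  exact_mod_cast h4.trans (Nat.le_ceil _)

end Plate

namespace Plate

variable {K : Triangulation} {κ : ℝ}

/-! ### The triangles around an interior vertex -/

theorem triangle_of_mem {K : Triangulation} {T : Finset Plane} (hT : T ∈ K.triangles) {z : Plane}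
    (hz : z ∈ T) : ∃ p q, p ≠ z ∧ q ≠ z ∧ p ≠ q ∧ T = {z, p, q} := by
  classical
  have hc := (Triangulation.mem_triangles.1 hT).2
  have : (T.erase z).card = 2 := by rw [Finset.card_erase_of_mem hz, hc]
  obtain ⟨p, q, hpq, he⟩ := Finset.card_eq_two.1 this
  have hp : p ∈ T.erase z := by rw [he]; simp
  have hq : q ∈ T.erase z := by rw [he]; simp
  refine ⟨p, q, Finset.ne_of_mem_erase hp, Finset.ne_of_mem_erase hq, hpq, ?_⟩
  rw [← he, Finset.insert_erase hz]

/-- No edge from `z` enters the sector of a triangle at `z` except its own two sides: points near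
`z` would lie in both faces although these share only `z`. -/
theorem mem_of_sector {z p q w : Plane} (hT : ({z, p, q} : Finset Plane) ∈ K.faces)
    (hw : ({z, w} : Finset Plane) ∈ K.faces) (hwz : w ≠ z) {α β : ℝ} (hα : 0 ≤ α) (hβ : 0 ≤ β)
    (h : w - z = α • (p - z) + β • (q - z)) : w = p ∨ w = q := by
  by_contra hcon
  push Not at hcon
  set t : ℝ := (1 + α + β)⁻¹ with ht
  have h1 : 0 < 1 + α + β := by positivity
  have ht0 : 0 < t := by positivity
  have ht1 : t ≤ 1 := inv_le_one_of_one_le₀ (by linarith)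
  have hx : z + t • (w - z) ∈ convexHull ℝ ((({z, p, q} : Finset Plane)) : Set Plane) := by
    refine mem_hull_triple.2 ⟨t * α, t * β, by positivity, by positivity, ?_, ?_⟩
    · rw [← mul_add, ht, inv_mul_le_iff₀ h1]; linarith
    · rw [h]; module
  have hx' : z + t • (w - z) ∈ convexHull ℝ ((({z, w} : Finset Plane)) : Set Plane) := by
    have e : ({z, w} : Finset Plane) = {z, w, w} := by simp
    rw [e]
    exact mem_hull_triple.2 ⟨0, t, le_rfl, ht0.le, by linarith, by module⟩
  have h2 := mem_hull_inter hT hw hx hx'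
  have hsub : (((({z, p, q} : Finset Plane)) : Set Plane) ∩ (({z, w} : Finset Plane))) ⊆ {z} := by
    intro x hx
    simp only [Finset.coe_insert, Finset.coe_singleton, Set.mem_inter_iff, Set.mem_insert_iff,
      Set.mem_singleton_iff] at hx ⊢
    obtain ⟨h1 | h1 | h1, h2 | h2⟩ := hx
    all_goals first | exact h1 | exact h2 | skip
    · exact absurd (h2.symm.trans h1) hcon.1
    · exact absurd (h2.symm.trans h1) hcon.2
  have h3 := convexHull_mono hsub h2
  rw [convexHull_singleton, Set.mem_singleton_iff] at h3
  have h4 : t • (w - z) = 0 := by simpa using h3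
  rcases smul_eq_zero.1 h4 with h | h
  · exact ht0.ne' h
  · exact hwz (sub_eq_zero.1 h)

theorem mem_region_iff {x : Plane} :
    x ∈ K.region ↔ ∃ T ∈ K.triangles, x ∈ convexHull ℝ (T : Set Plane) := by
  constructor
  · intro hx
    obtain ⟨s, hs, hx⟩ := K.mem_space_iff.1 hx
    obtain ⟨T, hT, hsT, hc⟩ := K.exists_triangle s hs
    exact ⟨T, Triangulation.mem_triangles.2 ⟨hT, hc⟩, convexHull_mono (by simpa using hsT) hx⟩
  · rintro ⟨T, hT, hx⟩
    exact K.convexHull_subset_space (Triangulation.mem_triangles.1 hT).1 hx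

theorem mem_of_mem_hull {T : Finset Plane} (hT : T ∈ K.faces) {z : Plane} (hz : {z} ∈ K.faces)
    (h : z ∈ convexHull ℝ (T : Set Plane)) : z ∈ T := by
  have h1 := mem_hull_inter hT hz h (by simp)
  by_contra hcon
  have : ((T : Set Plane) ∩ (({z} : Finset Plane))) = ∅ := by
    ext x
    simp only [Finset.coe_singleton, Set.mem_inter_iff, Set.mem_singleton_iff,
      Set.mem_empty_iff_false, iff_false, not_and]
    rintro hx rfl
    exact hcon hx
  rw [this] at h1
  simp at h1

/-- Each edge at an interior vertex has a triangle on its left. -/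
theorem exists_next (hreg : K.ShapeRegular κ) {z w : Plane} (hz : z ∈ K.interiorNodes)
    (hw : ({z, w} : Finset Plane) ∈ K.faces) (hwz : w ≠ z) :
    ∃ q, q ≠ z ∧ q ≠ w ∧ ({z, w, q} : Finset Plane) ∈ K.triangles ∧ 0 < cr (w - z) (q - z) := by
  classical
  obtain ⟨hzK, hzi⟩ := hz
  set u := w - z with hu
  have hu0 : u ≠ 0 := sub_ne_zero.2 hwz
  have hun : 0 < ‖u‖ ^ 2 := by positivity
  -- The points `y ε` leave `z` slightly to the left of the edge. They are in the region because `z`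
  -- is interior, and as there are finitely many triangles, one of them contains `y ε` for
  -- arbitrarily small `ε`.
  set d : ℝ → Plane := fun ε => u + ε • !₂[-u 1, u 0] with hd
  set y : ℝ → Plane := fun ε => z + ε • d ε with hy
  have hdc : Continuous d := by fun_prop
  have hyc : Continuous y := by fun_prop
  have hd0 : d 0 = u := by simp [hd]
  have hy0 : y 0 = z := by simp [hy]
  have hud : ∀ ε, cr u (d ε) = ε * ‖u‖ ^ 2 := by
    intro ε
    rw [norm_sq_eq]
    simp [hd, cr]
    ring
  have hyt : Filter.Tendsto y (nhdsWithin 0 (Set.Ioi 0)) (nhds z) := by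
    have := hyc.tendsto 0
    rw [hy0] at this
    exact this.mono_left nhdsWithin_le_nhds
  have hev : ∀ᶠ ε in nhdsWithin (0 : ℝ) (Set.Ioi 0), y ε ∈ K.region :=
    (hyt.eventually (isOpen_interior.mem_nhds hzi)).mono fun ε h => interior_subset h
  obtain ⟨T, hT, hfreq⟩ : ∃ T ∈ K.triangles, ∃ᶠ ε in nhdsWithin (0 : ℝ) (Set.Ioi 0),
      y ε ∈ convexHull ℝ (T : Set Plane) := by
    by_contra hcon
    push Not at hcon
    have h2 : ∀ᶠ ε in nhdsWithin (0 : ℝ) (Set.Ioi 0), ∀ T ∈ K.triangles,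
        ¬ y ε ∈ convexHull ℝ (T : Set Plane) :=
      (Filter.eventually_all_finset _).2 fun T hT => by simpa using hcon T hT
    obtain ⟨ε, h3, h4⟩ := (hev.and h2).exists
    obtain ⟨T, hT, h5⟩ := mem_region_iff.1 h3
    exact h4 T hT h5
  have hTf := (Triangulation.mem_triangles.1 hT).1
  have hzT : z ∈ T := mem_of_mem_hull hTf hzK
    ((isCompact_hull T).isClosed.mem_of_frequently_of_tendsto hfreq hyt)
  have hfreq' := hfreq.and_eventually self_mem_nhdsWithin
  -- The directions `d ε` belong to the closed cone of `T` at `z`, hence so does their limit `u`; by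
  -- conformity the edge is then a side of `T`.
  have hwT : w ∈ T := by
    obtain ⟨p, q, hp, hq, hpq, rfl⟩ := triangle_of_mem hT hzT
    have hD := hreg.cr_ne_zero hT
    have hcone : ∃ᶠ ε in nhdsWithin (0 : ℝ) (Set.Ioi 0),
        0 ≤ cr (d ε) (q - z) / cr (p - z) (q - z) ∧ 0 ≤ cr (p - z) (d ε) / cr (p - z) (q - z) := by
      refine hfreq'.mono ?_
      rintro ε ⟨h, hε⟩
      have hε : 0 < ε := hε
      obtain ⟨s, t, hs, ht, -, he⟩ := mem_hull_triple.1 h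
      have e : ε • d ε = s • (p - z) + t • (q - z) := by
        have := congrArg (fun x => x - z) he
        simp only [hy] at this
        rw [add_sub_cancel_left] at this
        rw [this]; abel
      have e0 := congrArg (fun x : Plane => x 0) e
      have e1 := congrArg (fun x : Plane => x 1) e
      simp only [PiLp.smul_apply, PiLp.add_apply, smul_eq_mul] at e0 e1
      have f1 : cr (d ε) (q - z) / cr (p - z) (q - z) = s / ε := by
        rw [div_eq_div_iff hD hε.ne']
        simp only [cr]
        linear_combination (q - z) 1 * e0 - (q - z) 0 * e1
      have f2 : cr (p - z) (d ε) / cr (p - z) (q - z) = t / ε := by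
        rw [div_eq_div_iff hD hε.ne']
        simp only [cr]
        linear_combination (p - z) 0 * e1 - (p - z) 1 * e0
      rw [f1, f2]
      exact ⟨by positivity, by positivity⟩
    have lim : ∀ f : Plane → ℝ, Continuous f →
        (∃ᶠ ε in nhdsWithin (0 : ℝ) (Set.Ioi 0), 0 ≤ f (d ε)) → 0 ≤ f u := by
      intro f hf h
      have h1 : Filter.Tendsto (fun ε => f (d ε)) (nhdsWithin 0 (Set.Ioi 0)) (nhds (f u)) := by
        have := (hf.comp hdc).tendsto 0
        simp only [Function.comp, hd0] at this
        exact this.mono_left nhdsWithin_le_nhds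
      exact isClosed_Ici.mem_of_frequently_of_tendsto (s := Set.Ici (0 : ℝ)) h h1
    have h1 := lim (fun x => cr x (q - z) / cr (p - z) (q - z))
      ((continuous_cr continuous_id continuous_const).div_const _) (hcone.mono fun _ h => h.1)
    have h2 := lim (fun x => cr (p - z) x / cr (p - z) (q - z))
      ((continuous_cr continuous_const continuous_id).div_const _) (hcone.mono fun _ h => h.2)
    rcases mem_of_sector hTf hw hwz h1 h2 (eq_combo hD u) with h | h <;> simp [h]
  obtain ⟨q, hqT, hqz, hqw⟩ : ∃ q ∈ T, q ≠ z ∧ q ≠ w := by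
    obtain ⟨p, q, hp, hq, hpq, rfl⟩ := triangle_of_mem hT hzT
    simp only [Finset.mem_insert, Finset.mem_singleton] at hwT
    rcases hwT with h | h | h
    · exact absurd h hwz
    · exact ⟨q, by simp, hq, by rw [h]; exact hpq.symm⟩
    · exact ⟨p, by simp, hp, by rw [h]; exact hpq⟩
  have hTe := triple_perm (Triangulation.mem_triangles.1 hT).2 hzT hwT hqT hwz.symm hqz hqw
  refine ⟨q, hqz, hqw, hTe ▸ hT, ?_⟩
  obtain ⟨ε, h, hε⟩ := hfreq'.exists
  have hε : 0 < ε := hε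
  rw [hTe] at h
  obtain ⟨s, t, hs, ht, -, he⟩ := mem_hull_triple.1 h
  have e : ε • d ε = s • u + t • (q - z) := by
    have := congrArg (fun x => x - z) he
    simp only [hy] at this
    rw [add_sub_cancel_left] at this
    rw [this]; abel
  have e0 := congrArg (fun x : Plane => x 0) e
  have e1 := congrArg (fun x : Plane => x 1) e
  simp only [PiLp.smul_apply, PiLp.add_apply, smul_eq_mul] at e0 e1
  -- A point of `T` is strictly to the left of the edge, so the third vertex is as well.
  have h5 : t * cr u (q - z) = ε * (ε * ‖u‖ ^ 2) := by
    rw [← hud]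
    simp only [cr]
    linear_combination u 1 * e0 - u 0 * e1
  have : 0 < t * cr u (q - z) := by rw [h5]; positivity
  exact pos_of_mul_pos_right this ht

/-- Two angles with sum at most `π` that lie on different sides of their common ray. -/
theorem cr_nonneg_of_angle {p u q : Plane} (h1 : 0 < cr p u) (h2 : 0 < cr u q)
    (h : InnerProductGeometry.angle p u + InnerProductGeometry.angle u q ≤ Real.pi) :
    0 ≤ cr p q := by
  have hin : ∀ x y : Plane, inner ℝ x y = dt x y := by
    intro x y
    rw [PiLp.inner_apply, Fin.sum_univ_two]
    simp [dt, mul_comm]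
  have hsin : ∀ x y : Plane, 0 < cr x y →
      Real.sin (InnerProductGeometry.angle x y) * (‖x‖ * ‖y‖) = cr x y := by
    intro x y hxy
    rw [InnerProductGeometry.sin_angle_mul_norm_mul_norm, hin, hin, hin,
      Real.sqrt_eq_iff_mul_self_eq_of_pos hxy]
    simp only [cr, dt]
    ring
  have hcos : ∀ x y : Plane,
      Real.cos (InnerProductGeometry.angle x y) * (‖x‖ * ‖y‖) = dt x y := by
    intro x y
    rw [InnerProductGeometry.cos_angle_mul_norm_mul_norm, hin]
  have hs := Real.sin_nonneg_of_nonneg_of_le_pi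
    (add_nonneg (InnerProductGeometry.angle_nonneg p u) (InnerProductGeometry.angle_nonneg u q)) h
  rw [Real.sin_add] at hs
  have hu : 0 < ‖u‖ := by
    rw [norm_pos_iff]
    rintro rfl
    simp [cr] at h1
  -- This is the addition theorem: `cr p q` has the sign of the sine of the sum of the two angles.
  have e : ‖u‖ ^ 2 * cr p q = cr p u * dt u q + dt p u * cr u q := by
    rw [norm_sq_eq]
    simp only [cr, dt]
    ring
  have h3 : 0 ≤ ‖u‖ ^ 2 * cr p q := by
    rw [e, ← hsin p u h1, ← hsin u q h2, ← hcos, ← hcos]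
    have := mul_nonneg hs (mul_nonneg (mul_nonneg (norm_nonneg p) (norm_nonneg u))
      (mul_nonneg (norm_nonneg u) (norm_nonneg q)))
    linarith
  exact nonneg_of_mul_nonneg_right h3 (by positivity)

theorem DirectlyConnected.pair_mem {z w : Plane} (h : K.DirectlyConnected z w) :
    ({z, w} : Finset Plane) ∈ K.faces ∧ w ≠ z := by
  classical
  obtain ⟨hne, e, he, hc, hz, hw⟩ := h
  have : ({z, w} : Finset Plane) = e := by
    apply Finset.eq_of_subset_of_card_le
    · intro x hx
      simp only [Finset.mem_insert, Finset.mem_singleton] at hx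
      rcases hx with rfl | rfl <;> assumption
    · rw [hc, Finset.card_pair hne]
  exact ⟨this ▸ he, hne.symm⟩

theorem directlyConnected_of_triangle {T : Finset Plane} (hT : T ∈ K.triangles) {z w : Plane}
    (hz : z ∈ T) (hw : w ∈ T) (hne : z ≠ w) : K.DirectlyConnected z w := by
  refine ⟨hne, {z, w}, K.down_closed (Triangulation.mem_triangles.1 hT).1 ?_ (by simp),
    Finset.card_pair hne, by simp, by simp⟩
  intro x hx
  simp only [Finset.mem_insert, Finset.mem_singleton] at hx
  rcases hx with rfl | rfl <;> assumption

/-- The vertices that are directly connected to `z`. -/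
abbrev Neighbor (K : Triangulation) (z : Plane) : Type := {w : Plane // K.DirectlyConnected z w}

theorem DirectlyConnected.exists_triangle {z w : Plane} (h : K.DirectlyConnected z w) :
    ∃ T ∈ K.triangles, z ∈ T ∧ w ∈ T := by
  obtain ⟨hne, e, he, hc, hz, hw⟩ := h
  obtain ⟨T, hT, heT, hc⟩ := K.exists_triangle e he
  exact ⟨T, Triangulation.mem_triangles.2 ⟨hT, hc⟩, heT hz, heT hw⟩

theorem neighbor_subset {z : Plane} {S : Finset (Finset Plane)}
    (hS : ∀ T ∈ K.triangles, z ∈ T → T ∈ S) :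
    {w | K.DirectlyConnected z w} ⊆ ((S.biUnion id : Finset Plane) : Set Plane) := by
  intro w hw
  obtain ⟨T, hT, hz, hwT⟩ := DirectlyConnected.exists_triangle hw
  simp only [Finset.coe_biUnion, Set.mem_iUnion]
  exact ⟨T, hS T hT hz, hwT⟩

instance (K : Triangulation) (z : Plane) : Finite (Neighbor K z) := by
  have := (Finset.finite_toSet _).subset
    (neighbor_subset (K := K) (z := z) (S := K.triangles) fun T hT _ => hT)
  exact this

theorem valence_le {z : Plane} {S : Finset (Finset Plane)} (hST : S ⊆ K.triangles)
    (hS : ∀ T ∈ K.triangles, z ∈ T → T ∈ S) : K.valence z ≤ S.card * 3 := by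
  have h1 := Set.ncard_le_ncard (neighbor_subset hS) (Finset.finite_toSet _)
  rw [Set.ncard_coe_finset] at h1
  refine h1.trans (Finset.card_biUnion_le_card_mul _ _ _ fun T hT => ?_)
  exact (Triangulation.mem_triangles.1 (hST hT)).2.le

/-- The triangles of `S` have diameter and distance from `z` at most of order `h`, and area at
least of order `h ^ 2`. -/
structure IsBounded (S : Finset (Finset Plane)) (z : Plane) (h R c : ℝ) : Prop where
  pos : 0 < h
  dist_le : ∀ T ∈ S, ∀ x ∈ T, dist x z ≤ R * h
  diam_le : ∀ T ∈ S, ∀ x ∈ T, ∀ y ∈ T, ‖x - y‖ ≤ R * h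
  area_ge : ∀ T ∈ S, ∀ x y w, T = {x, y, w} → c * h ^ 2 ≤ |cr (y - x) (w - x)|

theorem cr_scaled (h : ℝ) (x y : Plane) : cr (h⁻¹ • x) (h⁻¹ • y) = cr x y / h ^ 2 := by
  simp only [cr, PiLp.smul_apply, smul_eq_mul]
  ring

/-- The constant in `IsStar` that corresponds to those in `IsBounded`. -/
def starConst (R c : ℝ) : ℝ := min c (min ((c / R) ^ 2 / 2) ((c / R) ^ 2 * c / (4 * R ^ 2)))

theorem starConst_pos {R c : ℝ} (hR : 0 < R) (hc : 0 < c) : 0 < starConst R c := by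
  unfold starConst
  positivity

/-- `starConst` is so small that a direction `a'` which is turned counterclockwise from `a` by less
than it measures still comes before `b`. In the identity `e1` the term `dt a a' * cr a b` then
dominates. -/
theorem cr_pos_of_near {R c : ℝ} (hR : 0 < R) (hc : 0 < c) {a b a' : Plane} (ha : ‖a‖ ≤ R)
    (hb : ‖b‖ ≤ R) (ha1 : c / R ≤ ‖a‖) (ha' : c / R ≤ ‖a'‖) (hD : c ≤ cr a b)
    (hdt : 0 < dt a a') (h0 : 0 ≤ cr a a') (h : cr a a' < starConst R c) : 0 < cr a' b := by
  set r := c / R with hr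
  have hr0 : 0 < r := by positivity
  have hh1 : cr a a' < r ^ 2 / 2 :=
    h.trans_le ((min_le_right _ _).trans (min_le_left _ _))
  have hh2 : cr a a' < r ^ 2 * c / (4 * R ^ 2) :=
    h.trans_le ((min_le_right _ _).trans (min_le_right _ _))
  have e1 : cr a' b * ‖a‖ ^ 2 = dt a a' * cr a b - cr a a' * dt a b := by
    rw [norm_sq_eq]; simp only [cr, dt]; ring
  have e2 : dt a a' ^ 2 + cr a a' ^ 2 = ‖a‖ ^ 2 * ‖a'‖ ^ 2 := by
    rw [norm_sq_eq, norm_sq_eq]; simp only [cr, dt]; ring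
  have h3 : r ^ 2 * r ^ 2 ≤ ‖a‖ ^ 2 * ‖a'‖ ^ 2 := by gcongr
  have h4 : r ^ 2 / 2 ≤ dt a a' := by
    refine le_of_sq_le_sq ?_ hdt.le
    nlinarith [sq_nonneg (r ^ 2)]
  have h5 : dt a b ≤ R ^ 2 := by
    have e3 : dt a b ^ 2 ≤ (‖a‖ * ‖b‖) ^ 2 := by
      rw [mul_pow, norm_sq_eq, norm_sq_eq, dt]
      nlinarith [sq_nonneg (a 0 * b 1 - a 1 * b 0)]
    have e4 := abs_le_of_sq_le_sq e3 (by positivity)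
    have e5 : ‖a‖ * ‖b‖ ≤ R * R := mul_le_mul ha hb (norm_nonneg _) hR.le
    have := (abs_le.1 (abs_le_of_sq_le_sq e3 (by positivity))).2
    nlinarith
  have h6 : cr a a' * dt a b ≤ r ^ 2 * c / 4 := by
    have : cr a a' * R ^ 2 ≤ r ^ 2 * c / 4 := by
      have := mul_le_mul_of_nonneg_right hh2.le (sq_nonneg R)
      refine this.trans (le_of_eq ?_)
      field_simp
    exact (mul_le_mul_of_nonneg_left h5 h0).trans this
  have h7 : r ^ 2 / 2 * c ≤ dt a a' * cr a b := mul_le_mul h4 hD hc.le hdt.le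
  have h8 : 0 < cr a' b * ‖a‖ ^ 2 := by
    rw [e1]
    have : 0 < r ^ 2 * c := by positivity
    linarith
  exact pos_of_mul_pos_left h8 (sq_nonneg _)

/-- The edges at an interior vertex that satisfies the angle condition form a star. -/
theorem exists_isStar (hreg : K.ShapeRegular κ) (P : PatchAssignment K) {z : Plane}
    (hz : z ∈ K.interiorNodes) (hang : P.AngleCondition z) {h R c : ℝ} (hR : 0 < R) (hc : 0 < c)
    (hb : IsBounded (P.patch z) z h R c) :
    ∃ s : Neighbor K z → Neighbor K z,
      IsStar R (starConst R c) (fun w : Neighbor K z => h⁻¹ • (w.1 - z)) s ∧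
      (∀ w, c ≤ cr (h⁻¹ • (w.1 - z)) (h⁻¹ • ((s w).1 - z))) ∧
      ∀ w, ({z, w.1, (s w).1} : Finset Plane) ∈ P.patch z := by
  have hh := hb.pos
  have hh2 : 0 < h ^ 2 := by positivity
  have hex : ∀ w : Neighbor K z, ∃ q : Neighbor K z,
      ({z, w.1, q.1} : Finset Plane) ∈ K.triangles ∧ 0 < cr (w.1 - z) (q.1 - z) := by
    intro w
    obtain ⟨h1, h2⟩ := DirectlyConnected.pair_mem w.2
    obtain ⟨q, hqz, hqw, hT, hcr⟩ := exists_next hreg hz h1 h2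
    exact ⟨⟨q, directlyConnected_of_triangle hT (by simp) (by simp) hqz.symm⟩, hT, hcr⟩
  choose s hs hcr using hex
  have hpatch : ∀ w, ({z, w.1, (s w).1} : Finset Plane) ∈ P.patch z := fun w =>
    P.star_subset z hz _ (hs w) (by simp)
  have hnext : ∀ w, c ≤ cr (h⁻¹ • (w.1 - z)) (h⁻¹ • ((s w).1 - z)) := by
    intro w
    have := hb.area_ge _ (hpatch w) z w.1 (s w).1 rfl
    rw [abs_of_pos (hcr w)] at this
    rw [cr_scaled, le_div_iff₀ hh2]
    exact this
  have hnorm : ∀ w : Neighbor K z, ‖h⁻¹ • (w.1 - z)‖ ≤ R := by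
    intro w
    have := hb.dist_le _ (hpatch w) w.1 (by simp)
    rw [dist_eq_norm] at this
    rw [norm_smul, norm_inv, Real.norm_of_nonneg hh.le, inv_mul_le_iff₀ hh, mul_comm]
    exact this
  have hlow : ∀ w : Neighbor K z, c / R ≤ ‖h⁻¹ • (w.1 - z)‖ := by
    intro w
    rw [div_le_iff₀ hR]
    have h1 := (hnext w).trans ((le_abs_self _).trans (abs_cr_le _ _))
    exact h1.trans (mul_le_mul_of_nonneg_left (hnorm _) (norm_nonneg _))
  have hne : ∀ w, (s w).1 ≠ w.1 := by
    intro w hw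
    have := hcr w
    rw [hw] at this
    simp [cr, mul_comm] at this
  have hne2 : ∀ w, (s (s w)).1 ≠ w.1 := by
    intro w hw
    have h1 := hcr w
    have h2 := hcr (s w)
    rw [hw] at h2
    simp only [cr] at h1 h2
    linarith
  have hz' : ∀ w : Neighbor K z, w.1 ≠ z := fun w => w.2.1.symm
  have hTT : ∀ w, ({z, w.1, (s w).1} : Finset Plane) ≠ {z, (s w).1, (s (s w)).1} := by
    intro w he
    have : (s (s w)).1 ∈ ({z, w.1, (s w).1} : Finset Plane) := by rw [he]; simp
    simp only [Finset.mem_insert, Finset.mem_singleton] at this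
    rcases this with h | h | h
    · exact hz' _ h
    · exact hne2 _ h
    · exact hne _ h
  refine ⟨s, ⟨hnorm, fun w => (min_le_left _ _).trans (hnext w), fun w => ?_, fun w => ?_, ?_⟩,
    hnext, hpatch⟩
  -- The adjacent angles at `z` on both sides of the edge to `s w`.
  · rw [cr_scaled]
    refine div_nonneg ?_ hh2.le
    refine cr_nonneg_of_angle (hcr w) (hcr (s w)) ?_
    exact hang _ (hpatch w) _ (hpatch (s w)) (hTT w) z (s w).1 w.1 (s (s w)).1 (hz' _).symm
      (by simp) (by simp) (by simp) (by simp) (by simp) (hz' _) (hne w).symm (by simp)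
      (hz' _) (hne _)
  -- The adjacent angles at the neighbour `s w` on both sides of the same edge; that their sum is at
  -- most `π` is local convexity of the polygon.
  · simp only [cr_scaled]
    rw [← add_div]
    refine div_le_div_of_nonneg_right ?_ hh2.le
    have h1 : 0 < cr ((s (s w)).1 - (s w).1) (z - (s w).1) := by
      have := hcr (s w)
      simp only [cr, PiLp.sub_apply] at this ⊢
      linarith
    have h2 : 0 < cr (z - (s w).1) (w.1 - (s w).1) := by
      have := hcr w
      simp only [cr, PiLp.sub_apply] at this ⊢
      linarith
    have := cr_nonneg_of_angle h1 h2 (hang _ (hpatch (s w)) _ (hpatch w) (hTT w).symm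
      (s w).1 z (s (s w)).1 w.1 (hz' _) (by simp) (by simp) (by simp) (by simp) (by simp)
      (hne _) (hz' _) (by simp) (hne _).symm (hz' _))
    simp only [cr, PiLp.sub_apply] at this ⊢
    linarith
  -- If `j` followed `i` on almost the same ray, the edge to `j` would run into the sector between
  -- `i` and `s i`, and `mem_of_sector` leaves only `j = i` or `j = s i`.
  · have key : ∀ i j : Neighbor K z, i ≠ j → 0 < dt (h⁻¹ • (i.1 - z)) (h⁻¹ • (j.1 - z)) →
        0 ≤ cr (h⁻¹ • (i.1 - z)) (h⁻¹ • (j.1 - z)) →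
        cr (h⁻¹ • (i.1 - z)) (h⁻¹ • (j.1 - z)) < starConst R c → False := by
      intro i j hij hd h0 hlt
      have h1 := cr_pos_of_near hR hc (hnorm i) (hnorm (s i)) (hlow i) (hlow j) (hnext i) hd h0 hlt
      rw [cr_scaled] at h1 h0
      have h2 : 0 < cr (j.1 - z) ((s i).1 - z) := by
        rw [div_pos_iff_of_pos_right hh2] at h1; exact h1
      have h3 : 0 ≤ cr (i.1 - z) (j.1 - z) := by
        have := mul_nonneg h0 hh2.le
        rwa [div_mul_cancel₀ _ hh2.ne'] at this
      obtain ⟨h4, h5⟩ := DirectlyConnected.pair_mem j.2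
      rcases mem_of_sector (Triangulation.mem_triangles.1 (hs i)).1 h4 h5
        (div_nonneg h2.le (hcr i).le) (div_nonneg h3 (hcr i).le)
        (eq_combo (hcr i).ne' (j.1 - z)) with h | h
      · exact hij (Subtype.ext h.symm)
      · rw [h] at hlt
        have := hnext i
        have := hlt.trans_le (min_le_left c _)
        linarith
    intro i j hij
    by_contra hcon
    push Not at hcon
    obtain ⟨h1, h2⟩ := hcon
    rcases le_total 0 (cr (h⁻¹ • (i.1 - z)) (h⁻¹ • (j.1 - z))) with h0 | h0
    · rw [abs_of_nonneg h0] at h2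
      exact key i j hij h1 h0 h2
    · rw [abs_of_nonpos h0] at h2
      have e : ∀ x y : Plane, cr y x = - cr x y := fun x y => by simp only [cr]; ring
      refine key j i hij.symm ?_ ?_ ?_
      · have : ∀ x y : Plane, dt y x = dt x y := fun x y => by simp only [dt]; ring
        rw [this]; exact h1
      · rw [e]; linarith
      · rw [e]; exact h2

end Plate

namespace Plate

/-! ### Quadratic polynomials on a cross -/

theorem abs_mul_add_mul_le {x y p q X Y P Q : ℝ} (hx : |x| ≤ X) (hy : |y| ≤ Y) (hp : |p| ≤ P)
    (hq : |q| ≤ Q) : |x * p + y * q| ≤ X * P + Y * Q := by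
  refine (abs_add_le _ _).trans ?_
  rw [abs_mul, abs_mul]
  exact add_le_add (mul_le_mul hx hp (abs_nonneg _) ((abs_nonneg _).trans hx))
    (mul_le_mul hy hq (abs_nonneg _) ((abs_nonneg _).trans hy))

/-- The linear and the quadratic part of a polynomial that is bounded at `a` and `- ρ a`. -/
theorem quad_split {k : Fin 5 → ℝ} {a : Plane} {ρ ρ₀ M : ℝ} (hρ₀ : 0 < ρ₀) (hρ : ρ₀ ≤ ρ)
    (h1 : |quad k a| ≤ M) (h2 : |quad k (-ρ • a)| ≤ M) :
    |k 0 * a 0 + k 1 * a 1| ≤ (1 + 1 / ρ₀) * M ∧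
      |k 2 * a 0 ^ 2 + k 3 * (a 0 * a 1) + k 4 * a 1 ^ 2| ≤ (2 + 1 / ρ₀) * M := by
  have hρp : 0 < ρ := hρ₀.trans_le hρ
  have hM : 0 ≤ M := (abs_nonneg _).trans h1
  have h3 : |k 0 * a 0 + k 1 * a 1| ≤ (1 + 1 / ρ₀) * M := by
    -- This combination of the two values cancels the quadratic part. Its factor is positive since
    -- the points are on opposite sides of the origin.
    have e : (ρ ^ 2 + ρ) * (k 0 * a 0 + k 1 * a 1) =
        ρ ^ 2 * quad k a + (-1) * quad k (-ρ • a) := by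
      simp only [quad, PiLp.smul_apply, smul_eq_mul]; ring
    have h4 : (ρ ^ 2 + ρ) * |k 0 * a 0 + k 1 * a 1| ≤ ρ ^ 2 * M + 1 * M := by
      rw [← abs_of_pos (by positivity : 0 < ρ ^ 2 + ρ), ← abs_mul, e]
      exact abs_mul_add_mul_le (by rw [abs_of_nonneg (sq_nonneg _)]) (by simp) h1 h2
    have h5 : (ρ ^ 2 + ρ) * |k 0 * a 0 + k 1 * a 1| ≤ (ρ ^ 2 + ρ) * ((1 + 1 / ρ) * M) := by
      refine h4.trans ?_
      have : (ρ ^ 2 + ρ) * ((1 + 1 / ρ) * M) = (ρ ^ 2 + 2 * ρ + 1) * M := by field_simp; ring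
      rw [this]
      nlinarith
    have h6 := le_of_mul_le_mul_left h5 (by positivity)
    refine h6.trans (mul_le_mul_of_nonneg_right ?_ hM)
    have := one_div_le_one_div_of_le hρ₀ hρ
    linarith
  refine ⟨h3, ?_⟩
  have e : k 2 * a 0 ^ 2 + k 3 * (a 0 * a 1) + k 4 * a 1 ^ 2 =
      quad k a - (k 0 * a 0 + k 1 * a 1) := by simp only [quad]; ring
  rw [e]
  have := abs_sub (quad k a) (k 0 * a 0 + k 1 * a 1)
  linarith

/-- On each line of the cross there are points on both sides of the origin, so `quad_split` bounds
the linear part along both; Cramer's rule does the rest. No point off the cross is needed. -/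
theorem quad_cross_linear {k : Fin 5 → ℝ} {a b : Plane} {R c ρ ρ' ρ₀ M : ℝ} (hc : 0 < c)
    (ha : ‖a‖ ≤ R) (hb : ‖b‖ ≤ R) (hD : c ≤ cr a b) (hρ₀ : 0 < ρ₀) (hρ : ρ₀ ≤ ρ) (hρ' : ρ₀ ≤ ρ')
    (h1 : |quad k a| ≤ M) (h2 : |quad k (-ρ • a)| ≤ M) (h3 : |quad k b| ≤ M)
    (h4 : |quad k (-ρ' • b)| ≤ M) :
    |k 0| ≤ 2 * R * (1 + 1 / ρ₀) / c * M ∧ |k 1| ≤ 2 * R * (1 + 1 / ρ₀) / c * M := by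
  obtain ⟨la, -⟩ := quad_split hρ₀ hρ h1 h2
  obtain ⟨lb, -⟩ := quad_split hρ₀ hρ' h3 h4
  have hab : ∀ x : Plane, ‖x‖ ≤ R → ∀ i, |x i| ≤ R := fun x hx i => (abs_apply_le_norm x i).trans hx
  have fin : ∀ g : ℝ, |g * cr a b| ≤ (1 + 1 / ρ₀) * M * R + (1 + 1 / ρ₀) * M * R →
      |g| ≤ 2 * R * (1 + 1 / ρ₀) / c * M := by
    intro g hg
    rw [div_mul_eq_mul_div, le_div_iff₀ hc]
    rw [abs_mul, abs_of_pos (hc.trans_le hD)] at hg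
    have := mul_le_mul_of_nonneg_left hD (abs_nonneg g)
    linarith
  constructor
  · refine fin _ ?_
    have e : k 0 * cr a b = (k 0 * a 0 + k 1 * a 1) * b 1 + (k 0 * b 0 + k 1 * b 1) * -a 1 := by
      simp only [cr]; ring
    rw [e]
    exact abs_mul_add_mul_le la lb (hab b hb 1) (by rw [abs_neg]; exact hab a ha 1)
  · refine fin _ ?_
    have e : k 1 * cr a b = (k 0 * a 0 + k 1 * a 1) * -b 0 + (k 0 * b 0 + k 1 * b 1) * a 0 := by
      simp only [cr]; ring
    rw [e]
    exact abs_mul_add_mul_le la lb (by rw [abs_neg]; exact hab b hb 0) (hab a ha 0)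

theorem abs_three_le {x y z p q r X Y Z P Q S : ℝ} (hx : |x| ≤ X) (hy : |y| ≤ Y) (hz : |z| ≤ Z)
    (hp : |p| ≤ P) (hq : |q| ≤ Q) (hr : |r| ≤ S) :
    |x * p + y * q + z * r| ≤ X * P + Y * Q + Z * S := by
  refine (abs_add_le _ _).trans (add_le_add (abs_mul_add_mul_le hx hy hp hq) ?_)
  rw [abs_mul]
  exact mul_le_mul hz hr (abs_nonneg _) ((abs_nonneg _).trans hz)

/-- Bound of the mixed value of a quadratic form on a basis by its value at a vector that is away
from the axes. -/
theorem form_mixed_bound {R δ X W p q t : ℝ} (hR : 0 < R) (hδ : 0 < δ) {a b w : Plane}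
    (ha : ‖a‖ ≤ R) (hb : ‖b‖ ≤ R) (hw : ‖w‖ ≤ R)
    (hA : |p * a 0 ^ 2 + q * (a 0 * a 1) + t * a 1 ^ 2| ≤ X)
    (hB : |p * b 0 ^ 2 + q * (b 0 * b 1) + t * b 1 ^ 2| ≤ X)
    (hW : |p * w 0 ^ 2 + q * (w 0 * w 1) + t * w 1 ^ 2| ≤ W)
    (hwa : δ ≤ |cr a w|) (hwb : δ ≤ |cr b w|) :
    |2 * p * (a 0 * b 0) + q * (a 0 * b 1 + a 1 * b 0) + 2 * t * (a 1 * b 1)| ≤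
      (R ^ 4 * W + 2 * R ^ 4 * X) / δ ^ 2 := by
  have hsq : ∀ x y : Plane, ‖x‖ ≤ R → ‖y‖ ≤ R → |cr x y ^ 2| ≤ R ^ 4 := by
    intro x y hx hy
    have h1 : |cr x y| ≤ R ^ 2 := (abs_cr_le x y).trans
      (by rw [sq]; exact mul_le_mul hx hy (norm_nonneg _) hR.le)
    rw [abs_pow]
    calc |cr x y| ^ 2 ≤ (R ^ 2) ^ 2 := pow_le_pow_left₀ (abs_nonneg _) h1 2
      _ = R ^ 4 := by ring
  -- The form at `w`, expanded in the basis `a`, `b` and solved for the mixed term, whose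
  -- coefficient does not vanish off the two axes.
  have e : (cr b w * cr a w) *
      (2 * p * (a 0 * b 0) + q * (a 0 * b 1 + a 1 * b 0) + 2 * t * (a 1 * b 1)) =
      (-(cr a b ^ 2)) * (p * w 0 ^ 2 + q * (w 0 * w 1) + t * w 1 ^ 2) +
      cr b w ^ 2 * (p * a 0 ^ 2 + q * (a 0 * a 1) + t * a 1 ^ 2) +
      cr a w ^ 2 * (p * b 0 ^ 2 + q * (b 0 * b 1) + t * b 1 ^ 2) := by
    simp only [cr]; ring
  rw [le_div_iff₀ (by positivity)]
  have h2 : δ ^ 2 ≤ |cr b w * cr a w| := by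
    rw [abs_mul, sq]
    exact mul_le_mul hwb hwa hδ.le (abs_nonneg _)
  have h3 := mul_le_mul_of_nonneg_right h2
    (abs_nonneg (2 * p * (a 0 * b 0) + q * (a 0 * b 1 + a 1 * b 0) + 2 * t * (a 1 * b 1)))
  rw [← abs_mul, e] at h3
  have h0 : |-(cr a b ^ 2)| ≤ R ^ 4 := by rw [abs_neg]; exact hsq _ _ ha hb
  have h4 := abs_three_le h0 (hsq _ _ hb hw) (hsq _ _ ha hw)
    hW hA hB
  linarith

/-- The coefficients result from the values of the form on the basis `a`, `b` by a change of basis,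
with the denominator `cr a b ^ 2`. -/
theorem form_coeff_bound {R c X Y p q t : ℝ} (hR : 0 < R) (hc : 0 < c) {a b : Plane}
    (ha : ‖a‖ ≤ R) (hb : ‖b‖ ≤ R) (hD : c ≤ cr a b)
    (hA : |p * a 0 ^ 2 + q * (a 0 * a 1) + t * a 1 ^ 2| ≤ X)
    (hB : |p * b 0 ^ 2 + q * (b 0 * b 1) + t * b 1 ^ 2| ≤ X)
    (hY : |2 * p * (a 0 * b 0) + q * (a 0 * b 1 + a 1 * b 0) + 2 * t * (a 1 * b 1)| ≤ Y) :
    |p| ≤ (4 * R ^ 2 * X + 2 * R ^ 2 * Y) / c ^ 2 ∧ |q| ≤ (4 * R ^ 2 * X + 2 * R ^ 2 * Y) / c ^ 2 ∧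
      |t| ≤ (4 * R ^ 2 * X + 2 * R ^ 2 * Y) / c ^ 2 := by
  have hab : ∀ x : Plane, ‖x‖ ≤ R → ∀ i, |x i| ≤ R := fun x hx i => (abs_apply_le_norm x i).trans hx
  have ha0 := hab a ha 0
  have ha1 := hab a ha 1
  have hb0 := hab b hb 0
  have hb1 := hab b hb 1
  have hp2 : ∀ x y : ℝ, |x| ≤ R → |y| ≤ R → |x * y| ≤ R ^ 2 := fun x y hx hy => by
    rw [abs_mul, sq]; exact mul_le_mul hx hy (abs_nonneg _) hR.le
  have hR2 : 0 ≤ R ^ 2 := sq_nonneg R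
  have fin : ∀ g x y z : ℝ, |x| ≤ 2 * R ^ 2 → |y| ≤ 2 * R ^ 2 → |z| ≤ 2 * R ^ 2 →
      cr a b ^ 2 * g = x * (p * a 0 ^ 2 + q * (a 0 * a 1) + t * a 1 ^ 2) +
        y * (p * b 0 ^ 2 + q * (b 0 * b 1) + t * b 1 ^ 2) +
        z * (2 * p * (a 0 * b 0) + q * (a 0 * b 1 + a 1 * b 0) + 2 * t * (a 1 * b 1)) →
      |g| ≤ (4 * R ^ 2 * X + 2 * R ^ 2 * Y) / c ^ 2 := by
    intro g x y z hx hy hz e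
    rw [le_div_iff₀ (by positivity)]
    have h1 := mul_le_mul_of_nonneg_right (pow_le_pow_left₀ hc.le hD 2) (abs_nonneg g)
    rw [← abs_of_nonneg (sq_nonneg (cr a b)), ← abs_mul, e] at h1
    have h2 := abs_three_le hx hy hz hA hB hY
    linarith
  refine ⟨fin p (b 1 * b 1) (a 1 * a 1) (-(b 1 * a 1)) ?_ ?_ ?_ ?_,
    fin q (-2 * (b 1 * b 0)) (-2 * (a 1 * a 0)) (b 1 * a 0 + b 0 * a 1) ?_ ?_ ?_ ?_,
    fin t (b 0 * b 0) (a 0 * a 0) (-(b 0 * a 0)) ?_ ?_ ?_ ?_⟩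
  · linarith [hp2 _ _ hb1 hb1]
  · linarith [hp2 _ _ ha1 ha1]
  · rw [abs_neg]; linarith [hp2 _ _ hb1 ha1]
  · simp only [cr]; ring
  · rw [abs_mul]; simpa using hp2 _ _ hb1 hb0
  · rw [abs_mul]; simpa using hp2 _ _ ha1 ha0
  · have := abs_add_le (b 1 * a 0) (b 0 * a 1)
    linarith [hp2 _ _ hb1 ha0, hp2 _ _ hb0 ha1]
  · simp only [cr]; ring
  · linarith [hp2 _ _ hb0 hb0]
  · linarith [hp2 _ _ ha0 ha0]
  · rw [abs_neg]; linarith [hp2 _ _ hb0 ha0]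
  · simp only [cr]; ring

/-- A quadratic polynomial that is bounded at four points of a cross, and at one point off the
cross. -/
theorem exists_quad_cross_bound {R c ρ₀ δ : ℝ} (hR : 0 < R) (hc : 0 < c) (hρ₀ : 0 < ρ₀)
    (hδ : 0 < δ) : ∃ C : ℝ, 0 < C ∧ ∀ (k : Fin 5 → ℝ) (a b w : Plane) (ρ ρ' M : ℝ),
      ‖a‖ ≤ R → ‖b‖ ≤ R → ‖w‖ ≤ R → c ≤ cr a b → ρ₀ ≤ ρ → ρ₀ ≤ ρ' →
      |quad k a| ≤ M → |quad k (-ρ • a)| ≤ M → |quad k b| ≤ M → |quad k (-ρ' • b)| ≤ M →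
      |quad k w| ≤ M → δ ≤ |cr a w| → δ ≤ |cr b w| → ∀ m, |k m| ≤ C * M := by
  obtain ⟨A, hA⟩ : ∃ A, A = 2 * R * (1 + 1 / ρ₀) / c := ⟨_, rfl⟩
  have hA0 : 0 < A := by rw [hA]; positivity
  obtain ⟨X, hX⟩ : ∃ X, X = 2 + 1 / ρ₀ := ⟨_, rfl⟩
  have hX0 : 0 < X := by rw [hX]; positivity
  obtain ⟨Y, hY⟩ : ∃ Y, Y = (R ^ 4 * (1 + 2 * A * R) + 2 * R ^ 4 * X) / δ ^ 2 := ⟨_, rfl⟩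
  have hY0 : 0 < Y := by rw [hY]; positivity
  obtain ⟨E, hE⟩ : ∃ E, E = (4 * R ^ 2 * X + 2 * R ^ 2 * Y) / c ^ 2 := ⟨_, rfl⟩
  have hE0 : 0 < E := by rw [hE]; positivity
  refine ⟨A + E, by positivity, ?_⟩
  intro k a b w ρ ρ' M ha hb hw hD hρ hρ' h1 h2 h3 h4 h5 hwa hwb
  have hM : 0 ≤ M := (abs_nonneg _).trans h1
  obtain ⟨k0, k1⟩ := quad_cross_linear hc ha hb hD hρ₀ hρ hρ' h1 h2 h3 h4
  have qa := (quad_split hρ₀ hρ h1 h2).2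
  have qb := (quad_split hρ₀ hρ' h3 h4).2
  rw [← hA] at k0 k1
  rw [← hX] at qa qb
  have hQw : |k 2 * w 0 ^ 2 + k 3 * (w 0 * w 1) + k 4 * w 1 ^ 2| ≤ (1 + 2 * A * R) * M := by
    have e : k 2 * w 0 ^ 2 + k 3 * (w 0 * w 1) + k 4 * w 1 ^ 2 =
        quad k w - (k 0 * w 0 + k 1 * w 1) := by simp only [quad]; ring
    rw [e]
    have i1 := abs_sub (quad k w) (k 0 * w 0 + k 1 * w 1)
    have i2 := abs_mul_add_mul_le k0 k1 ((abs_apply_le_norm w 0).trans hw)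
      ((abs_apply_le_norm w 1).trans hw)
    linarith
  have hmix := form_mixed_bound hR hδ ha hb hw qa qb hQw hwa hwb
  have eY : (R ^ 4 * ((1 + 2 * A * R) * M) + 2 * R ^ 4 * (X * M)) / δ ^ 2 = Y * M := by
    rw [hY]; ring
  rw [eY] at hmix
  have hco := form_coeff_bound hR hc ha hb hD qa qb hmix
  have eE : (4 * R ^ 2 * (X * M) + 2 * R ^ 2 * (Y * M)) / c ^ 2 = E * M := by
    rw [hE]; ring
  rw [eE] at hco
  have hAM : 0 ≤ A * M := by positivity
  have hEM : 0 ≤ E * M := by positivity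
  have l1 : A * M ≤ (A + E) * M := by linarith
  have l2 : E * M ≤ (A + E) * M := by linarith
  intro m
  fin_cases m
  · exact k0.trans l1
  · exact k1.trans l1
  · exact hco.1.trans l2
  · exact hco.2.1.trans l2
  · exact hco.2.2.trans l2

/-- If there are four points in a star, they lie on a cross. -/
theorem IsStar.exists_cross {ι : Type*} [Finite ι] (h4 : Nat.card ι = 4) {R c c' : ℝ}
    (hc' : 0 < c') {a : ι → Plane} {s : ι → ι} (hs : IsStar R c a s)
    (hn : ∀ i, c' ≤ cr (a i) (a (s i))) (i : ι) :
    ∃ ρ ρ' : ℝ, c' / R ^ 2 ≤ ρ ∧ c' / R ^ 2 ≤ ρ' ∧ a (s (s i)) = -ρ • a i ∧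
      a (s (s (s i))) = -ρ' • a (s i) := by
  classical
  have := Fintype.ofFinite ι
  have anti : ∀ x y : Plane, cr y x = - cr x y := fun x y => by simp only [cr]; ring
  have n1 : ∀ j, s j ≠ j := by
    intro j hj
    have := hn j
    rw [hj] at this
    have h0 : cr (a j) (a j) = 0 := by simp only [cr]; ring
    linarith
  have n2 : ∀ j, s (s j) ≠ j := by
    intro j hj
    have h1 := hn j
    have h2 := hn (s j)
    rw [hj, anti] at h2
    linarith
  have n3 : ∀ j, s (s (s j)) ≠ j := by
    intro j hj
    have h1 := hs.angle j
    have h2 := hn (s (s j))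
    rw [hj, anti] at h2
    linarith
  -- One, two or three steps never return to the start, so by counting the fourth one does.
  have hcyc : ∀ j, s (s (s (s j))) = j := by
    intro j
    by_contra hne
    have : ({j, s j, s (s j), s (s (s j)), s (s (s (s j)))} : Finset ι).card = 5 := by
      rw [Finset.card_insert_of_notMem, Finset.card_insert_of_notMem,
        Finset.card_insert_of_notMem, Finset.card_insert_of_notMem, Finset.card_singleton]
      · simp only [Finset.mem_singleton]; exact (n1 _).symm
      · simp only [Finset.mem_insert, Finset.mem_singleton, not_or]
        exact ⟨(n1 _).symm, (n2 _).symm⟩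
      · simp only [Finset.mem_insert, Finset.mem_singleton, not_or]
        exact ⟨(n1 _).symm, (n2 _).symm, (n3 _).symm⟩
      · simp only [Finset.mem_insert, Finset.mem_singleton, not_or]
        exact ⟨(n1 _).symm, (n2 _).symm, (n3 _).symm, fun h => hne h.symm⟩
    have h5 := Finset.card_le_univ
      ({j, s j, s (s j), s (s (s j)), s (s (s (s j)))} : Finset ι)
    rw [this, ← Nat.card_eq_fintype_card, h4] at h5
    omega
  -- The angle condition at `j` and at `s (s j)` bounds the two complementary pairs of angles by
  -- `π`. They add up to a full turn, so both equal `π` and opposite neighbours are collinear with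
  -- the origin.
  have key : ∀ j, ∃ ρ : ℝ, c' / R ^ 2 ≤ ρ ∧ a (s (s j)) = -ρ • a j := by
    intro j
    have h1 := hs.angle j
    have h2 := hs.angle (s (s j))
    rw [hcyc, anti] at h2
    have hE : cr (a j) (a (s (s j))) = 0 := by linarith
    have hD := hc'.trans_le (hn j)
    refine ⟨cr (a (s j)) (a (s (s j))) / cr (a j) (a (s j)), ?_, ?_⟩
    · have hD2 : cr (a j) (a (s j)) ≤ R ^ 2 := by
        refine (le_abs_self _).trans ((abs_cr_le _ _).trans ?_)
        rw [sq]
        exact mul_le_mul (hs.norm_le _) (hs.norm_le _) (norm_nonneg _)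
          ((norm_nonneg _).trans (hs.norm_le j))
      exact div_le_div₀ (hc'.le.trans (hn (s j))) (hn (s j)) hD hD2
    · apply plane_ext <;> simp only [PiLp.smul_apply, smul_eq_mul] <;> field_simp <;>
        simp only [cr] at hE ⊢
      · linear_combination a (s j) 0 * hE
      · linear_combination a (s j) 1 * hE
  obtain ⟨ρ, h1, h2⟩ := key i
  obtain ⟨ρ', h3, h4⟩ := key (s i)
  exact ⟨ρ, ρ', h1, h3, h2, h4⟩

/-! ### Stability of the edge values on a patch -/

theorem edgeMidpoint_pair {a b : Plane} (hab : a ≠ b) :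
    edgeMidpoint {a, b} = (2 : ℝ)⁻¹ • (a + b) := by
  rw [edgeMidpoint, Finset.sum_pair hab]

theorem pair_mem_edgesOf {S : Finset (Finset Plane)} {T : Finset Plane} (hT : T ∈ S) {a b : Plane}
    (ha : a ∈ T) (hb : b ∈ T) (hab : a ≠ b) : {a, b} ∈ edgesOf S := by
  rw [edgesOf, Finset.mem_biUnion]
  refine ⟨T, hT, Finset.mem_powersetCard.2 ⟨?_, Finset.card_pair hab⟩⟩
  intro x hx
  simp only [Finset.mem_insert, Finset.mem_singleton] at hx
  rcases hx with rfl | rfl <;> assumption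

theorem edge_bound {S : Finset (Finset Plane)} {z : Plane} {h R c : ℝ} (hb : IsBounded S z h R c)
    {r : Plane →ᵃ[ℝ] Mat} {η : ℝ}
    (hη : ∀ e ∈ edgesOf S, |normalNormal e (r (edgeMidpoint e))| ≤ η) {k l : Fin 5 → ℝ}
    (hs : IsStrain r z h k l) {T : Finset Plane} (hT : T ∈ S) {p q : Plane} (hp : p ∈ T)
    (hq : q ∈ T) (hpq : p ≠ q) :
    |(quad k (h⁻¹ • (q - z)) - quad k (h⁻¹ • (p - z))) *
        ((h⁻¹ • (q - z)) 0 - (h⁻¹ • (p - z)) 0) +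
      (quad l (h⁻¹ • (q - z)) - quad l (h⁻¹ • (p - z))) *
        ((h⁻¹ • (q - z)) 1 - (h⁻¹ • (p - z)) 1)| ≤ R ^ 2 * η := by
  have hh := hb.pos
  rw [hs.edge]
  have e1 : z + h • ((2 : ℝ)⁻¹ • (h⁻¹ • (p - z) + h⁻¹ • (q - z))) = edgeMidpoint {p, q} := by
    rw [edgeMidpoint_pair hpq, ← smul_add, smul_comm (2 : ℝ)⁻¹, smul_inv_smul₀ hh.ne']
    module
  have e2 : h⁻¹ • (q - z) - h⁻¹ • (p - z) = h⁻¹ • (q - p) := by module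
  have e3 : ∀ A : Mat, ∀ d : Plane, normalForm A (h⁻¹ • d) = normalForm A d / h ^ 2 := by
    intro A d
    simp only [normalForm, PiLp.smul_apply, smul_eq_mul]
    ring
  rw [e1, e2, e3, normalForm_eq hpq]
  have h1 := hη _ (pair_mem_edgesOf hT hp hq hpq)
  have h2 : ‖q - p‖ ^ 2 / h ^ 2 ≤ R ^ 2 := by
    rw [div_le_iff₀ (by positivity), ← mul_pow]
    exact pow_le_pow_left₀ (norm_nonneg _) (hb.diam_le T hT q hq p hp) 2
  rw [mul_div_right_comm, abs_mul, abs_of_nonneg (by positivity)]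
  exact mul_le_mul h2 h1 (abs_nonneg _) (sq_nonneg _)

/-- The edge values of an affine field bound a displacement at all vertices of the patch. -/
theorem exists_displacement_bound (N : ℕ) {R c : ℝ} (hR : 0 < R) (hc : 0 < c) :
    ∃ B : ℝ, 0 < B ∧ ∀ (S : Finset (Finset Plane)) (z : Plane) (h : ℝ), IsBounded S z h R c →
      EdgeConnected S → S.card ≤ N → (∀ T ∈ S, T.card = 3) →
      ∀ T₀ ∈ S, z ∈ T₀ → ∀ r : Plane →ᵃ[ℝ] Mat, (∀ x, (r x).IsSymm) → ∀ η : ℝ,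
      (∀ e ∈ edgesOf S, |normalNormal e (r (edgeMidpoint e))| ≤ η) →
      ∃ k l, IsStrain r z h k l ∧ ∀ T ∈ S, ∀ w ∈ T, |quad k (h⁻¹ • (w - z))| ≤ B * η ∧
        |quad l (h⁻¹ • (w - z))| ≤ B * η := by
  -- `F` is the loss of `rigid_step` at a new vertex, and `G` covers the first edge (`rigid_base`).
  -- In the final constant, one `F` is for the third vertex of `T₀` and `F ^ N` for the chain from
  -- `T₀`.
  set F := 1 + 2 * (1 + 2 * R) * R / c with hF
  have hF1 : 1 ≤ F := by
    have : 0 < 2 * (1 + 2 * R) * R / c := by positivity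
    linarith
  set G := 1 + R / (c / R) ^ 2 with hG
  have hG1 : 1 ≤ G := by
    have : 0 < R / (c / R) ^ 2 := by positivity
    linarith
  refine ⟨F ^ N * (F * (G * R ^ 2)), by positivity, ?_⟩
  intro S z h hb hconn hcard h3 T₀ hT₀ hzT₀ r hr η hη
  have hh := hb.pos
  have hh2 : 0 < h ^ 2 := by positivity
  set y : Plane → Plane := fun w => h⁻¹ • (w - z) with hy
  have hyd : ∀ p q, y p - y q = h⁻¹ • (p - q) := fun p q => by simp only [hy]; module
  have hdiam : ∀ T ∈ S, ∀ p ∈ T, ∀ q ∈ T, ‖y p - y q‖ ≤ R := by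
    intro T hT p hp q hq
    rw [hyd, norm_smul, norm_inv, Real.norm_of_nonneg hh.le, inv_mul_le_iff₀ hh, mul_comm]
    exact hb.diam_le T hT p hp q hq
  have harea : ∀ T ∈ S, ∀ d a b, T = {d, a, b} → c ≤ |cr (y d - y a) (y d - y b)| := by
    intro T hT d a b he
    rw [hyd, hyd, cr_scaled, abs_div, abs_of_pos hh2, le_div_iff₀ hh2]
    refine (hb.area_ge T hT d a b he).trans (le_of_eq ?_)
    congr 1
    simp only [cr, PiLp.sub_apply]
    ring
  obtain ⟨a, b, ha, hbz, hab, hT₀e⟩ : ∃ p q, p ≠ z ∧ q ≠ z ∧ p ≠ q ∧ T₀ = {z, p, q} := by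
    classical
    have : (T₀.erase z).card = 2 := by rw [Finset.card_erase_of_mem hzT₀, h3 T₀ hT₀]
    obtain ⟨p, q, hpq, he⟩ := Finset.card_eq_two.1 this
    have hp : p ∈ T₀.erase z := by rw [he]; simp
    have hq : q ∈ T₀.erase z := by rw [he]; simp
    refine ⟨p, q, Finset.ne_of_mem_erase hp, Finset.ne_of_mem_erase hq, hpq, ?_⟩
    rw [← he, Finset.insert_erase hzT₀]
  have hzm : z ∈ T₀ := hzT₀
  have ham : a ∈ T₀ := by rw [hT₀e]; simp
  have hbm : b ∈ T₀ := by rw [hT₀e]; simp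
  have hyz : y z = 0 := by simp [hy]
  have haR : ‖y a‖ ≤ R := by
    have := hdiam T₀ hT₀ a ham z hzm
    rwa [hyz, sub_zero] at this
  have hac : c / R ≤ ‖y a‖ := by
    rw [div_le_iff₀ hR]
    have h1 := harea T₀ hT₀ z a b hT₀e
    rw [hyz, zero_sub, zero_sub] at h1
    refine h1.trans ((abs_cr_le _ _).trans ?_)
    rw [norm_neg, norm_neg]
    have := hdiam T₀ hT₀ b hbm z hzm
    rw [hyz, sub_zero] at this
    exact mul_le_mul_of_nonneg_left this (norm_nonneg _)
  have hcR : 0 < c / R := by positivity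
  -- All rigid motions are eliminated: the displacement vanishes at `z`, and at `a` it only has a
  -- component along the edge, which is the stretching of this edge.
  obtain ⟨k, l, hs, hperp⟩ := exists_isStrain r hr z h (y a) (hcR.trans_le hac)
  refine ⟨k, l, hs, ?_⟩
  have hη0 : 0 ≤ η := (abs_nonneg _).trans (hη _ (pair_mem_edgesOf hT₀ hzm ham ha.symm))
  have hη' : 0 ≤ R ^ 2 * η := by positivity
  have hedge : ∀ T ∈ S, ∀ p ∈ T, ∀ q ∈ T, p ≠ q →
      |(quad k (y q) - quad k (y p)) * ((y q) 0 - (y p) 0) +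
        (quad l (y q) - quad l (y p)) * ((y q) 1 - (y p) 1)| ≤ R ^ 2 * η :=
    fun T hT p hp q hq hpq => edge_bound hb hη hs hT hp hq hpq
  have hq0 : ∀ m : Fin 5 → ℝ, quad m (y z) = 0 := by
    intro m; rw [hyz]; simp [quad]
  have hbase := rigid_base (η := R ^ 2 * η) hcR hη' haR hac hperp (by
    have := hedge T₀ hT₀ z hzm a ham ha.symm
    rw [hq0, hq0, hyz] at this
    simpa using this)
  set M₁ := G * (R ^ 2 * η) with hM₁
  have hM₁0 : 0 ≤ M₁ := by positivity
  have hηM : R ^ 2 * η ≤ M₁ := le_mul_of_one_le_left hη' hG1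
  have hGM : R / (c / R) ^ 2 * (R ^ 2 * η) ≤ M₁ :=
    mul_le_mul_of_nonneg_right (by linarith) hη'
  have step : ∀ T ∈ S, ∀ d a b, d ≠ a → d ≠ b → T = {d, a, b} → ∀ M, M₁ ≤ M →
      |quad k (y a)| ≤ M → |quad l (y a)| ≤ M → |quad k (y b)| ≤ M → |quad l (y b)| ≤ M →
      |quad k (y d)| ≤ F * M ∧ |quad l (y d)| ≤ F * M := by
    intro T hT d a b hda hdb he M hM hka hla hkb hlb
    have hd : d ∈ T := by rw [he]; simp
    have ha : a ∈ T := by rw [he]; simp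
    have hb : b ∈ T := by rw [he]; simp
    exact rigid_step hR hc (hηM.trans hM) (hdiam T hT d hd a ha) (hdiam T hT d hd b hb)
      (harea T hT d a b he) hka hla hkb hlb (hedge T hT a ha d hd hda.symm)
      (hedge T hT b hb d hd hdb.symm)
  have hP0 : ∀ w ∈ T₀, |quad k (y w)| ≤ F * M₁ ∧ |quad l (y w)| ≤ F * M₁ := by
    have hle : M₁ ≤ F * M₁ := le_mul_of_one_le_left hM₁0 hF1
    have h1 := hbase.1.trans hGM
    have h2 := hbase.2.trans hGM
    have h0 : ∀ m, |quad m (y z)| ≤ M₁ := fun m => by rw [hq0, abs_zero]; exact hM₁0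
    intro w hw
    rw [hT₀e] at hw
    simp only [Finset.mem_insert, Finset.mem_singleton] at hw
    rcases hw with rfl | rfl | rfl
    · exact ⟨(h0 _).trans hle, (h0 _).trans hle⟩
    · exact ⟨h1.trans hle, h2.trans hle⟩
    · refine step T₀ hT₀ w z a hbz hab.symm ?_ M₁ le_rfl (h0 _) (h0 _) h1 h2
      rw [hT₀e]
      ext x
      simp only [Finset.mem_insert, Finset.mem_singleton]
      tauto
  intro T hT w hw
  have := hconn.chain_bound hcard (P := fun M A => ∀ w ∈ A, |quad k (y w)| ≤ M ∧
      |quad l (y w)| ≤ M) (M₀ := F * M₁) hF1 (by positivity)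
    (fun A M M' hMM hA w hw => ⟨(hA w hw).1.trans hMM, (hA w hw).2.trans hMM⟩) ?_ hT₀ hT
    le_rfl hP0
  · have h1 := this w hw
    have e : F ^ N * (F * (G * R ^ 2)) * η = F ^ N * (F * M₁) := by rw [hM₁]; ring
    rw [e]
    exact h1
  · intro A hA A' hA' hshare M hM hAM
    have hM0 : 0 ≤ M := (by positivity : 0 ≤ F * M₁).trans hM
    have hM1 : M₁ ≤ M := (le_mul_of_one_le_left hM₁0 hF1).trans hM
    have hle : M ≤ F * M := le_mul_of_one_le_left hM0 hF1
    obtain ⟨a, b, c, d, -, -, -, hda, hdb, -, hAe, hAe'⟩ :=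
      hshare.exists_vertices (h3 A hA) (h3 A' hA')
    have pa := hAM a (by rw [hAe]; simp)
    have pb := hAM b (by rw [hAe]; simp)
    intro w hw
    rw [hAe'] at hw
    simp only [Finset.mem_insert, Finset.mem_singleton] at hw
    rcases hw with rfl | rfl | rfl
    · exact ⟨pa.1.trans hle, pa.2.trans hle⟩
    · exact ⟨pb.1.trans hle, pb.2.trans hle⟩
    · refine step A' hA' w a b hda hdb ?_ M hM1 pa.1 pa.2 pb.1 pb.2
      rw [hAe']
      ext x
      simp only [Finset.mem_insert, Finset.mem_singleton]
      tauto

/-- Some vertex of the patch is away from the two lines through `z` and two neighbours. -/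
def AwayFromAxes {K : Triangulation} (P : PatchAssignment K) (z : Plane) (h δ : ℝ) : Prop :=
  ∀ a b : Plane, K.DirectlyConnected z a → K.DirectlyConnected z b → ∃ w ∈ P.patchNodes z,
    δ * h ^ 2 ≤ |cr (a - z) (w - z)| ∧ δ * h ^ 2 ≤ |cr (b - z) (w - z)|

theorem IsStrain.abs_le {r : Plane →ᵃ[ℝ] Mat} {z : Plane} {h : ℝ} {k l : Fin 5 → ℝ}
    (hs : IsStrain r z h k l) {M R : ℝ} (hk : ∀ m, |k m| ≤ M) (hl : ∀ m, |l m| ≤ M) {y : Plane}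
    (hy : ‖y‖ ≤ R) (i j : Fin 2) : |r (z + h • y) i j| ≤ (1 + 3 * R) * M := by
  have h0 := (abs_apply_le_norm y 0).trans hy
  have h1 := (abs_apply_le_norm y 1).trans hy
  have hM : 0 ≤ M := (abs_nonneg _).trans (hk 0)
  have hR : 0 ≤ R := (abs_nonneg _).trans h0
  have main : ∀ p q s : ℝ, |p| ≤ M → |q| ≤ M → |s| ≤ M → ∀ u v, |u| ≤ R → |v| ≤ R →
      |p + 2 * q * u + s * v| ≤ (1 + 3 * R) * M := by
    intro p q s hp hq hs u v hu hv
    have e : p + 2 * q * u + s * v = p * 1 + q * (2 * u) + s * v := by ring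
    rw [e]
    refine (abs_three_le hp hq hs (abs_one.le) (Q := 2 * R) ?_ hv).trans (le_of_eq (by ring))
    rw [abs_mul]; simpa using hu
  have h01 : |r (z + h • y) 0 1| ≤ (1 + 3 * R) * M := by
    have e : r (z + h • y) 0 1 = -((k 1 + 2 * k 4 * y 1 + k 3 * y 0) +
        (l 0 + 2 * l 2 * y 0 + l 3 * y 1)) / 2 := by rw [hs.eq01]; ring
    rw [e, abs_div, abs_neg, abs_two]
    have i1 := main _ _ _ (hk 1) (hk 4) (hk 3) _ _ h1 h0
    have i2 := main _ _ _ (hl 0) (hl 2) (hl 3) _ _ h0 h1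
    have := abs_add_le (k 1 + 2 * k 4 * y 1 + k 3 * y 0) (l 0 + 2 * l 2 * y 0 + l 3 * y 1)
    linarith
  fin_cases i <;> fin_cases j
  · change |r (z + h • y) 0 0| ≤ _
    have e : l 1 + l 3 * y 0 + 2 * l 4 * y 1 = l 1 + 2 * l 4 * y 1 + l 3 * y 0 := by ring
    rw [hs.eq00, e]
    exact main _ _ _ (hl 1) (hl 4) (hl 3) _ _ h1 h0
  · exact h01
  · change |r (z + h • y) 1 0| ≤ _
    rw [hs.symm]; exact h01
  · change |r (z + h • y) 1 1| ≤ _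
    rw [hs.eq11]
    exact main _ _ _ (hk 0) (hk 2) (hk 3) _ _ h0 h1

/-- The strain at the centre involves only the linear part of the displacement. This is why a cross
of four neighbours suffices for the value at an interior vertex. -/
theorem IsStrain.abs_le_center {r : Plane →ᵃ[ℝ] Mat} {z : Plane} {h : ℝ} {k l : Fin 5 → ℝ}
    (hs : IsStrain r z h k l) {M : ℝ} (hk0 : |k 0| ≤ M) (hk1 : |k 1| ≤ M) (hl0 : |l 0| ≤ M)
    (hl1 : |l 1| ≤ M) (i j : Fin 2) : |r z i j| ≤ M := by
  have e : z + h • (0 : Plane) = z := by simp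
  have e00 := hs.eq00 0
  have e11 := hs.eq11 0
  have e01 := hs.eq01 0
  have e10 := hs.symm 0
  rw [e] at e00 e11 e01 e10
  have h01 : |r z 0 1| ≤ M := by
    rw [e01]
    simp only [PiLp.zero_apply, mul_zero, add_zero]
    rw [abs_div, abs_neg, abs_two]
    have := abs_add_le (k 1) (l 0)
    linarith
  fin_cases i <;> fin_cases j
  · change |r z 0 0| ≤ _
    rw [e00]; simpa using hl1
  · exact h01
  · change |r z 1 0| ≤ _
    rw [e10]; exact h01
  · change |r z 1 1| ≤ _
    rw [e11]; simpa using hk0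

/-- Stability of the edge values at an interior vertex. The value at the vertex is controlled by
the edge values, and if there are at least five neighbours, or a vertex of the patch off the cross
formed by four neighbours, so is the whole affine field. -/
theorem exists_stability (N : ℕ) {R c δ : ℝ} (hR : 0 < R) (hc : 0 < c) (hδ : 0 < δ) :
    ∃ C : ℝ, 0 < C ∧ ∀ (K : Triangulation) (κ : ℝ) (P : PatchAssignment K) (z : Plane) (h : ℝ),
      K.ShapeRegular κ → z ∈ K.interiorNodes → (P.patch z).card ≤ N → P.WellPosedAt z →
      IsBounded (P.patch z) z h R c → ∀ r : Plane →ᵃ[ℝ] Mat, (∀ x, (r x).IsSymm) → ∀ η : ℝ,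
      (∀ e ∈ edgesOf (P.patch z), |normalNormal e (r (edgeMidpoint e))| ≤ η) →
      (∀ i j, |r z i j| ≤ C * η) ∧
      ((K.valence z = 4 → AwayFromAxes P z h δ) →
        ∀ x, dist x z ≤ R * h → ∀ i j, |r x i j| ≤ C * η) := by
  obtain ⟨B, hB, hdisp⟩ := exists_displacement_bound N hR hc
  obtain ⟨C₁, hC₁, hquad⟩ := exists_quad_bound (N * 3) R (starConst_pos hR hc)
  have hρ₀ : 0 < c / R ^ 2 := by positivity
  obtain ⟨C₂, hC₂, hcross⟩ := exists_quad_cross_bound hR hc hρ₀ hδ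
  set C₃ := 2 * R * (1 + 1 / (c / R ^ 2)) / c with hC₃
  have hC₃0 : 0 < C₃ := by positivity
  refine ⟨(1 + 3 * R) * (C₁ + C₂ + C₃) * B, by positivity, ?_⟩
  intro K κ P z h hreg hz hcard hwp hb r hr η hη
  have hh := hb.pos
  have hzn : z ∈ K.nodes := hz.1
  have h3 : ∀ T ∈ P.patch z, T.card = 3 := fun T hT =>
    (Triangulation.mem_triangles.1 (P.patch_subset z hzn hT)).2
  obtain ⟨hval, hang, hfour⟩ := hwp
  obtain ⟨s, hstar, hnext, hpatch⟩ := exists_isStar hreg P hz hang hR hc hb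
  have hne : Nonempty (Neighbor K z) := by
    by_contra hcon
    rw [not_nonempty_iff] at hcon
    have : K.valence z = Nat.card (Neighbor K z) := rfl
    rw [Nat.card_of_isEmpty] at this
    omega
  obtain ⟨i₀⟩ := hne
  obtain ⟨k, l, hs, hkl⟩ := hdisp (P.patch z) z h hb (P.patch_connected z hzn) hcard h3 _
    (hpatch i₀) (by simp) r hr η hη
  have hη0 : 0 ≤ η := (abs_nonneg _).trans
    (hη _ (pair_mem_edgesOf (hpatch i₀) (by simp) (by simp) i₀.2.1))
  have hBη : 0 ≤ B * η := by positivity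
  have hk : ∀ i : Neighbor K z, |quad k (h⁻¹ • (i.1 - z))| ≤ B * η := fun i =>
    (hkl _ (hpatch i) i.1 (by simp)).1
  have hl : ∀ i : Neighbor K z, |quad l (h⁻¹ • (i.1 - z))| ≤ B * η := fun i =>
    (hkl _ (hpatch i) i.1 (by simp)).2
  have full : ∀ D, 0 ≤ D → D ≤ C₁ + C₂ + C₃ → (∀ m, |k m| ≤ D * (B * η)) →
      (∀ m, |l m| ≤ D * (B * η)) → ∀ x, dist x z ≤ R * h → ∀ i j,
      |r x i j| ≤ (1 + 3 * R) * (C₁ + C₂ + C₃) * B * η := by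
    intro D hD hDC hk hl x hx i j
    have e : x = z + h • (h⁻¹ • (x - z)) := by rw [smul_inv_smul₀ hh.ne']; abel
    have hn : ‖h⁻¹ • (x - z)‖ ≤ R := by
      rw [dist_eq_norm] at hx
      rw [norm_smul, norm_inv, Real.norm_of_nonneg hh.le, inv_mul_le_iff₀ hh, mul_comm]
      exact hx
    rw [e]
    refine (hs.abs_le hk hl hn i j).trans ?_
    calc (1 + 3 * R) * (D * (B * η)) ≤ (1 + 3 * R) * ((C₁ + C₂ + C₃) * (B * η)) := by gcongr
      _ = _ := by ring
  have hzz : dist z z ≤ R * h := by rw [dist_self]; positivity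
  -- With five neighbours or more, these alone control the displacement, without the other vertices
  -- of the patch.
  rcases Nat.lt_or_ge 4 (K.valence z) with h5 | h5
  · have hv : K.valence z ≤ N * 3 :=
      (valence_le (P.patch_subset z hzn) (P.star_subset z hz)).trans (by omega)
    have hk' := hquad (Neighbor K z) _ s h5 hv hstar k _ hk
    have hl' := hquad (Neighbor K z) _ s h5 hv hstar l _ hl
    have := full C₁ hC₁.le (by linarith) hk' hl'
    exact ⟨this z hzz, fun _ => this⟩
  · have h4 : K.valence z = 4 := le_antisymm h5 hval
    obtain ⟨ρ, ρ', hρ, hρ', e1, e2⟩ :=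
      IsStar.exists_cross (ι := Neighbor K z) h4 hc hstar hnext i₀
    have hcrossed : ∀ m : Fin 5 → ℝ, (∀ i : Neighbor K z, |quad m (h⁻¹ • (i.1 - z))| ≤ B * η) →
        |quad m (-ρ • (h⁻¹ • (i₀.1 - z)))| ≤ B * η ∧
        |quad m (-ρ' • (h⁻¹ • ((s i₀).1 - z)))| ≤ B * η := by
      intro m hm
      rw [← e1, ← e2]
      exact ⟨hm _, hm _⟩
    refine ⟨?_, fun hoff => ?_⟩
    -- At the centre the constant does not depend on the position of the remaining vertices; only
    -- the second claim uses one off the cross.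
    · have h1 := quad_cross_linear hc (hstar.norm_le i₀) (hstar.norm_le (s i₀)) (hnext i₀) hρ₀ hρ
        hρ' (hk i₀) (hcrossed k hk).1 (hk (s i₀)) (hcrossed k hk).2
      have h2 := quad_cross_linear hc (hstar.norm_le i₀) (hstar.norm_le (s i₀)) (hnext i₀) hρ₀ hρ
        hρ' (hl i₀) (hcrossed l hl).1 (hl (s i₀)) (hcrossed l hl).2
      rw [← hC₃] at h1 h2
      intro i j
      refine (hs.abs_le_center h1.1 h1.2 h2.1 h2.2 i j).trans ?_
      have : C₃ ≤ (1 + 3 * R) * (C₁ + C₂ + C₃) := by nlinarith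
      calc C₃ * (B * η) ≤ (1 + 3 * R) * (C₁ + C₂ + C₃) * (B * η) :=
            mul_le_mul_of_nonneg_right this hBη
        _ = _ := by ring
    · obtain ⟨w, ⟨T, hT, hwT⟩, hw1, hw2⟩ := hoff h4 i₀.1 (s i₀).1 i₀.2 (s i₀).2
      have hwn : ‖h⁻¹ • (w - z)‖ ≤ R := by
        have := hb.dist_le T hT w hwT
        rw [dist_eq_norm] at this
        rw [norm_smul, norm_inv, Real.norm_of_nonneg hh.le, inv_mul_le_iff₀ hh, mul_comm]
        exact this
      have hh2 : 0 < h ^ 2 := by positivity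
      have hd : ∀ a : Plane, δ * h ^ 2 ≤ |cr (a - z) (w - z)| →
          δ ≤ |cr (h⁻¹ • (a - z)) (h⁻¹ • (w - z))| := by
        intro a ha
        rw [cr_scaled, abs_div, abs_of_pos hh2, le_div_iff₀ hh2]
        exact ha
      have hkw := hkl T hT w hwT
      refine full C₂ hC₂.le (by linarith) ?_ ?_
      · exact hcross k _ _ _ ρ ρ' _ (hstar.norm_le i₀) (hstar.norm_le (s i₀)) hwn (hnext i₀) hρ hρ'
          (hk i₀) (hcrossed k hk).1 (hk (s i₀)) (hcrossed k hk).2 hkw.1 (hd _ hw1) (hd _ hw2)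
      · exact hcross l _ _ _ ρ ρ' _ (hstar.norm_le i₀) (hstar.norm_le (s i₀)) hwn (hnext i₀) hρ hρ'
          (hl i₀) (hcrossed l hl).1 (hl (s i₀)) (hcrossed l hl).2 hkw.2 (hd _ hw1) (hd _ hw2)

end Plate

namespace Plate

/-! ### Coordinates of a parallelogram -/

/-- The first coordinate with respect to the basis `u`, `v`. -/
def coordS (u v : Plane) : Plane →L[ℝ] ℝ :=
  LinearMap.toContinuousLinearMap
    { toFun := fun w => cr w v / cr u v
      map_add' := fun x y => by simp only [cr, PiLp.add_apply]; ring
      map_smul' := fun t x => by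
        simp only [cr, PiLp.smul_apply, smul_eq_mul, RingHom.id_apply]
        ring }

/-- The second coordinate with respect to the basis `u`, `v`. -/
def coordT (u v : Plane) : Plane →L[ℝ] ℝ :=
  LinearMap.toContinuousLinearMap
    { toFun := fun w => cr u w / cr u v
      map_add' := fun x y => by simp only [cr, PiLp.add_apply]; ring
      map_smul' := fun t x => by
        simp only [cr, PiLp.smul_apply, smul_eq_mul, RingHom.id_apply]
        ring }

theorem coordS_apply (u v w : Plane) : coordS u v w = cr w v / cr u v := rfl

theorem coordT_apply (u v w : Plane) : coordT u v w = cr u w / cr u v := rfl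

theorem coord_eq {u v : Plane} (h : cr u v ≠ 0) (x y : Plane) :
    y = x + coordS u v (y - x) • u + coordT u v (y - x) • v := by
  have := eq_combo h (y - x)
  rw [coordS_apply, coordT_apply, add_assoc, ← this]
  abel

theorem coordS_combo {u v : Plane} (h : cr u v ≠ 0) (x : Plane) (s t : ℝ) :
    coordS u v (x + s • u + t • v - x) = s := by
  rw [coordS_apply, div_eq_iff h]
  simp only [cr, PiLp.add_apply, PiLp.sub_apply, PiLp.smul_apply, smul_eq_mul]
  ring

theorem coordT_combo {u v : Plane} (h : cr u v ≠ 0) (x : Plane) (s t : ℝ) :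
    coordT u v (x + s • u + t • v - x) = t := by
  rw [coordT_apply, div_eq_iff h]
  simp only [cr, PiLp.add_apply, PiLp.sub_apply, PiLp.smul_apply, smul_eq_mul]
  ring

/-- A product of functions of the coordinates. -/
def tensor (x u v : Plane) (B C : ℝ → ℝ) (y : Plane) : ℝ :=
  B (coordS u v (y - x)) * C (coordT u v (y - x))

/-- Translation, the linear substitution `frame u v` with determinant `cr u v`, and Fubini. -/
theorem integral_tensor {x u v : Plane} (h : cr u v ≠ 0) (B C : ℝ → ℝ) :
    ∫ y, tensor x u v B C y = |cr u v| * ((∫ r, B r) * ∫ r, C r) := by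
  have hdet : LinearMap.det (frame u v) ≠ 0 := by rw [det_frame]; exact h
  have h1 : ∫ y, tensor x u v B C y = ∫ y, B (coordS u v y) * C (coordT u v y) := by
    simp only [tensor]
    exact integral_sub_right_eq_self (fun y => B (coordS u v y) * C (coordT u v y)) x
  have hemb : MeasurableEmbedding (frame u v) := by
    let e := ((frame u v).equivOfDetNeZero hdet).toContinuousLinearEquiv
    exact e.toHomeomorph.measurableEmbedding
  have h2 := hemb.integral_map (μ := volume) (fun y => B (coordS u v y) * C (coordT u v y))
  rw [Measure.map_linearMap_addHaar_eq_smul_addHaar _ hdet, integral_smul_measure, det_frame,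
    ENNReal.toReal_ofReal (abs_nonneg _), abs_inv, smul_eq_mul] at h2
  have h3 : ∀ p : Plane, B (coordS u v (frame u v p)) * C (coordT u v (frame u v p)) =
      B (p 0) * C (p 1) := by
    intro p
    have e1 := coordS_combo h 0 (p 0) (p 1)
    have e2 := coordT_combo h 0 (p 0) (p 1)
    rw [zero_add, sub_zero] at e1 e2
    rw [frame_apply, e1, e2]
  simp only [h3] at h2
  have h4 : ∫ p : Plane, B (p 0) * C (p 1) = (∫ r, B r) * ∫ r, C r := by
    have e1 := (PiLp.volume_preserving_ofLp (Fin 2)).integral_comp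
      (MeasurableEquiv.toLp 2 (Fin 2 → ℝ)).symm.measurableEmbedding
      (fun p : Fin 2 → ℝ => B (p 0) * C (p 1))
    rw [e1]
    have e2 := integral_fintype_prod_volume_eq_prod (ι := Fin 2) (E := fun _ => ℝ) (𝕜 := ℝ) ![B, C]
    simpa [Fin.prod_univ_two] using e2
  rw [h1, ← h4, ← h2, mul_inv_cancel_left₀ (abs_pos.2 h).ne']

theorem contDiff_tensor {x u v : Plane} {B C : ℝ → ℝ} (hB : ContDiff ℝ ∞ B)
    (hC : ContDiff ℝ ∞ C) : ContDiff ℝ ∞ (tensor x u v B C) := by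
  unfold tensor
  fun_prop

theorem continuous_tensor {x u v : Plane} {B C : ℝ → ℝ} (hB : Continuous B)
    (hC : Continuous C) : Continuous (tensor x u v B C) := by
  unfold tensor
  fun_prop

theorem fderiv_tensor {x u v : Plane} {B C : ℝ → ℝ} (hB : ContDiff ℝ ∞ B)
    (hC : ContDiff ℝ ∞ C) (y w : Plane) :
    fderiv ℝ (tensor x u v B C) y w =
      tensor x u v (deriv B) C y * coordS u v w + tensor x u v B (deriv C) y * coordT u v w := by
  have hB' : HasDerivAt B (deriv B (coordS u v (y - x))) (coordS u v (y - x)) :=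
    (hB.differentiable (by simp)).differentiableAt.hasDerivAt
  have hC' : HasDerivAt C (deriv C (coordT u v (y - x))) (coordT u v (y - x)) :=
    (hC.differentiable (by simp)).differentiableAt.hasDerivAt
  have hs : ∀ L : Plane →L[ℝ] ℝ, HasFDerivAt (fun y => L (y - x)) L y := fun L =>
    L.hasFDerivAt.comp y ((hasFDerivAt_id y).sub_const x)
  have h1 := hB'.comp_hasFDerivAt y (hs (coordS u v))
  have h2 := hC'.comp_hasFDerivAt y (hs (coordT u v))
  have h3 := h1.mul h2
  have : fderiv ℝ (tensor x u v B C) y = _ := h3.fderiv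
  rw [this]
  simp only [Function.comp_apply, tensor, add_apply,
    smul_apply, smul_eq_mul]
  ring

/-! ### Smooth cutoff functions -/

/-- A smooth function that increases from `0` to `1` in the interval from `0` to `ε`. -/
def smoothStep (ε r : ℝ) : ℝ := Real.smoothTransition (r / ε)

theorem contDiff_smoothStep (ε : ℝ) : ContDiff ℝ ∞ (smoothStep ε) := by
  unfold smoothStep
  exact Real.smoothTransition.contDiff.comp (contDiff_id.div_const ε)

theorem smoothStep_of_nonpos {ε r : ℝ} (hε : 0 < ε) (hr : r ≤ 0) : smoothStep ε r = 0 :=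
  Real.smoothTransition.zero_of_nonpos (div_nonpos_of_nonpos_of_nonneg hr hε.le)

theorem smoothStep_of_le {ε r : ℝ} (hε : 0 < ε) (hr : ε ≤ r) : smoothStep ε r = 1 :=
  Real.smoothTransition.one_of_one_le ((one_le_div hε).2 hr)

theorem monotone_smoothStep {ε : ℝ} (hε : 0 < ε) : Monotone (smoothStep ε) := fun _ _ h =>
  Real.smoothTransition.monotone (div_le_div_of_nonneg_right h hε.le)

theorem continuous_deriv_smoothStep (ε : ℝ) : Continuous (deriv (smoothStep ε)) :=
  (contDiff_smoothStep ε).continuous_deriv (by simp)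

theorem deriv_smoothStep_eq_zero {ε r : ℝ} (hε : 0 < ε) (hr : r ∉ Set.Icc 0 ε) :
    deriv (smoothStep ε) r = 0 := by
  rw [Set.mem_Icc, not_and_or, not_le, not_le] at hr
  rcases hr with hr | hr
  · have : smoothStep ε =ᶠ[nhds r] fun _ => 0 :=
      (Iio_mem_nhds hr : Set.Iio (0 : ℝ) ∈ nhds r) |> fun h => Filter.eventually_of_mem h
        fun y hy => smoothStep_of_nonpos hε (le_of_lt hy)
    rw [this.deriv_eq, deriv_const]
  · have : smoothStep ε =ᶠ[nhds r] fun _ => 1 :=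
      (Ioi_mem_nhds hr : Set.Ioi ε ∈ nhds r) |> fun h => Filter.eventually_of_mem h
        fun y hy => smoothStep_of_le hε (le_of_lt hy)
    rw [this.deriv_eq, deriv_const]

theorem integral_deriv_smoothStep {ε : ℝ} (hε : 0 < ε) : ∫ r, deriv (smoothStep ε) r = 1 := by
  have hcs : HasCompactSupport (deriv (smoothStep ε)) :=
    HasCompactSupport.intro isCompact_Icc fun r hr => deriv_smoothStep_eq_zero hε hr
  have := integral_of_hasDerivAt_of_tendsto (f := smoothStep ε) (f' := deriv (smoothStep ε))
    (m := 0) (n := 1)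
    (fun r => ((contDiff_smoothStep ε).differentiable (by simp)).differentiableAt.hasDerivAt)
    ((continuous_deriv_smoothStep ε).integrable_of_hasCompactSupport hcs)
    (tendsto_const_nhds.congr' ?_) (tendsto_const_nhds.congr' ?_)
  · rw [this, sub_zero]
  · filter_upwards [Filter.eventually_le_atBot 0] with r hr
    exact (smoothStep_of_nonpos hε hr).symm
  · filter_upwards [Filter.eventually_ge_atTop ε] with r hr
    exact (smoothStep_of_le hε hr).symm

/-- A smooth approximation of the characteristic function of the unit interval. -/
def cutoff (ε r : ℝ) : ℝ := smoothStep ε (r - ε) - smoothStep ε (r - (1 - 2 * ε))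

theorem contDiff_cutoff (ε : ℝ) : ContDiff ℝ ∞ (cutoff ε) := by
  unfold cutoff
  exact ((contDiff_smoothStep ε).comp (contDiff_id.sub contDiff_const)).sub
    ((contDiff_smoothStep ε).comp (contDiff_id.sub contDiff_const))

/-- Two bumps of mass one with opposite signs, near `0` and near `1`. The product of two such
derivatives therefore averages over the four corners of a parallelogram, with the signs of the mixed
second difference. -/
theorem deriv_cutoff (ε r : ℝ) : deriv (cutoff ε) r =
    deriv (smoothStep ε) (r - ε) - deriv (smoothStep ε) (r - (1 - 2 * ε)) := by
  have hd := (contDiff_smoothStep ε).differentiable (by simp)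
  have h : ∀ a, HasDerivAt (fun r => smoothStep ε (r - a)) (deriv (smoothStep ε) (r - a)) r :=
    fun a => by
      exact (hd (r - a)).hasDerivAt.comp_sub_const r a
  exact ((h ε).sub (h (1 - 2 * ε))).deriv

theorem cutoff_eq_zero {ε r : ℝ} (hε : 0 < ε) (hε4 : ε ≤ 1 / 4) (hr : r ∉ Set.Icc ε (1 - ε)) :
    cutoff ε r = 0 := by
  rw [Set.mem_Icc, not_and_or, not_le, not_le] at hr
  rcases hr with hr | hr
  · rw [cutoff, smoothStep_of_nonpos hε (by linarith), smoothStep_of_nonpos hε (by linarith),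
      sub_zero]
  · rw [cutoff, smoothStep_of_le hε (by linarith), smoothStep_of_le hε (by linarith), sub_self]

theorem cutoff_mem {ε : ℝ} (hε : 0 < ε) (hε4 : ε ≤ 1 / 4) (r : ℝ) :
    0 ≤ cutoff ε r ∧ cutoff ε r ≤ 1 := by
  have h0 : ∀ r, 0 ≤ smoothStep ε r := fun r => Real.smoothTransition.nonneg _
  have h1 : ∀ r, smoothStep ε r ≤ 1 := fun r => Real.smoothTransition.le_one _
  refine ⟨?_, ?_⟩
  · exact sub_nonneg.2 (monotone_smoothStep hε (by linarith))
  · have := h0 (r - (1 - 2 * ε))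
    have := h1 (r - ε)
    unfold cutoff
    linarith

/-! ### Mixed second differences -/

theorem abs_integral_mul_le {μ : Measure Plane} {f g : Plane → ℝ} (hf : MemLp f 2 μ)
    (hg : MemLp g 2 μ) :
    |∫ x, f x * g x ∂μ| ≤ Real.sqrt (∫ x, f x ^ 2 ∂μ) * Real.sqrt (∫ x, g x ^ 2 ∂μ) := by
  have h := integral_mul_norm_le_Lp_mul_Lq (μ := μ) (f := f) (g := g)
    Real.HolderConjugate.two_two (by simpa using hf) (by simpa using hg)
  refine (abs_integral_le_integral_abs).trans ?_
  simp only [abs_mul]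
  refine h.trans (le_of_eq ?_)
  rw [Real.sqrt_eq_rpow, Real.sqrt_eq_rpow]
  simp

/-- Average of `f` near a corner of a parallelogram. -/
theorem corner_average {U : Set Plane} {x u v : Plane} (h : cr u v ≠ 0) {f : Plane → ℝ}
    (hf : MemLp f 2 (volume.restrict U)) {ε a b c η : ℝ} (hε : 0 < ε)
    (hclose : ∀ s ∈ Set.Icc a (a + ε), ∀ t ∈ Set.Icc b (b + ε),
      x + s • u + t • v ∈ U ∧ |f (x + s • u + t • v) - c| ≤ η) :
    Integrable (fun y => f y * tensor x u v (fun r => deriv (smoothStep ε) (r - a))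
      (fun r => deriv (smoothStep ε) (r - b)) y) (volume.restrict U) ∧
    |(∫ y in U, f y * tensor x u v (fun r => deriv (smoothStep ε) (r - a))
      (fun r => deriv (smoothStep ε) (r - b)) y) - |cr u v| * c| ≤ η * |cr u v| := by
  set ψ := tensor x u v (fun r => deriv (smoothStep ε) (r - a))
    (fun r => deriv (smoothStep ε) (r - b)) with hψ
  have hρ := continuous_deriv_smoothStep ε
  have hψc : Continuous ψ := continuous_tensor (hρ.comp (continuous_id.sub continuous_const))
    (hρ.comp (continuous_id.sub continuous_const))
  have hψ0 : ∀ y, 0 ≤ ψ y := fun y => mul_nonneg (monotone_smoothStep hε).deriv_nonneg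
    (monotone_smoothStep hε).deriv_nonneg
  have hsupp : ∀ y, ψ y ≠ 0 → coordS u v (y - x) ∈ Set.Icc a (a + ε) ∧
      coordT u v (y - x) ∈ Set.Icc b (b + ε) := by
    intro y hy
    rw [hψ, tensor] at hy
    have h1 := left_ne_zero_of_mul hy
    have h2 := right_ne_zero_of_mul hy
    have h3 : coordS u v (y - x) - a ∈ Set.Icc 0 ε := by
      by_contra hc; exact h1 (deriv_smoothStep_eq_zero hε hc)
    have h4 : coordT u v (y - x) - b ∈ Set.Icc 0 ε := by
      by_contra hc; exact h2 (deriv_smoothStep_eq_zero hε hc)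
    rw [Set.mem_Icc] at h3 h4 ⊢
    exact ⟨⟨by linarith, by linarith⟩, ⟨by linarith, by linarith⟩⟩
  have hclose' : ∀ y, ψ y ≠ 0 → y ∈ U ∧ |f y - c| ≤ η := by
    intro y hy
    obtain ⟨h1, h2⟩ := hsupp y hy
    have := hclose _ h1 _ h2
    rwa [← coord_eq h x y] at this
  have hψcs : HasCompactSupport ψ := by
    have hc : IsCompact ((fun p : ℝ × ℝ => x + p.1 • u + p.2 • v) ''
        (Set.Icc a (a + ε) ×ˢ Set.Icc b (b + ε))) :=
      (isCompact_Icc.prod isCompact_Icc).image (by fun_prop)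
    refine HasCompactSupport.intro hc fun y hy => ?_
    by_contra hne
    obtain ⟨h1, h2⟩ := hsupp y hne
    exact hy ⟨(_, _), ⟨h1, h2⟩, (coord_eq h x y).symm⟩
  have hψi : Integrable ψ := hψc.integrable_of_hasCompactSupport hψcs
  have hψU : ∫ y in U, ψ y = |cr u v| := by
    rw [setIntegral_eq_integral_of_forall_compl_eq_zero, hψ, integral_tensor h,
      integral_sub_right_eq_self (deriv (smoothStep ε)) a,
      integral_sub_right_eq_self (deriv (smoothStep ε)) b, integral_deriv_smoothStep hε]
    · ring
    · intro y hy
      by_contra hne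
      exact hy (hclose' y hne).1
  have hfi : Integrable (fun y => f y * ψ y) (volume.restrict U) :=
    hf.integrable_mul (q := 2) (hψc.memLp_of_hasCompactSupport hψcs)
  refine ⟨hfi, ?_⟩
  have e : (∫ y in U, f y * ψ y) - |cr u v| * c = ∫ y in U, (f y - c) * ψ y := by
    have e1 : ∫ y in U, c * ψ y = c * ∫ y in U, ψ y := integral_const_mul c _
    have hi : Integrable (fun y => c * ψ y) (volume.restrict U) := hψi.restrict.const_mul c
    rw [← hψU, mul_comm (∫ y in U, ψ y), ← e1, ← integral_sub hfi hi]
    congr 1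
    ext y
    ring
  have eη : ∫ y in U, η * ψ y = η * ∫ y in U, ψ y := integral_const_mul η _
  rw [e, ← hψU, ← eη, ← Real.norm_eq_abs]
  refine norm_integral_le_of_norm_le (hψi.restrict.const_mul η) (Filter.Eventually.of_forall ?_)
  intro y
  rw [Real.norm_eq_abs, abs_mul, abs_of_nonneg (hψ0 y)]
  by_cases hy : ψ y = 0
  · simp [hy]
  · exact mul_le_mul_of_nonneg_right (hclose' y hy).2 (hψ0 y)

/-- The mixed second difference of a function on a parallelogram, tested with a product. -/
theorem abs_integral_mixed_le {U : Set Plane} {f : Plane → ℝ} {g : Fin 2 → Plane → ℝ}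
    {H : Fin 2 → Fin 2 → Plane → ℝ} (hf : IsH2With U f g H) {x u v : Plane} (h : cr u v ≠ 0)
    (hU : ∀ s ∈ Set.Ioo (0 : ℝ) 1, ∀ t ∈ Set.Ioo (0 : ℝ) 1, x + s • u + t • v ∈ U) {ε : ℝ}
    (hε : 0 < ε) (hε4 : ε ≤ 1 / 4) :
    |∫ y in U, f y * tensor x u v (deriv (cutoff ε)) (deriv (cutoff ε)) y| ≤
      4 * (‖u‖ * ‖v‖) * Real.sqrt |cr u v| *
        Real.sqrt (∫ y in U, ∑ i, ∑ j, H i j y ^ 2) := by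
  set A := cutoff ε with hA
  have hAc : ContDiff ℝ ∞ A := contDiff_cutoff ε
  have hA' : ContDiff ℝ ∞ (deriv A) := (contDiff_infty_iff_deriv.1 hAc).2
  set φ := tensor x u v A A with hφ
  have hφc : ContDiff ℝ ∞ φ := contDiff_tensor hAc hAc
  set Q : Set Plane := (fun p : ℝ × ℝ => x + p.1 • u + p.2 • v) ''
        (Set.Icc ε (1 - ε) ×ˢ Set.Icc ε (1 - ε)) with hQ
  have hQc : IsCompact Q := (isCompact_Icc.prod isCompact_Icc).image (by fun_prop)
  have hQU : Q ⊆ U := by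
    rintro _ ⟨⟨s, t⟩, ⟨hs, ht⟩, rfl⟩
    exact hU s ⟨hε.trans_le hs.1, by linarith [hs.2]⟩ t ⟨hε.trans_le ht.1, by linarith [ht.2]⟩
  have hφ0 : ∀ y ∉ Q, φ y = 0 := by
    intro y hy
    by_contra hne
    have h1 : coordS u v (y - x) ∈ Set.Icc ε (1 - ε) := by
      by_contra hc; exact left_ne_zero_of_mul hne (cutoff_eq_zero hε hε4 hc)
    have h2 : coordT u v (y - x) ∈ Set.Icc ε (1 - ε) := by
      by_contra hc; exact right_ne_zero_of_mul hne (cutoff_eq_zero hε hε4 hc)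
    exact hy ⟨(_, _), ⟨h1, h2⟩, (coord_eq h x y).symm⟩
  have hφcs : HasCompactSupport φ := HasCompactSupport.intro hQc hφ0
  have hφs : tsupport φ ⊆ Q := by
    refine closure_minimal (fun y hy => ?_) hQc.isClosed
    by_contra hc
    exact hy (hφ0 y hc)
  set e : Fin 2 → Plane := fun i => EuclideanSpace.single i 1 with he
  set ψ : Fin 2 → Plane → ℝ := fun j y => fderiv ℝ φ y (e j) with hψ
  have hψc : ∀ j, ContDiff ℝ ∞ (ψ j) := fun j =>
    (hφc.fderiv_right (m := ∞) (by simp)).clm_apply contDiff_const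
  have hψcs : ∀ j, HasCompactSupport (ψ j) := fun j => hφcs.fderiv_apply ℝ (e j)
  have hψs : ∀ j, tsupport (ψ j) ⊆ Q := by
    intro j
    refine closure_minimal (fun y hy => ?_) hQc.isClosed
    have h1 : fderiv ℝ φ y ≠ 0 := by
      intro h0
      simp [hψ, h0] at hy
    exact hφs (tsupport_fderiv_subset ℝ (subset_tsupport _ h1))
  -- Two integrations by parts; the cutoffs keep the support of `φ` inside the open parallelogram.
  have hweak : ∀ i j, ∫ y in U, f y * fderiv ℝ (ψ j) y (e i) = ∫ y in U, H i j y * φ y := by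
    intro i j
    have h1 := hf.weak_grad i (ψ j) (hψc j) (hψcs j) ((hψs j).trans hQU)
    have h2 := hf.weak_hess i j φ hφc hφcs (hφs.trans hQU)
    change ∫ y in U, g i y * ψ j y = _ at h2
    rw [h2, neg_neg] at h1
    exact h1
  have hfi : ∀ i j, Integrable (fun y => f y * fderiv ℝ (ψ j) y (e i)) (volume.restrict U) := by
    intro i j
    refine hf.memLp.integrable_mul (q := 2) (Continuous.memLp_of_hasCompactSupport ?_ ?_)
    · exact (((hψc j).fderiv_right (m := ∞) (by simp)).clm_apply contDiff_const).continuous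
    · exact (hψcs j).fderiv_apply ℝ (e i)
  -- The left side is the mixed derivative of `φ` in the directions `u` and `v`, the right side its
  -- expansion in Cartesian second derivatives.
  have hpt : ∀ y, tensor x u v (deriv A) (deriv A) y =
      u 0 * v 0 * fderiv ℝ (ψ 0) y (e 0) + u 0 * v 1 * fderiv ℝ (ψ 1) y (e 0) +
      u 1 * v 0 * fderiv ℝ (ψ 0) y (e 1) + u 1 * v 1 * fderiv ℝ (ψ 1) y (e 1) := by
    intro y
    have hψe : ∀ j, ψ j = fun y => tensor x u v (deriv A) A y * coordS u v (e j) +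
        tensor x u v A (deriv A) y * coordT u v (e j) := by
      intro j
      ext y
      exact fderiv_tensor hAc hAc y (e j)
    have hd : ∀ i j, fderiv ℝ (ψ j) y (e i) =
        (tensor x u v (deriv (deriv A)) A y * coordS u v (e i) +
          tensor x u v (deriv A) (deriv A) y * coordT u v (e i)) * coordS u v (e j) +
        (tensor x u v (deriv A) (deriv A) y * coordS u v (e i) +
          tensor x u v A (deriv (deriv A)) y * coordT u v (e i)) * coordT u v (e j) := by
      intro i j
      have d1 : DifferentiableAt ℝ (tensor x u v (deriv A) A) y :=
        (contDiff_tensor hA' hAc).differentiable (by simp) y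
      have d2 : DifferentiableAt ℝ (tensor x u v A (deriv A)) y :=
        (contDiff_tensor hAc hA').differentiable (by simp) y
      rw [hψe j, fderiv_fun_add (d1.mul_const _) (d2.mul_const _), fderiv_mul_const d1,
        fderiv_mul_const d2]
      simp only [add_apply, smul_apply, smul_eq_mul,
        fderiv_tensor hA' hAc, fderiv_tensor hAc hA']
      ring
    have s0 : coordS u v (e 0) = v 1 / cr u v := by simp [coordS_apply, cr, he]
    have s1 : coordS u v (e 1) = -v 0 / cr u v := by simp [coordS_apply, cr, he]
    have t0 : coordT u v (e 0) = -u 1 / cr u v := by simp [coordT_apply, cr, he]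
    have t1 : coordT u v (e 1) = u 0 / cr u v := by simp [coordT_apply, cr, he]
    simp only [hd, s0, s1, t0, t1]
    field_simp
    simp only [cr]
    ring
  have hint : ∫ y in U, f y * tensor x u v (deriv A) (deriv A) y =
      u 0 * v 0 * (∫ y in U, H 0 0 y * φ y) + u 0 * v 1 * (∫ y in U, H 0 1 y * φ y) +
      u 1 * v 0 * (∫ y in U, H 1 0 y * φ y) + u 1 * v 1 * (∫ y in U, H 1 1 y * φ y) := by
    rw [← hweak, ← hweak, ← hweak, ← hweak, ← integral_const_mul, ← integral_const_mul,
      ← integral_const_mul, ← integral_const_mul, ← integral_add, ← integral_add, ← integral_add]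
    · congr 1
      ext y
      rw [hpt]
      ring
    · exact (((hfi 0 0).const_mul _).add ((hfi 0 1).const_mul _)).add ((hfi 1 0).const_mul _)
    · exact (hfi 1 1).const_mul _
    · exact ((hfi 0 0).const_mul _).add ((hfi 0 1).const_mul _)
    · exact (hfi 1 0).const_mul _
    · exact (hfi 0 0).const_mul _
    · exact (hfi 0 1).const_mul _
  -- The cutoffs have values between `0` and `1` and live on the unit interval, so the area of the
  -- parallelogram is a bound uniformly in `ε`.
  have hφ2 : ∫ y in U, φ y ^ 2 ≤ |cr u v| := by
    have hsq : ∀ y, φ y ^ 2 = tensor x u v (fun r => A r ^ 2) (fun r => A r ^ 2) y := by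
      intro y; simp only [hφ, tensor]; ring
    rw [setIntegral_eq_integral_of_forall_compl_eq_zero
      (fun y hy => by rw [hφ0 y (fun hc => hy (hQU hc))]; simp)]
    simp only [hsq]
    rw [integral_tensor h]
    have hA2 : ∫ r, A r ^ 2 ≤ 1 := by
      have hz : ∀ r ∉ Set.Icc (0 : ℝ) 1, A r ^ 2 = 0 := by
        intro r hr
        rw [hA, cutoff_eq_zero hε hε4 (fun hc => hr ⟨by linarith [hc.1], by linarith [hc.2]⟩)]
        simp
      rw [← setIntegral_eq_integral_of_forall_compl_eq_zero hz]
      have : ∫ r in Set.Icc (0 : ℝ) 1, A r ^ 2 ≤ ∫ _ in Set.Icc (0 : ℝ) 1, (1 : ℝ) := by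
        refine setIntegral_mono_on ?_ ?_ measurableSet_Icc ?_
        · exact ((hAc.continuous.pow 2).continuousOn).integrableOn_Icc
        · exact continuousOn_const.integrableOn_Icc
        · intro r _
          have := cutoff_mem hε hε4 r
          exact pow_le_one₀ this.1 this.2
      simpa using this
    have hA0 : 0 ≤ ∫ r, A r ^ 2 := integral_nonneg fun r => sq_nonneg _
    have : (∫ r, A r ^ 2) * ∫ r, A r ^ 2 ≤ 1 := mul_le_one₀ hA2 hA0 hA2
    exact mul_le_of_le_one_right (abs_nonneg _) this
  have hHi : ∀ i j, Integrable (fun y => H i j y ^ 2) (volume.restrict U) := fun i j =>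
    (hf.memLp_hess i j).integrable_sq
  set W := Real.sqrt (∫ y in U, ∑ i, ∑ j, H i j y ^ 2) with hW
  have hHW : ∀ i j, Real.sqrt (∫ y in U, H i j y ^ 2) ≤ W := by
    intro i j
    refine Real.sqrt_le_sqrt (integral_mono (hHi i j) ?_ ?_)
    · exact integrable_finsetSum _ fun i _ => integrable_finsetSum _ fun j _ => hHi i j
    · intro y
      refine (Finset.single_le_sum (f := fun j => H i j y ^ 2) (fun j _ => sq_nonneg _)
        (Finset.mem_univ j)).trans ?_
      exact Finset.single_le_sum (f := fun i => ∑ j, H i j y ^ 2)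
        (fun i _ => Finset.sum_nonneg fun j _ => sq_nonneg _) (Finset.mem_univ i)
  have hW0 : 0 ≤ W := Real.sqrt_nonneg _
  have hone : ∀ i j, |∫ y in U, H i j y * φ y| ≤ W * Real.sqrt |cr u v| := by
    intro i j
    refine (abs_integral_mul_le (hf.memLp_hess i j)
      (hφc.continuous.memLp_of_hasCompactSupport hφcs)).trans ?_
    exact mul_le_mul (hHW i j) (Real.sqrt_le_sqrt hφ2) (Real.sqrt_nonneg _) hW0
  have hterm : ∀ i j, |u i * v j * ∫ y in U, H i j y * φ y| ≤
      ‖u‖ * ‖v‖ * (W * Real.sqrt |cr u v|) := by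
    intro i j
    rw [abs_mul, abs_mul]
    exact mul_le_mul (mul_le_mul (abs_apply_le_norm _ _) (abs_apply_le_norm _ _) (abs_nonneg _)
      (norm_nonneg _)) (hone i j) (abs_nonneg _) (by positivity)
  rw [hint]
  have a1 := abs_add_le (u 0 * v 0 * (∫ y in U, H 0 0 y * φ y) +
    u 0 * v 1 * (∫ y in U, H 0 1 y * φ y) + u 1 * v 0 * (∫ y in U, H 1 0 y * φ y))
    (u 1 * v 1 * (∫ y in U, H 1 1 y * φ y))
  have a2 := abs_add_three (u 0 * v 0 * (∫ y in U, H 0 0 y * φ y))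
    (u 0 * v 1 * (∫ y in U, H 0 1 y * φ y)) (u 1 * v 0 * (∫ y in U, H 1 0 y * φ y))
  have := hterm 0 0
  have := hterm 0 1
  have := hterm 1 0
  have := hterm 1 1
  linarith

/-- The mixed second difference of a continuous function over a parallelogram is bounded by its
weak second derivatives. -/
theorem abs_mixed_difference_le {U : Set Plane} {f : Plane → ℝ} {g : Fin 2 → Plane → ℝ}
    {H : Fin 2 → Fin 2 → Plane → ℝ} (hf : IsH2With U f g H) {x u v : Plane} (h : cr u v ≠ 0)
    (hU : ∀ s ∈ Set.Ioo (0 : ℝ) 1, ∀ t ∈ Set.Ioo (0 : ℝ) 1, x + s • u + t • v ∈ U)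
    (hc : ContinuousOn f ((fun p : ℝ × ℝ => x + p.1 • u + p.2 • v) ''
      (Set.Icc 0 1 ×ˢ Set.Icc 0 1))) :
    |f x - f (x + u) - f (x + v) + f (x + u + v)| ≤
      4 * (‖u‖ * ‖v‖) / Real.sqrt |cr u v| *
        Real.sqrt (∫ y in U, ∑ i, ∑ j, H i j y ^ 2) := by
  set D := |cr u v| with hD
  have hD0 : 0 < D := abs_pos.2 h
  set W := Real.sqrt (∫ y in U, ∑ i, ∑ j, H i j y ^ 2) with hW
  set F : ℝ × ℝ → ℝ := fun p => f (x + p.1 • u + p.2 • v) with hF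
  have hFc : ContinuousOn F (Set.Icc 0 1 ×ˢ Set.Icc 0 1) :=
    hc.comp (by fun_prop) (Set.mapsTo_image _ _)
  have hFu := (isCompact_Icc.prod isCompact_Icc).uniformContinuousOn_of_continuous hFc
  rw [Metric.uniformContinuousOn_iff] at hFu
  -- The four corner averages differ from the corner values by at most `η`. The bumps reach up to `2
  -- * ε` into the parallelogram, whence the choice of `ε` as at most a quarter of the modulus `δ`
  -- of uniform continuity.
  have hkey : ∀ η : ℝ, 0 < η → D * |f x - f (x + u) - f (x + v) + f (x + u + v)| ≤
      4 * (‖u‖ * ‖v‖) * Real.sqrt D * W + 4 * (η * D) := by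
    intro η hη
    obtain ⟨δ, hδ, hδF⟩ := hFu η hη
    set ε := min (1 / 4) (δ / 4) with hε
    have hε0 : 0 < ε := by positivity
    have hε4 : ε ≤ 1 / 4 := min_le_left _ _
    have hεδ : ε ≤ δ / 4 := min_le_right _ _
    have hcor : ∀ a b p q : ℝ, ε ≤ a → a + ε ≤ 1 - ε → ε ≤ b → b + ε ≤ 1 - ε →
        p ∈ Set.Icc (0 : ℝ) 1 → q ∈ Set.Icc (0 : ℝ) 1 →
        p - 2 * ε ≤ a → a + ε ≤ p + 2 * ε → q - 2 * ε ≤ b → b + ε ≤ q + 2 * ε →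
        ∀ s ∈ Set.Icc a (a + ε), ∀ t ∈ Set.Icc b (b + ε),
        x + s • u + t • v ∈ U ∧ |f (x + s • u + t • v) - F (p, q)| ≤ η := by
      intro a b p q ha ha' hb hb' hp hq h1 h2 h3 h4 s hs t ht
      have hs1 := hs.1
      have hs2 := hs.2
      have ht1 := ht.1
      have ht2 := ht.2
      refine ⟨hU s ⟨by linarith, by linarith⟩ t ⟨by linarith, by linarith⟩, ?_⟩
      have := hδF (s, t) ⟨⟨by linarith, by linarith⟩, ⟨by linarith, by linarith⟩⟩ (p, q) ⟨hp, hq⟩ ?_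
      · rw [Real.dist_eq] at this
        exact this.le
      · rw [Prod.dist_eq, max_lt_iff, Real.dist_eq, Real.dist_eq, abs_lt, abs_lt]
        exact ⟨⟨by simp only []; linarith, by simp only []; linarith⟩,
          ⟨by simp only []; linarith, by simp only []; linarith⟩⟩
    have m0 : (0 : ℝ) ∈ Set.Icc (0 : ℝ) 1 := ⟨le_rfl, zero_le_one⟩
    have m1 : (1 : ℝ) ∈ Set.Icc (0 : ℝ) 1 := ⟨zero_le_one, le_rfl⟩
    obtain ⟨i00, c00⟩ := corner_average (c := F (0, 0)) h hf.memLp hε0 (hcor ε ε 0 0 le_rfl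
      (by linarith) le_rfl (by linarith) m0 m0 (by linarith) (by linarith) (by linarith)
      (by linarith))
    obtain ⟨i10, c10⟩ := corner_average (c := F (1, 0)) h hf.memLp hε0 (hcor (1 - 2 * ε) ε 1 0
      (by linarith) (by linarith) le_rfl (by linarith) m1 m0 (by linarith) (by linarith)
      (by linarith) (by linarith))
    obtain ⟨i01, c01⟩ := corner_average (c := F (0, 1)) h hf.memLp hε0 (hcor ε (1 - 2 * ε) 0 1
      le_rfl (by linarith) (by linarith) (by linarith) m0 m1 (by linarith) (by linarith)
      (by linarith) (by linarith))
    obtain ⟨i11, c11⟩ := corner_average (c := F (1, 1)) h hf.memLp hε0 (hcor (1 - 2 * ε)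
      (1 - 2 * ε) 1 1 (by linarith) (by linarith) (by linarith) (by linarith) m1 m1 (by linarith)
      (by linarith) (by linarith) (by linarith))
    have hmix := abs_integral_mixed_le hf h hU hε0 hε4
    have e : ∫ y in U, f y * tensor x u v (deriv (cutoff ε)) (deriv (cutoff ε)) y =
        (∫ y in U, f y * tensor x u v (fun r => deriv (smoothStep ε) (r - ε))
          (fun r => deriv (smoothStep ε) (r - ε)) y) -
        (∫ y in U, f y * tensor x u v (fun r => deriv (smoothStep ε) (r - (1 - 2 * ε)))
          (fun r => deriv (smoothStep ε) (r - ε)) y) -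
        (∫ y in U, f y * tensor x u v (fun r => deriv (smoothStep ε) (r - ε))
          (fun r => deriv (smoothStep ε) (r - (1 - 2 * ε))) y) +
        (∫ y in U, f y * tensor x u v (fun r => deriv (smoothStep ε) (r - (1 - 2 * ε)))
          (fun r => deriv (smoothStep ε) (r - (1 - 2 * ε))) y) := by
      rw [← integral_sub i00 i10, ← integral_sub (by exact i00.sub i10) i01,
        ← integral_add (by exact (i00.sub i10).sub i01) i11]
      congr 1
      ext y
      simp only [tensor, deriv_cutoff]
      ring
    rw [e] at hmix
    have f00 : F (0, 0) = f x := by simp [hF]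
    have f10 : F (1, 0) = f (x + u) := by simp [hF]
    have f01 : F (0, 1) = f (x + v) := by simp [hF]
    have f11 : F (1, 1) = f (x + u + v) := by simp [hF]
    rw [f00] at c00
    rw [f10] at c10
    rw [f01] at c01
    rw [f11] at c11
    rw [← hD] at c00 c10 c01 c11 hmix
    rw [← hW] at hmix
    rw [← abs_of_pos hD0, ← abs_mul, abs_of_pos hD0]
    rw [abs_le] at c00 c10 c01 c11 hmix ⊢
    constructor <;> linarith [c00.1, c00.2, c10.1, c10.2, c01.1, c01.2, c11.1, c11.2, hmix.1,
      hmix.2]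
  have hlim : D * |f x - f (x + u) - f (x + v) + f (x + u + v)| ≤
      4 * (‖u‖ * ‖v‖) * Real.sqrt D * W := by
    refine le_of_forall_pos_le_add fun η hη => ?_
    have := hkey (η / (4 * D)) (by positivity)
    have e : 4 * (η / (4 * D) * D) = η := by field_simp
    rwa [e] at this
  have hs : Real.sqrt D * Real.sqrt D = D := Real.mul_self_sqrt hD0.le
  have hs0 : 0 < Real.sqrt D := Real.sqrt_pos.2 hD0
  rw [div_mul_eq_mul_div, le_div_iff₀ hs0]
  have : (|f x - f (x + u) - f (x + v) + f (x + u + v)| * Real.sqrt D) * Real.sqrt D ≤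
      (4 * (‖u‖ * ‖v‖) * W) * Real.sqrt D := by
    rw [mul_assoc, hs]
    linarith
  exact le_of_mul_le_mul_right this hs0

end Plate

namespace Plate

/-! ### Approximation by affine functions -/

theorem isOpen_parallelogram {u v : Plane} (h : cr u v ≠ 0) (x : Plane) :
    IsOpen {y | ∃ s ∈ Set.Ioo (0 : ℝ) 1, ∃ t ∈ Set.Ioo (0 : ℝ) 1, y = x + s • u + t • v} := by
  have e : {y | ∃ s ∈ Set.Ioo (0 : ℝ) 1, ∃ t ∈ Set.Ioo (0 : ℝ) 1, y = x + s • u + t • v} =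
      (fun y => coordS u v (y - x)) ⁻¹' Set.Ioo 0 1 ∩
        (fun y => coordT u v (y - x)) ⁻¹' Set.Ioo 0 1 := by
    ext y
    constructor
    · rintro ⟨s, hs, t, ht, rfl⟩
      refine ⟨?_, ?_⟩
      · rw [Set.mem_preimage]
        rwa [coordS_combo h]
      · rw [Set.mem_preimage]
        rwa [coordT_combo h]
    · rintro ⟨h1, h2⟩
      exact ⟨_, h1, _, h2, coord_eq h x y⟩
  rw [e]
  exact (isOpen_Ioo.preimage (by fun_prop)).inter (isOpen_Ioo.preimage (by fun_prop))

/-- A continuous function on `Ω` whose mixed second differences on parallelograms are bounded as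
those of a function with `L²` norm `W` of the Hessian. -/
structure HasMixedBound (Ω : Set Plane) (W : ℝ) (f : Plane → ℝ) : Prop where
  continuousOn : ContinuousOn f Ω
  mixed : ∀ x u v : Plane, cr u v ≠ 0 →
    (∀ s ∈ Set.Icc (0 : ℝ) 1, ∀ t ∈ Set.Icc (0 : ℝ) 1, x + s • u + t • v ∈ Ω) →
    |f x - f (x + u) - f (x + v) + f (x + u + v)| ≤
      4 * (‖u‖ * ‖v‖) / Real.sqrt |cr u v| * W

/-- The open parallelogram is automatically in the interior of `Ω`, so the closed one may touch the
boundary; there only continuity is used. -/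
theorem IsH2With.hasMixedBound {Ω : Set Plane} {f : Plane → ℝ} {g : Fin 2 → Plane → ℝ}
    {H : Fin 2 → Fin 2 → Plane → ℝ} (hf : IsH2With (interior Ω) f g H) (hc : ContinuousOn f Ω) :
    HasMixedBound Ω (Real.sqrt (∫ y in interior Ω, ∑ i, ∑ j, H i j y ^ 2)) f := by
  refine ⟨hc, fun x u v h hΩ => abs_mixed_difference_le hf h (fun s hs t ht => ?_) (hc.mono ?_)⟩
  · refine interior_maximal ?_ (isOpen_parallelogram h x) ⟨s, hs, t, ht, rfl⟩
    rintro _ ⟨s, hs, t, ht, rfl⟩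
    exact hΩ s (Set.Ioo_subset_Icc_self hs) t (Set.Ioo_subset_Icc_self ht)
  · rintro _ ⟨⟨s, t⟩, ⟨hs, ht⟩, rfl⟩
    exact hΩ s hs t ht

theorem HasMixedBound.mono {Ω : Set Plane} {W W' : ℝ} {f : Plane → ℝ} (hf : HasMixedBound Ω W f)
    (h : W ≤ W') : HasMixedBound Ω W' f :=
  ⟨hf.continuousOn, fun x u v huv hΩ => (hf.mixed x u v huv hΩ).trans
    (mul_le_mul_of_nonneg_left h (by positivity))⟩

theorem affine_mixed_difference (p : Plane →ᵃ[ℝ] ℝ) (x u v : Plane) :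
    p x - p (x + u) - p (x + v) + p (x + u + v) = 0 := by
  have h : ∀ x u, p (x + u) = p.linear u + p x := fun x u => by
    rw [add_comm x u]
    exact p.map_vadd x u
  rw [h (x + u) v, h x u, h x v]
  ring

theorem HasMixedBound.sub_affine {Ω : Set Plane} {W : ℝ} {f : Plane → ℝ}
    (hf : HasMixedBound Ω W f) (p : Plane →ᵃ[ℝ] ℝ) : HasMixedBound Ω W (fun x => f x - p x) := by
  refine ⟨hf.continuousOn.sub (p.continuous_of_finiteDimensional.continuousOn),
    fun x u v huv hΩ => ?_⟩
  have e : f x - p x - (f (x + u) - p (x + u)) - (f (x + v) - p (x + v)) +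
      (f (x + u + v) - p (x + u + v)) = f x - f (x + u) - f (x + v) + f (x + u + v) := by
    linarith [affine_mixed_difference p x u v]
  rw [e]
  exact hf.mixed x u v huv hΩ

/-- The mixed differences on a scaled parallelogram. -/
theorem HasMixedBound.mixed_scaled {Ω : Set Plane} {W : ℝ} {f : Plane → ℝ}
    (hf : HasMixedBound Ω W f) (hW : 0 ≤ W) {x u v : Plane} {D ε s t : ℝ} (huv : cr u v ≠ 0)
    (hu : ‖u‖ ≤ D) (hv : ‖v‖ ≤ D) (hε : 4 * D ^ 2 / Real.sqrt |cr u v| * W ≤ ε)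
    (hs : s ∈ Set.Icc (0 : ℝ) 1) (ht : t ∈ Set.Icc (0 : ℝ) 1)
    (hΩ : ∀ p ∈ Set.Icc (0 : ℝ) 1, ∀ q ∈ Set.Icc (0 : ℝ) 1,
      x + (p * s) • u + (q * t) • v ∈ Ω) :
    |f x - f (x + s • u) - f (x + t • v) + f (x + s • u + t • v)| ≤ ε := by
  have hD : 0 ≤ D := (norm_nonneg u).trans hu
  have hε0 : 0 ≤ ε := le_trans (by positivity) hε
  rcases hs.1.eq_or_lt with hs0 | hs0
  · rw [← hs0]; simpa using hε0
  rcases ht.1.eq_or_lt with ht0 | ht0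
  · rw [← ht0]; simpa using hε0
  have hcr : cr (s • u) (t • v) = s * t * cr u v := by
    simp only [cr, PiLp.smul_apply, smul_eq_mul]; ring
  have h := hf.mixed x (s • u) (t • v) (by rw [hcr]; positivity) (fun p hp q hq => by
    rw [smul_smul, smul_smul]; exact hΩ p hp q hq)
  refine h.trans (le_trans ?_ hε)
  refine mul_le_mul_of_nonneg_right ?_ hW
  have hst : 0 < s * t := mul_pos hs0 ht0
  rw [hcr, abs_mul, abs_of_pos hst, Real.sqrt_mul hst.le, norm_smul, norm_smul, Real.norm_eq_abs,
    Real.norm_eq_abs, abs_of_pos hs0, abs_of_pos ht0]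
  have hc0 : 0 < Real.sqrt |cr u v| := Real.sqrt_pos.2 (abs_pos.2 huv)
  have hr0 : 0 < Real.sqrt (s * t) := Real.sqrt_pos.2 hst
  have hst1 : s * t ≤ 1 := mul_le_one₀ hs.2 ht0.le ht.2
  -- Scaling by `s` and `t` multiplies the bound by `√(s t) ≤ 1`, so the unscaled bound serves all
  -- smaller parallelograms.
  have hr : s * t ≤ Real.sqrt (s * t) := by
    rw [Real.le_sqrt hst.le hst.le]
    nlinarith
  have huvD : ‖u‖ * ‖v‖ ≤ D ^ 2 := by
    rw [sq]; exact mul_le_mul hu hv (norm_nonneg _) hD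
  rw [div_le_div_iff₀ (by positivity) hc0]
  have : s * t * (‖u‖ * ‖v‖) ≤ Real.sqrt (s * t) * D ^ 2 :=
    mul_le_mul hr huvD (by positivity) hr0.le
  nlinarith

/-- A second difference along a side of a triangle. -/
theorem HasMixedBound.second_difference {Ω : Set Plane} {W : ℝ} {f : Plane → ℝ}
    (hf : HasMixedBound Ω W f) (hW : 0 ≤ W) {x u v : Plane} {D ε r : ℝ} (huv : cr u v ≠ 0)
    (hu : ‖u‖ ≤ D) (hv : ‖v‖ ≤ D) (hvu : ‖v - u‖ ≤ D)
    (hε : 4 * D ^ 2 / Real.sqrt |cr u v| * W ≤ ε) (hr : r ∈ Set.Icc (0 : ℝ) 1)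
    (hΩ : ∀ s t : ℝ, 0 ≤ s → 0 ≤ t → s + t ≤ 2 * r → x + s • u + t • v ∈ Ω) :
    |f x + f (x + (2 * r) • u) - 2 * f (x + r • u)| ≤ 2 * ε := by
  have h1 := hf.mixed_scaled hW huv hu hv hε hr hr (x := x) (fun p hp q hq =>
    hΩ _ _ (mul_nonneg hp.1 hr.1) (mul_nonneg hq.1 hr.1) (by nlinarith [hp.2, hq.2, hr.1]))
  have hcr : cr u (v - u) = cr u v := by
    simp only [cr, PiLp.sub_apply]; ring
  -- The second parallelogram shares the corners `x + r v` and `x + r u + r v` with the first one.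
  -- In the difference of the two mixed differences these cancel, and the second difference along
  -- `u` remains.
  have h2 := hf.mixed_scaled hW (v := v - u) (ε := ε) (by rwa [hcr]) hu hvu (by rwa [hcr]) hr hr
    (x := x + r • u) (fun p hp q hq => by
      have e : x + r • u + (p * r) • u + (q * r) • (v - u) =
          x + (r + p * r - q * r) • u + (q * r) • v := by module
      rw [e]
      exact hΩ _ _ (by nlinarith [hp.1, hq.2, hr.1, mul_nonneg hp.1 hr.1])
        (mul_nonneg hq.1 hr.1) (by nlinarith [hp.2, hr.1]))
  have e1 : x + r • u + r • u = x + (2 * r) • u := by module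
  have e2 : x + r • u + r • (v - u) = x + r • v := by module
  have e3 : x + (2 * r) • u + r • (v - u) = x + r • u + r • v := by module
  rw [e1, e2, e3] at h2
  rw [abs_le] at h1 h2 ⊢
  constructor <;> linarith [h1.1, h1.2, h2.1, h2.2]

/-- A continuous function with bounded second differences that vanishes at the end points. -/
theorem le_of_second_difference {a : ℝ → ℝ} {η : ℝ} (hc : ContinuousOn a (Set.Icc 0 1))
    (h0 : a 0 = 0) (h1 : a 1 = 0)
    (h : ∀ s r : ℝ, 0 ≤ s → 0 ≤ r → s + 2 * r ≤ 1 → -η ≤ a s + a (s + 2 * r) - 2 * a (s + r)) :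
    ∀ s ∈ Set.Icc (0 : ℝ) 1, a s ≤ η := by
  obtain ⟨m, hm, hmax⟩ := isCompact_Icc.exists_isMaxOn (Set.nonempty_Icc.2 zero_le_one) hc
  intro s hs
  refine (hmax hs).trans ?_
  -- Reflect the nearer end point at the maximum point `m`: the image is still in the interval and
  -- its value does not exceed the maximum.
  rcases le_total m (1 / 2) with hm2 | hm2
  · have h2 := h 0 m le_rfl hm.1 (by linarith)
    rw [zero_add, zero_add, h0] at h2
    have : a (2 * m) ≤ a m := hmax ⟨by linarith [hm.1], by linarith⟩
    linarith
  · have h2 := h (2 * m - 1) (1 - m) (by linarith) (by linarith [hm.2]) (by linarith)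
    rw [show 2 * m - 1 + 2 * (1 - m) = 1 by ring, show 2 * m - 1 + (1 - m) = m by ring, h1] at h2
    have : a (2 * m - 1) ≤ a m := hmax ⟨by linarith, by linarith [hm.2]⟩
    linarith

/-- Second differences along the side are bounded, and `le_of_second_difference` applies to the
function and to its negative. -/
theorem HasMixedBound.abs_le_on_side {Ω : Set Plane} {W : ℝ} {f : Plane → ℝ}
    (hf : HasMixedBound Ω W f) (hW : 0 ≤ W) {x u v : Plane} {D ε : ℝ} (huv : cr u v ≠ 0)
    (hu : ‖u‖ ≤ D) (hv : ‖v‖ ≤ D) (hvu : ‖v - u‖ ≤ D)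
    (hε : 4 * D ^ 2 / Real.sqrt |cr u v| * W ≤ ε)
    (hΩ : ∀ s t : ℝ, 0 ≤ s → 0 ≤ t → s + t ≤ 1 → x + s • u + t • v ∈ Ω)
    (h0 : f x = 0) (h1 : f (x + u) = 0) :
    ∀ s ∈ Set.Icc (0 : ℝ) 1, |f (x + s • u)| ≤ 2 * ε := by
  have hc : ContinuousOn (fun s : ℝ => f (x + s • u)) (Set.Icc 0 1) :=
    hf.continuousOn.comp (by fun_prop) fun s hs => by
      have := hΩ s 0 hs.1 le_rfl (by linarith [hs.2])
      rwa [zero_smul, add_zero] at this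
  have hd : ∀ s r : ℝ, 0 ≤ s → 0 ≤ r → s + 2 * r ≤ 1 →
      |f (x + s • u) + f (x + (s + 2 * r) • u) - 2 * f (x + (s + r) • u)| ≤ 2 * ε := by
    intro s r hs hr hsr
    have := hf.second_difference hW (x := x + s • u) huv hu hv hvu hε ⟨hr, by linarith⟩
      (fun p q hp hq hpq => by
        have e : x + s • u + p • u + q • v = x + (s + p) • u + q • v := by module
        rw [e]
        exact hΩ _ _ (by linarith) hq (by linarith))
    rwa [add_assoc, ← add_smul, add_assoc, ← add_smul] at this
  intro s hs
  rw [abs_le]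
  constructor
  · have := le_of_second_difference (η := 2 * ε) hc.neg (by simpa using h0) (by simpa using h1)
      (fun s r hs hr hsr => ?_) s hs
    · simp only [Pi.neg_apply] at this
      linarith
    · have := (abs_le.1 (hd s r hs hr hsr)).2
      simp only [Pi.neg_apply]
      linarith
  · exact le_of_second_difference hc (by simpa using h0) (by simpa using h1)
      (fun s r hs hr hsr => (abs_le.1 (hd s r hs hr hsr)).1) s hs

/-- A function that vanishes at the vertices of a triangle. -/
theorem HasMixedBound.abs_le_on_triangle {Ω : Set Plane} {W : ℝ} {f : Plane → ℝ}
    (hf : HasMixedBound Ω W f) (hW : 0 ≤ W) {x u v : Plane} {D ε : ℝ} (huv : cr u v ≠ 0)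
    (hu : ‖u‖ ≤ D) (hv : ‖v‖ ≤ D) (hvu : ‖v - u‖ ≤ D)
    (hε : 4 * D ^ 2 / Real.sqrt |cr u v| * W ≤ ε)
    (hΩ : ∀ s t : ℝ, 0 ≤ s → 0 ≤ t → s + t ≤ 1 → x + s • u + t • v ∈ Ω)
    (h0 : f x = 0) (h1 : f (x + u) = 0) (h2 : f (x + v) = 0) {s t : ℝ} (hs : 0 ≤ s) (ht : 0 ≤ t)
    (hst : s + t ≤ 1) : |f (x + s • u + t • v)| ≤ 5 * ε := by
  have a1 := hf.abs_le_on_side hW huv hu hv hvu hε hΩ h0 h1 s ⟨hs, by linarith⟩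
  have hcr : cr v u = -cr u v := by simp only [cr]; ring
  have a2 := hf.abs_le_on_side hW (x := x) (u := v) (v := u) (ε := ε)
    (by rw [hcr]; exact neg_ne_zero.2 huv)
    hv hu (by rwa [norm_sub_rev]) (by rwa [hcr, abs_neg])
    (fun s t hs ht hst => by rw [add_right_comm]; exact hΩ t s ht hs (by linarith)) h0 h2 t
    ⟨ht, by linarith⟩
  -- A mixed difference with one corner at `x` reduces an inner point to two points on sides: `2 + 2
  -- + 1 = 5`.
  have a3 := hf.mixed_scaled hW huv hu hv hε ⟨hs, by linarith⟩ ⟨ht, by linarith⟩ (x := x)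
    (fun p hp q hq => hΩ _ _ (mul_nonneg hp.1 hs) (mul_nonneg hq.1 ht)
      (by nlinarith [hp.2, hq.2]))
  rw [abs_le] at a1 a2 a3 ⊢
  constructor <;> linarith [a1.1, a1.2, a2.1, a2.2, a3.1, a3.2]

end Plate

namespace Plate

/-! ### Affine interpolation and the passage across an edge -/

theorem affine_triangle {V : Type*} [AddCommGroup V] [Module ℝ V] (p : Plane →ᵃ[ℝ] V)
    (a b c : Plane) (s t : ℝ) :
    p (a + s • (b - a) + t • (c - a)) = p a + s • (p b - p a) + t • (p c - p a) := by
  have h : ∀ x w, p (x + w) = p x + p.linear w := fun x w => by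
    rw [add_comm x w, add_comm (p x)]
    exact p.map_vadd x w
  have h' : ∀ x y, p.linear (y - x) = p y - p x := fun x y => p.linearMap_vsub y x
  rw [h, h, map_smul, map_smul, h', h']

theorem exists_affine {V : Type*} [AddCommGroup V] [Module ℝ V] {a b c : Plane}
    (h : cr (b - a) (c - a) ≠ 0) (A B C : V) :
    ∃ p : Plane →ᵃ[ℝ] V, p a = A ∧ p b = B ∧ p c = C := by
  let L : Plane →ₗ[ℝ] V := (coordS (b - a) (c - a)).toLinearMap.smulRight (B - A) +
    (coordT (b - a) (c - a)).toLinearMap.smulRight (C - A)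
  let p : Plane →ᵃ[ℝ] V :=
    { toFun := fun x => L (x - a) + A
      linear := L
      map_vadd' := fun x w => by
        simp only [vadd_eq_add]
        rw [add_sub_assoc, map_add, add_assoc] }
  have hp : ∀ x, p x = coordS (b - a) (c - a) (x - a) • (B - A) +
      coordT (b - a) (c - a) (x - a) • (C - A) + A := fun x => rfl
  have h1 : coordS (b - a) (c - a) (b - a) = 1 := by rw [coordS_apply, div_self h]
  have h2 : coordT (b - a) (c - a) (b - a) = 0 := by
    rw [coordT_apply, show cr (b - a) (b - a) = 0 by simp only [cr]; ring, zero_div]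
  have h3 : coordS (b - a) (c - a) (c - a) = 0 := by
    rw [coordS_apply, show cr (c - a) (c - a) = 0 by simp only [cr]; ring, zero_div]
  have h4 : coordT (b - a) (c - a) (c - a) = 1 := by rw [coordT_apply, div_self h]
  refine ⟨p, ?_, ?_, ?_⟩
  · rw [hp, sub_self, map_zero, map_zero]; module
  · rw [hp, h1, h2]; module
  · rw [hp, h3, h4]; module

theorem affine_ext {V : Type*} [AddCommGroup V] [Module ℝ V] {a b c : Plane}
    (h : cr (b - a) (c - a) ≠ 0) {p q : Plane →ᵃ[ℝ] V} (ha : p a = q a) (hb : p b = q b)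
    (hc : p c = q c) : p = q := by
  ext x
  have e := coord_eq h a x
  rw [e, affine_triangle, affine_triangle, ha, hb, hc]

/-- A bound on a triangle in terms of the values at the vertices. -/
theorem abs_affine_le {A B C M s t : ℝ} (hA : |A| ≤ M) (hB : |B| ≤ M) (hC : |C| ≤ M) (hs : 0 ≤ s)
    (ht : 0 ≤ t) (hst : s + t ≤ 1) : |A + s * (B - A) + t * (C - A)| ≤ M := by
  rw [abs_le] at hA hB hC ⊢
  constructor <;> nlinarith [mul_nonneg hs (sub_nonneg.2 hB.2), mul_nonneg ht (sub_nonneg.2 hC.2),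
    mul_nonneg (sub_nonneg.2 hst) (sub_nonneg.2 hA.2), mul_nonneg hs (sub_nonneg.2 hB.1),
    mul_nonneg ht (sub_nonneg.2 hC.1), mul_nonneg (sub_nonneg.2 hst) (sub_nonneg.2 hA.1)]

/-- A function is close to its interpolant on a triangle. -/
theorem HasMixedBound.sub_interpolant {Ω : Set Plane} {W : ℝ} {f : Plane → ℝ}
    (hf : HasMixedBound Ω W f) (hW : 0 ≤ W) {a b c : Plane} {D A ε : ℝ} (hA : 0 < A)
    (hc : A ≤ |cr (b - a) (c - a)|) (h1 : ‖b - a‖ ≤ D) (h2 : ‖c - a‖ ≤ D) (h3 : ‖c - b‖ ≤ D)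
    (hε : 4 * D ^ 2 / Real.sqrt A * W ≤ ε)
    (hΩ : convexHull ℝ ((({a, b, c} : Finset Plane)) : Set Plane) ⊆ Ω)
    {p : Plane →ᵃ[ℝ] ℝ} (hpa : p a = f a) (hpb : p b = f b) (hpc : p c = f c) :
    ∀ x ∈ convexHull ℝ ((({a, b, c} : Finset Plane)) : Set Plane), |f x - p x| ≤ 5 * ε := by
  intro x hx
  obtain ⟨s, t, hs, ht, hst, rfl⟩ := mem_hull_triple.1 hx
  refine (hf.sub_affine p).abs_le_on_triangle hW (abs_pos.1 (hA.trans_le hc)) h1 h2 (by simpa) ?_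
    (fun s t hs ht hst => hΩ (mem_hull_triple.2 ⟨s, t, hs, ht, hst, rfl⟩)) ?_ ?_ ?_ hs ht hst
  · refine le_trans (mul_le_mul_of_nonneg_right ?_ hW) hε
    exact div_le_div_of_nonneg_left (by positivity) (Real.sqrt_pos.2 hA) (Real.sqrt_le_sqrt hc)
  · simp [hpa]
  · simp [hpb]
  · simp [hpc]

/-- Coordinates of one vertex with respect to an edge and the vertex on the other side. -/
theorem exists_crossing {e p q : Plane} {A B : ℝ} (hA : 0 < A) (hB1 : 1 ≤ B)
    (hc : A ≤ |cr e p|) (hd : A ≤ |cr e q|) (hcd : cr e p * cr e q < 0)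
    (hep : |cr e p| ≤ B * A) (heq : |cr e q| ≤ B * A) (hpq : |cr p q| ≤ B * A) :
    ∃ t γ ζ : ℝ, 0 < t ∧ t ≤ 1 / 4 ∧ t * B = 1 / 4 ∧ 0 < γ ∧ 1 ≤ γ * B ∧ t * γ ≤ 1 / 4 ∧
      |t * ζ| ≤ 1 / 4 ∧ p = ζ • e - γ • q := by
  have hB0 : 0 < B := by linarith
  have hq0 : cr e q ≠ 0 := abs_pos.1 (hA.trans_le hd)
  have hq0' : 0 < |cr e q| := abs_pos.2 hq0
  obtain ⟨γ, hγ⟩ : ∃ γ, γ = -(cr e p / cr e q) := ⟨_, rfl⟩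
  obtain ⟨ζ, hζ⟩ : ∃ ζ, ζ = cr p q / cr e q := ⟨_, rfl⟩
  have hp : p = ζ • e - γ • q := by
    rw [hγ, hζ, neg_smul, sub_neg_eq_add]
    exact eq_combo hq0 p
  have hγ0 : 0 < γ := by
    rw [hγ, neg_pos]
    rcases mul_neg_iff.1 hcd with ⟨x, y⟩ | ⟨x, y⟩
    · exact div_neg_of_pos_of_neg x y
    · exact div_neg_of_neg_of_pos x y
  have hγabs : γ * |cr e q| = |cr e p| := by
    rw [← abs_of_pos hγ0, hγ, abs_neg, abs_div, div_mul_cancel₀ _ hq0'.ne']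
  have hγB : γ ≤ B := by
    have := hep
    rw [← hγabs] at this
    by_contra hlt
    rw [not_le] at hlt
    nlinarith [mul_le_mul_of_nonneg_left hd hγ0.le]
  have hγB' : 1 ≤ γ * B := by
    have h7 : A ≤ γ * |cr e q| := by rw [hγabs]; exact hc
    have h8 : A ≤ γ * (B * A) := h7.trans (mul_le_mul_of_nonneg_left heq hγ0.le)
    by_contra hlt
    rw [not_le] at hlt
    nlinarith
  have hζB : |ζ| ≤ B := by
    rw [hζ, abs_div, div_le_iff₀ hq0']
    exact hpq.trans (mul_le_mul_of_nonneg_left hd hB0.le)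
  rw [abs_le] at hζB
  -- With this `t` the points at `± t p` from the midpoint of the edge stay well inside the two
  -- triangles.
  obtain ⟨t, ht⟩ : ∃ t, t = 1 / (4 * B) := ⟨_, rfl⟩
  have ht0 : 0 < t := by rw [ht]; positivity
  have htB : t * B = 1 / 4 := by rw [ht]; field_simp
  have ht1 : t ≤ 1 / 4 := by nlinarith
  have htγ : t * γ ≤ 1 / 4 := by nlinarith
  have htζ : |t * ζ| ≤ 1 / 4 := by
    rw [abs_le]; constructor <;> nlinarith [hζB.1, hζB.2,
      mul_le_mul_of_nonneg_left hζB.1 ht0.le, mul_le_mul_of_nonneg_left hζB.2 ht0.le]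
  exact ⟨t, γ, ζ, ht0, ht1, htB, hγ0, hγB', htγ, htζ, hp⟩

/-- A second difference across an edge. -/
theorem HasMixedBound.second_difference_across {Ω : Set Plane} {W : ℝ} {f : Plane → ℝ}
    (hf : HasMixedBound Ω W f) (hW : 0 ≤ W) {m e p : Plane} {A B D ε t : ℝ} (hA : 0 < A)
    (hc : A ≤ |cr e p|) (he : ‖e‖ ≤ D) (np : ‖p‖ ≤ D) (hε : 4 * D ^ 2 / Real.sqrt A * W ≤ ε)
    (ht0 : 0 < t) (ht1 : t ≤ 1 / 4) (htB : t * B = 1 / 4)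
    (hΩ : ∀ k r : ℝ, 0 ≤ r → |k| + r ≤ 1 → m + (k * t) • p - (r / 2) • e ∈ Ω) :
    |f (m + t • p) + f (m - t • p) - 2 * f m| ≤ 32 * B * ε := by
  have hD : 0 ≤ D := (norm_nonneg _).trans he
  have hε0 : 0 ≤ ε := le_trans (by positivity) hε
  have hB0 : 0 < B := by
    by_contra hlt
    nlinarith [mul_nonneg ht0.le (neg_nonneg.2 (not_lt.1 hlt))]
  have ht : B = 1 / (4 * t) := by field_simp; linarith
  -- The auxiliary triangle has the vertices `m + t p`, `m - t p` and `m - e / 2`, which is an end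
  -- point of the edge. The factor `16 * B` accounts for the doubled diameter bound and for `1 / t =
  -- 4 * B`.
  have hsd := hf.second_difference hW (x := m + t • p) (u := -(2 * t) • p)
    (v := -((2 : ℝ)⁻¹ • e) - t • p) (D := 2 * D) (ε := 16 * B * ε) (r := 1 / 2) ?_ ?_ ?_ ?_ ?_
    ⟨by norm_num, by norm_num⟩ ?_
  · have e1 : m + t • p + (2 * (1 / 2 : ℝ)) • (-(2 * t) • p) = m - t • p := by module
    have e2 : m + t • p + (1 / 2 : ℝ) • (-(2 * t) • p) = m := by module
    rw [e1, e2] at hsd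
    rw [show 32 * B * ε = 2 * (16 * B * ε) by ring]
    exact hsd
  · have : cr (-(2 * t) • p) (-((2 : ℝ)⁻¹ • e) - t • p) = -t * cr e p := by
      simp only [cr, PiLp.sub_apply, PiLp.neg_apply, PiLp.smul_apply, smul_eq_mul]; ring
    rw [this]
    exact mul_ne_zero (neg_ne_zero.2 ht0.ne') (abs_pos.1 (hA.trans_le hc))
  · rw [norm_smul, norm_neg, Real.norm_of_nonneg (by positivity)]
    nlinarith
  · refine (norm_sub_le _ _).trans ?_
    rw [norm_neg, norm_smul, norm_smul, Real.norm_of_nonneg (by norm_num),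
      Real.norm_of_nonneg ht0.le]
    nlinarith
  · have : -((2 : ℝ)⁻¹ • e) - t • p - -(2 * t) • p = t • p - (2 : ℝ)⁻¹ • e := by module
    rw [this]
    refine (norm_sub_le _ _).trans ?_
    rw [norm_smul, norm_smul, Real.norm_of_nonneg ht0.le,
      Real.norm_of_nonneg (by norm_num : (0 : ℝ) ≤ 2⁻¹)]
    nlinarith
  · have hcr : cr (-(2 * t) • p) (-((2 : ℝ)⁻¹ • e) - t • p) = -(t * cr e p) := by
      simp only [cr, PiLp.sub_apply, PiLp.neg_apply, PiLp.smul_apply, smul_eq_mul]; ring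
    rw [hcr, abs_neg, abs_mul, abs_of_pos ht0, Real.sqrt_mul ht0.le]
    have s1 : t ≤ Real.sqrt t := by rw [Real.le_sqrt ht0.le ht0.le]; nlinarith
    have s2 : Real.sqrt A ≤ Real.sqrt |cr e p| := Real.sqrt_le_sqrt hc
    have s0 : 0 < Real.sqrt A := Real.sqrt_pos.2 hA
    have s3 : t * Real.sqrt A ≤ Real.sqrt t * Real.sqrt |cr e p| :=
      mul_le_mul s1 s2 s0.le (Real.sqrt_nonneg _)
    have s4 : 4 * (2 * D) ^ 2 / (Real.sqrt t * Real.sqrt |cr e p|) ≤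
        4 * (2 * D) ^ 2 / (t * Real.sqrt A) :=
      div_le_div_of_nonneg_left (by positivity) (by positivity) s3
    refine (mul_le_mul_of_nonneg_right s4 hW).trans ?_
    have s5 : 4 * (2 * D) ^ 2 / (t * Real.sqrt A) * W =
        16 * B * (4 * D ^ 2 / Real.sqrt A * W) := by
      rw [ht]; field_simp; ring
    rw [s5]
    exact mul_le_mul_of_nonneg_left hε (by positivity)
  · intro s r hs hr hsr
    have e1 : m + t • p + s • (-(2 * t) • p) + r • (-((2 : ℝ)⁻¹ • e) - t • p) =
        m + ((1 - 2 * s - r) * t) • p - (r / 2) • e := by module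
    rw [e1]
    refine hΩ _ _ hr ?_
    rw [← le_sub_iff_add_le, abs_le]
    constructor <;> linarith

/-- `Y`, `Z`, `X` are values before, on and behind the edge. The second difference bounds `X`, and
the interpolant on the second triangle turns this into a bound at its opposite vertex. -/
theorem abs_opposite_value_le {fa fb fd X Y Z M ε B σ ν : ℝ} (hε : 0 ≤ ε) (hB : 1 ≤ B)
    (hY : |Y| ≤ M) (hZ : |Z| ≤ M) (ha : |fa| ≤ M) (hb : |fb| ≤ M)
    (hX : |X - (fa + σ * (fb - fa) + ν * (fd - fa))| ≤ 5 * ε) (hd : |Y + X - 2 * Z| ≤ 32 * B * ε)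
    (hσ : 0 ≤ σ) (hν : 0 ≤ ν) (hσν : σ + ν ≤ 1) : |ν * fd| ≤ 4 * M + 37 * B * ε := by
  have hM : 0 ≤ M := (abs_nonneg _).trans hY
  have hBε : ε ≤ B * ε := le_mul_of_one_le_left hε hB
  rw [abs_le] at hY hZ ha hb hX hd ⊢
  have k1 := mul_le_mul_of_nonneg_left ha.2 (by linarith : 0 ≤ 1 - σ - ν)
  have k2 := mul_le_mul_of_nonneg_left hb.2 hσ
  have k3 := mul_le_mul_of_nonneg_left ha.1 (by linarith : 0 ≤ 1 - σ - ν)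
  have k4 := mul_le_mul_of_nonneg_left hb.1 hσ
  have k5 := mul_nonneg hν hM
  constructor <;> linarith [hY.1, hY.2, hZ.1, hZ.2, hX.1, hX.2, hd.1, hd.2]

/-- A bound on a triangle carries over to a triangle on the other side of an edge. -/
theorem HasMixedBound.abs_le_across {Ω : Set Plane} {W : ℝ} {f : Plane → ℝ}
    (hf : HasMixedBound Ω W f) (hW : 0 ≤ W) {a b c d : Plane} {D A B ε M : ℝ} (hA : 0 < A)
    (hc : A ≤ |cr (b - a) (c - a)|) (hd : A ≤ |cr (b - a) (d - a)|)
    (hcd : cr (b - a) (c - a) * cr (b - a) (d - a) < 0)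
    (h1 : ‖b - a‖ ≤ D) (h2 : ‖c - a‖ ≤ D) (h3 : ‖c - b‖ ≤ D) (h4 : ‖d - a‖ ≤ D)
    (h5 : ‖d - b‖ ≤ D) (hB : D ^ 2 ≤ B * A) (hε : 4 * D ^ 2 / Real.sqrt A * W ≤ ε) (hM : ε ≤ M)
    (hΩ : convexHull ℝ ((({a, b, c} : Finset Plane)) : Set Plane) ⊆ Ω)
    (hΩ' : convexHull ℝ ((({a, b, d} : Finset Plane)) : Set Plane) ⊆ Ω)
    (hfM : ∀ x ∈ convexHull ℝ ((({a, b, c} : Finset Plane)) : Set Plane), |f x| ≤ M) :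
    ∀ x ∈ convexHull ℝ ((({a, b, d} : Finset Plane)) : Set Plane),
      |f x| ≤ 169 * B ^ 3 * M := by
  have hD : 0 ≤ D := (norm_nonneg _).trans h1
  have hε0 : 0 ≤ ε := le_trans (by positivity) hε
  have hM0 : 0 ≤ M := hε0.trans hM
  set e := b - a with he
  set m : Plane := a + (2 : ℝ)⁻¹ • e with hm
  set p := c - m with hp
  set q := d - m with hq
  have hpe : p = (c - a) - (2 : ℝ)⁻¹ • e := by rw [hp, hm]; module
  have hqe : q = (d - a) - (2 : ℝ)⁻¹ • e := by rw [hq, hm]; module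
  have crp : cr e p = cr e (c - a) := by
    rw [hpe]; simp only [cr, PiLp.sub_apply, PiLp.smul_apply, smul_eq_mul]; ring
  have crq : cr e q = cr e (d - a) := by
    rw [hqe]; simp only [cr, PiLp.sub_apply, PiLp.smul_apply, smul_eq_mul]; ring
  have half : ∀ x y : Plane, ‖x‖ ≤ D → ‖y‖ ≤ D → ‖(2 : ℝ)⁻¹ • x + (2 : ℝ)⁻¹ • y‖ ≤ D := by
    intro x y hx hy
    refine (norm_add_le _ _).trans ?_
    rw [norm_smul, norm_smul, Real.norm_of_nonneg (by norm_num : (0 : ℝ) ≤ 2⁻¹)]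
    linarith
  have np : ‖p‖ ≤ D := by
    have : p = (2 : ℝ)⁻¹ • (c - a) + (2 : ℝ)⁻¹ • (c - b) := by rw [hpe, he]; module
    rw [this]; exact half _ _ h2 h3
  have nq : ‖q‖ ≤ D := by
    have : q = (2 : ℝ)⁻¹ • (d - a) + (2 : ℝ)⁻¹ • (d - b) := by rw [hqe, he]; module
    rw [this]; exact half _ _ h4 h5
  have crle : ∀ x y : Plane, ‖x‖ ≤ D → ‖y‖ ≤ D → |cr x y| ≤ B * A := fun x y hx hy =>
    (abs_cr_le x y).trans ((mul_le_mul hx hy (norm_nonneg _) hD).trans (by rwa [← sq]))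
  have hB1 : 1 ≤ B := by
    have := hc.trans (crle _ _ h1 h2)
    by_contra hlt
    rw [not_le] at hlt
    nlinarith
  have hB0 : 0 < B := by linarith
  rw [← crp] at hc hcd
  rw [← crq] at hd hcd
  obtain ⟨t, γ, ζ, ht0, ht1, htB, hγ0, hγB', htγ, htζ, hpq⟩ := exists_crossing hA hB1 hc hd hcd
    (crle e p h1 np) (crle e q h1 nq) (crle p q np nq)
  have hq0 : cr e q ≠ 0 := abs_pos.1 (hA.trans_le hd)
  rw [abs_le] at htζ
  -- The auxiliary triangle crosses the edge: its part with `k ≥ 0` is in the first triangle, that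
  -- with `k ≤ 0` in the second one.
  have hbase : ∀ k r : ℝ, 0 ≤ r → |k| + r ≤ 1 → m + (k * t) • p - (r / 2) • e ∈ Ω := by
    intro k r hr hkr
    rcases le_total 0 k with hk | hk
    · rw [abs_of_nonneg hk] at hkr
      refine hΩ (mem_hull_triple.2 ⟨1 / 2 - k * t / 2 - r / 2, k * t, ?_, by positivity, ?_, ?_⟩)
      · nlinarith
      · nlinarith
      · rw [hpe, hm]; module
    · rw [abs_of_nonpos hk] at hkr
      have hk0 : 0 ≤ -k := by linarith
      have g1 := mul_le_mul_of_nonneg_left htγ hk0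
      have g2 := mul_le_mul_of_nonneg_left htζ.1 hk0
      have g3 := mul_le_mul_of_nonneg_left htζ.2 hk0
      refine hΩ' (mem_hull_triple.2 ⟨1 / 2 - (-k) * (t * γ) / 2 - (-k) * (t * ζ) - r / 2,
        (-k) * (t * γ), ?_, mul_nonneg hk0 (by positivity), ?_, ?_⟩)
      · linarith
      · linarith
      · rw [hpq, hqe, hm]; module
  have hsd := hf.second_difference_across hW hA hc h1 np hε ht0 ht1 htB hbase
  have m1 : |f (m + t • p)| ≤ M := by
    refine hfM _ (mem_hull_triple.2 ⟨1 / 2 - t / 2, t, by linarith, ht0.le, by linarith, ?_⟩)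
    rw [hpe, hm]; module
  have m2 : |f m| ≤ M := by
    refine hfM _ (mem_hull_triple.2 ⟨1 / 2, 0, by norm_num, le_rfl, by norm_num, ?_⟩)
    rw [hm]; module
  have ma : |f a| ≤ M := by
    refine hfM _ (mem_hull_triple.2 ⟨0, 0, le_rfl, le_rfl, by norm_num, by module⟩)
  have mb : |f b| ≤ M := by
    refine hfM _ (mem_hull_triple.2 ⟨1, 0, by norm_num, le_rfl, by norm_num, ?_⟩)
    module
  obtain ⟨L, La, Lb, Ld⟩ := exists_affine (a := a) (b := b) (c := d)
    (by rw [← he, ← crq]; exact hq0) (f a) (f b) (f d)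
  have hL := hf.sub_interpolant hW hA (by rw [← he, ← crq]; exact hd) h1 h4 h5 hε hΩ' La Lb Ld
  obtain ⟨σ, hσ⟩ : ∃ σ, σ = 1 / 2 - t * γ / 2 - t * ζ := ⟨_, rfl⟩
  have e3 : m - t • p = a + σ • (b - a) + (t * γ) • (d - a) := by
    rw [hσ, hpq, hqe, hm, ← he]; module
  have hσ0 : 0 ≤ σ := by rw [hσ]; linarith [htζ.2]
  have hν0 : 0 < t * γ := by positivity
  have hσν : σ + t * γ ≤ 1 := by rw [hσ]; linarith [htζ.1]
  have l1 := hL (m - t • p) (mem_hull_triple.2 ⟨_, _, hσ0, hν0.le, hσν, e3⟩)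
  rw [e3, affine_triangle, La, Lb, Ld, ← e3, smul_eq_mul, smul_eq_mul] at l1
  have key : |t * γ * f d| ≤ 4 * M + 37 * B * ε :=
    abs_opposite_value_le hε0 hB1 m1 m2 ma mb l1 hsd hσ0 hν0.le hσν
  -- From `key`, with `4 + 37 = 41` and `1 ≤ t γ * 4 B ^ 2`. The interpolation error `5 * ε` later
  -- raises `164` to `169`.
  have md : |f d| ≤ 164 * B ^ 3 * M := by
    rw [abs_mul, abs_of_pos hν0] at key
    have k1 : 1 ≤ t * γ * (4 * B ^ 2) := by
      have : t * γ * (4 * B ^ 2) = 4 * (t * B) * (γ * B) := by ring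
      rw [this, htB]; linarith
    have k2 : 4 * M + 37 * B * ε ≤ 41 * B * M := by
      have := mul_le_mul_of_nonneg_left hM (by linarith : 0 ≤ 37 * B)
      have := mul_le_mul_of_nonneg_right hB1 hM0
      linarith
    calc |f d| ≤ t * γ * (4 * B ^ 2) * |f d| := le_mul_of_one_le_left (abs_nonneg _) k1
      _ = 4 * B ^ 2 * (t * γ * |f d|) := by ring
      _ ≤ 4 * B ^ 2 * (41 * B * M) :=
        mul_le_mul_of_nonneg_left (key.trans k2) (by positivity)
      _ = 164 * B ^ 3 * M := by ring
  have hB3 : 1 ≤ B ^ 3 := one_le_pow₀ hB1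
  have hle : M ≤ 164 * B ^ 3 * M := le_mul_of_one_le_left hM0 (by linarith)
  intro x hx
  have hx1 := hL x hx
  obtain ⟨s, r, hs, hr, hsr, rfl⟩ := mem_hull_triple.1 hx
  rw [affine_triangle, La, Lb, Ld, smul_eq_mul, smul_eq_mul] at hx1
  have hx2 := abs_affine_le (ma.trans hle) (mb.trans hle) md hs hr hsr
  have hx3 : 5 * ε ≤ 5 * B ^ 3 * M := by
    have := le_mul_of_one_le_left hM0 hB3
    linarith
  rw [abs_le] at hx1 hx2 ⊢
  constructor <;> linarith [hx1.1, hx1.2, hx2.1, hx2.2]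

end Plate

namespace Plate

variable {K : Triangulation} {κ : ℝ}

/-! ### Patches and neighbourhoods -/

theorem mem_nodes {T : Finset Plane} (hT : T ∈ K.triangles) {z : Plane} (hz : z ∈ T) :
    z ∈ K.nodes :=
  K.down_closed (Triangulation.mem_triangles.1 hT).1 (by simpa using hz) (by simp)

theorem exists_triangle_of_node {z : Plane} (hz : z ∈ K.nodes) : ∃ T ∈ K.triangles, z ∈ T := by
  obtain ⟨T, hT, hzT, hc⟩ := K.exists_triangle _ hz
  exact ⟨T, Triangulation.mem_triangles.2 ⟨hT, hc⟩, hzT (by simp)⟩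

theorem interior_or_boundary {z : Plane} (hz : z ∈ K.nodes) :
    z ∈ K.interiorNodes ∨ z ∈ K.boundaryNodes := by
  by_cases h : z ∈ interior K.region
  · exact Or.inl ⟨hz, h⟩
  · exact Or.inr ⟨hz, h⟩

theorem patch_source_subset (P : PatchAssignment K) {z : Plane} (hz : z ∈ K.boundaryNodes) :
    P.patch (P.source z) ⊆ P.patch z := by
  by_cases h : ∃ w ∈ K.interiorNodes, K.DirectlyConnected z w
  · rw [(P.direct z hz h).2]
  · exact (P.indirect z hz h).2

theorem exists_mem_patch (P : PatchAssignment K) {z : Plane} (hz : z ∈ K.nodes) :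
    ∃ T ∈ P.patch z, z ∈ T := by
  rcases interior_or_boundary hz with hi | hb
  · obtain ⟨T, hT, hzT⟩ := exists_triangle_of_node hz
    exact ⟨T, P.star_subset z hi T hT hzT, hzT⟩
  · by_cases h : ∃ w ∈ K.interiorNodes, K.DirectlyConnected z w
    · obtain ⟨hd, he⟩ := P.direct z hb h
      obtain ⟨T, hT, hzT, hsT⟩ := DirectlyConnected.exists_triangle hd
      exact ⟨T, he ▸ P.star_subset _ (P.source_mem z hb) T hT hsT, hzT⟩
    · exact (P.indirect z hb h).1

theorem mem_neighborhood {P : PatchAssignment K} {T A : Finset Plane} :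
    A ∈ P.neighborhood T ↔ A ∈ K.triangles ∧
      ((convexHull ℝ (A : Set Plane) ∩ convexHull ℝ (T : Set Plane)).Nonempty ∨
        ∃ z ∈ T, A ∈ P.patch z) := by
  classical
  simp only [PatchAssignment.neighborhood, Finset.mem_filter]

theorem star_subset_neighborhood (P : PatchAssignment K) {T A : Finset Plane}
    (hA : A ∈ K.triangles) {z : Plane} (hzT : z ∈ T) (hzA : z ∈ A) : A ∈ P.neighborhood T :=
  mem_neighborhood.2 ⟨hA, Or.inl ⟨z, mem_hull hzA, mem_hull hzT⟩⟩

theorem patch_subset_neighborhood (P : PatchAssignment K) {T : Finset Plane}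
    (hT : T ∈ K.triangles) {z : Plane} (hz : z ∈ T) : P.patch z ⊆ P.neighborhood T := fun _ hA =>
  mem_neighborhood.2 ⟨P.patch_subset z (mem_nodes hT hz) hA, Or.inr ⟨z, hz, hA⟩⟩

theorem neighborhood_subset (P : PatchAssignment K) (T : Finset Plane) :
    P.neighborhood T ⊆ K.triangles := fun _ hA => (mem_neighborhood.1 hA).1

theorem self_mem_neighborhood (P : PatchAssignment K) {T : Finset Plane} (hT : T ∈ K.triangles) :
    T ∈ P.neighborhood T := by
  have hc := (Triangulation.mem_triangles.1 hT).2
  obtain ⟨z, hz⟩ := Finset.card_pos.1 (by omega : 0 < T.card)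
  exact star_subset_neighborhood P hT hz hz

theorem exists_common_vertex {T A : Finset Plane} (hT : T ∈ K.triangles) (hA : A ∈ K.triangles)
    (h : (convexHull ℝ (A : Set Plane) ∩ convexHull ℝ (T : Set Plane)).Nonempty) :
    ∃ z, z ∈ A ∧ z ∈ T := by
  obtain ⟨x, hxA, hxT⟩ := h
  have h1 := mem_hull_inter (Triangulation.mem_triangles.1 hA).1
    (Triangulation.mem_triangles.1 hT).1 hxA hxT
  by_contra hcon
  push Not at hcon
  have : ((A : Set Plane) ∩ T) = ∅ := by
    ext y
    simpa using hcon y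
  rw [this] at h1
  simp at h1

/-- The number of steps from a triangle to those in its neighbourhood. -/
def chainLength (κ : ℝ) (N : ℕ) : ℕ := ⌈4 * κ ^ 2⌉₊ + N

/-- Propagation of a bound from a triangle to its neighbourhood. -/
theorem neighborhood_bound (hreg : K.ShapeRegular κ) (hκ : 1 ≤ κ) (P : PatchAssignment K) {N : ℕ}
    (hN : P.BoundedBy N) {T : Finset Plane} (hT : T ∈ K.triangles) {Q : ℝ → Finset Plane → Prop}
    {B M₀ : ℝ} (hB : 1 ≤ B) (hM₀ : 0 ≤ M₀) (mono : ∀ A M M', M ≤ M' → Q M A → Q M' A)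
    (step : ∀ A ∈ P.neighborhood T, ∀ A' ∈ P.neighborhood T, ShareEdge A A' →
      ∀ M, M₀ ≤ M → Q M A → Q (B * M) A') {M : ℝ} (hM : M₀ ≤ M) (h : Q M T) :
    ∀ A ∈ P.neighborhood T, Q (B ^ chainLength κ N * M) A := by
  -- Triangles that touch `T` share a vertex with it and are reached around this vertex, as there
  -- are no pinch points. A patch is then entered at one of its triangles that contains the vertex.
  have hstar : ∀ z ∈ T, ∀ A ∈ K.triangles, z ∈ A → Q (B ^ ⌈4 * κ ^ 2⌉₊ * M) A := by
    intro z hz A hA hzA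
    have hmem : ∀ A, A ∈ K.finite_faces.toFinset.filter (fun T => T.card = 3 ∧ z ∈ T) ↔
        A ∈ K.triangles ∧ z ∈ A := by
      intro A
      rw [Triangulation.mem_triangles]
      simp only [Finset.mem_filter, Set.Finite.mem_toFinset, and_assoc]
    refine (K.no_pinch z).chain_bound (hreg.card_star_le hκ z (fun A hA => ((hmem A).1 hA).1)
      (fun A hA => ((hmem A).1 hA).2)) hB hM₀ mono ?_ ((hmem T).2 ⟨hT, hz⟩) ((hmem A).2 ⟨hA, hzA⟩)
      hM h
    intro A hA A' hA'
    exact step A (star_subset_neighborhood P ((hmem A).1 hA).1 hz ((hmem A).1 hA).2)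
      A' (star_subset_neighborhood P ((hmem A').1 hA').1 hz ((hmem A').1 hA').2)
  have hB1 : 1 ≤ B ^ ⌈4 * κ ^ 2⌉₊ := one_le_pow₀ hB
  have hB2 : 1 ≤ B ^ N := one_le_pow₀ hB
  have hM1 : M₀ ≤ B ^ ⌈4 * κ ^ 2⌉₊ * M :=
    hM.trans (le_mul_of_one_le_left (hM₀.trans hM) hB1)
  have e : B ^ chainLength κ N * M = B ^ N * (B ^ ⌈4 * κ ^ 2⌉₊ * M) := by
    rw [chainLength, pow_add]; ring
  intro A hA
  rw [e]
  obtain ⟨hAK, hAT | ⟨z, hz, hAz⟩⟩ := mem_neighborhood.1 hA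
  · obtain ⟨z, hzA, hzT⟩ := exists_common_vertex hT hAK hAT
    exact mono _ _ _ (le_mul_of_one_le_left (hM₀.trans hM1) hB2) (hstar z hzT A hAK hzA)
  · have hzn := mem_nodes hT hz
    obtain ⟨A', hA', hzA'⟩ := exists_mem_patch P hzn
    refine (P.patch_connected z hzn).chain_bound (hN z hzn) hB hM₀ mono ?_ hA' hAz hM1
      (hstar z hz A' (P.patch_subset z hzn hA') hzA')
    intro A hA A' hA'
    exact step A (patch_subset_neighborhood P hT hz hA) A' (patch_subset_neighborhood P hT hz hA')

/-- The triangle `A` has size and distance from `T` comparable to the size of `T`. -/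
structure SizeBound (T : Finset Plane) (M : ℝ) (A : Finset Plane) : Prop where
  size_le : meshSize A ≤ M * meshSize T
  size_ge : meshSize T ≤ M * meshSize A
  dist_le : ∀ x ∈ A, ∀ y ∈ T, dist x y ≤ M * meshSize T

/-- The ratio of sizes in a neighbourhood. -/
def sizeRatio (κ : ℝ) (N : ℕ) : ℝ := (κ ^ 3 + 1) ^ chainLength κ N * κ

theorem one_le_sizeRatio (hκ : 1 ≤ κ) (N : ℕ) : 1 ≤ sizeRatio κ N :=
  one_le_mul_of_one_le_of_one_le (one_le_pow₀ (by linarith [one_le_pow₀ hκ (n := 3)])) hκ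

/-- Across an edge the size changes at most by the factor `κ ^ 2`, and the distance from `T` grows
by at most one diameter; `κ ^ 3 + 1` covers both. -/
theorem sizeBound_of_mem (hreg : K.ShapeRegular κ) (hκ : 1 ≤ κ) (P : PatchAssignment K) {N : ℕ}
    (hN : P.BoundedBy N) {T : Finset Plane} (hT : T ∈ K.triangles) :
    ∀ A ∈ P.neighborhood T, SizeBound T (sizeRatio κ N) A := by
  have h0 := hreg.meshSize_pos hT
  have hκ0 : 0 < κ := by linarith
  have hκ2 : 1 ≤ κ ^ 2 := one_le_pow₀ hκ
  have hκ3 : κ ^ 2 ≤ κ ^ 3 := pow_le_pow_right₀ hκ (by norm_num)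
  refine neighborhood_bound hreg hκ P hN hT (Q := SizeBound T) (M₀ := 0) (by linarith) le_rfl ?_ ?_
    hκ0.le ?_
  · rintro A M M' hM ⟨h1, h2, h3⟩
    have hA := meshSize_nonneg A
    exact ⟨h1.trans (by gcongr), h2.trans (by gcongr),
      fun x hx y hy => (h3 x hx y hy).trans (by gcongr)⟩
  · rintro A hA A' hA' hs M hM ⟨h1, h2, h3⟩
    have hAK := neighborhood_subset P T hA
    have hAK' := neighborhood_subset P T hA'
    have s1 := hreg.meshSize_adjacent hκ hAK hAK' hs
    have s2 := hreg.meshSize_adjacent hκ hAK' hAK hs.symm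
    have p0 := hreg.meshSize_pos hAK
    have p0' := hreg.meshSize_pos hAK'
    have s3 : meshSize A' ≤ κ ^ 2 * (M * meshSize T) :=
      s1.trans (mul_le_mul_of_nonneg_left h1 (by positivity))
    refine ⟨s3.trans ?_, ?_, fun x hx y hy => ?_⟩
    · have : 0 ≤ M * meshSize T := by positivity
      nlinarith
    · have h4 : M * meshSize A ≤ M * (κ ^ 2 * meshSize A') := mul_le_mul_of_nonneg_left s2 hM
      have : 0 ≤ M * meshSize A' := by positivity
      nlinarith
    · obtain ⟨a, b, -, ha, ha', -⟩ := hs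
      have d1 := hreg.dist_le hAK' (mem_hull hx) (mem_hull ha')
      have d2 := h3 a ha y hy
      have d3 := dist_triangle x a y
      have d4 : κ * meshSize A' ≤ κ * (κ ^ 2 * (M * meshSize T)) :=
        mul_le_mul_of_nonneg_left s3 hκ0.le
      linarith
  · exact ⟨le_mul_of_one_le_left h0.le hκ, le_mul_of_one_le_left h0.le hκ,
      fun x hx y hy => hreg.dist_le hT (mem_hull hx) (mem_hull hy)⟩

theorem SizeBound.sq_le_cr {T A : Finset Plane} {M : ℝ} (h : SizeBound T M A) (hM : 0 < M)
    {x y w : Plane} (hA : A = {x, y, w}) :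
    1 / M ^ 2 * meshSize T ^ 2 ≤ |cr (y - x) (w - x)| := by
  refine le_trans ?_ (hA ▸ sq_meshSize_le x y w)
  rw [one_div_mul_eq_div, div_le_iff₀ (by positivity)]
  have := pow_le_pow_left₀ (meshSize_nonneg T) h.size_ge 2
  rw [mul_pow] at this
  linarith

theorem SizeBound.norm_sub_le {T A A' : Finset Plane} {M : ℝ} (h : SizeBound T M A)
    (h' : SizeBound T M A') (hT : T.Nonempty) {x y : Plane} (hx : x ∈ A) (hy : y ∈ A') :
    ‖x - y‖ ≤ 2 * M * meshSize T := by
  obtain ⟨t, ht⟩ := hT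
  rw [← dist_eq_norm]
  have h1 := h.dist_le x hx t ht
  have h2 := h'.dist_le y hy t ht
  have h3 := dist_triangle_right x y t
  linarith

/-- Patches in the neighbourhood of a triangle have bounded geometry. -/
theorem isBounded_of_subset (hreg : K.ShapeRegular κ) (hκ : 1 ≤ κ) (P : PatchAssignment K) {N : ℕ}
    (hN : P.BoundedBy N) {T : Finset Plane} (hT : T ∈ K.triangles) {z : Plane} (hz : z ∈ K.nodes)
    (hsub : P.patch z ⊆ P.neighborhood T) :
    IsBounded (P.patch z) z (meshSize T) (2 * sizeRatio κ N) (1 / sizeRatio κ N ^ 2) := by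
  have hs := sizeBound_of_mem hreg hκ P hN hT
  have hne : T.Nonempty := Finset.card_pos.1 (by rw [(Triangulation.mem_triangles.1 hT).2]; simp)
  have hM : 0 < sizeRatio κ N := by linarith [one_le_sizeRatio hκ N]
  obtain ⟨A₀, hA₀, hz₀⟩ := exists_mem_patch P hz
  refine ⟨hreg.meshSize_pos hT, fun A hA x hx => ?_, fun A hA x hx y hy => ?_,
    fun A hA x y w he => ?_⟩
  · rw [dist_eq_norm]
    exact (hs A (hsub hA)).norm_sub_le (hs A₀ (hsub hA₀)) hne hx hz₀
  · exact (hs A (hsub hA)).norm_sub_le (hs A (hsub hA)) hne hx hy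
  · exact (hs A (hsub hA)).sq_le_cr hM he

/-- The constant in `abs_sub_interpolant_le`. -/
def interpolationConst (κ : ℝ) (N : ℕ) : ℝ :=
  (169 * (4 * sizeRatio κ N ^ 4) ^ 3) ^ chainLength κ N * (80 * sizeRatio κ N ^ 3)

theorem interpolationConst_pos (hκ : 1 ≤ κ) (N : ℕ) : 0 < interpolationConst κ N := by
  have hM : 0 < sizeRatio κ N := by linarith [one_le_sizeRatio hκ N]
  unfold interpolationConst
  positivity

/-- The interpolant at the vertices of a triangle is close to the function in the neighbourhood. -/
theorem abs_sub_interpolant_le (hreg : K.ShapeRegular κ) (hκ : 1 ≤ κ) (P : PatchAssignment K)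
    {N : ℕ} (hN : P.BoundedBy N) {T : Finset Plane} (hT : T ∈ K.triangles) {W : ℝ} (hW : 0 ≤ W)
    {f : Plane → ℝ} (hf : HasMixedBound (cover (P.neighborhood T)) W f) {p : Plane →ᵃ[ℝ] ℝ}
    (hp : ∀ z ∈ T, p z = f z) :
    ∀ A ∈ P.neighborhood T, ∀ x ∈ convexHull ℝ (A : Set Plane),
      |f x - p x| ≤ interpolationConst κ N * (meshSize T * W) := by
  have hs := sizeBound_of_mem hreg hκ P hN hT
  have hT3 := (Triangulation.mem_triangles.1 hT).2
  have hne : T.Nonempty := Finset.card_pos.1 (by rw [hT3]; simp)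
  have hM1 := one_le_sizeRatio hκ N
  set M := sizeRatio κ N with hMdef
  have hM : 0 < M := by linarith
  have h0 := hreg.meshSize_pos hT
  set h := meshSize T with hh
  have hcov : ∀ A ∈ P.neighborhood T,
      convexHull ℝ (A : Set Plane) ⊆ cover (P.neighborhood T) := fun A hA x hx =>
    Set.mem_iUnion₂.2 ⟨A, hA, hx⟩
  have hA0 : 0 < 1 / M ^ 2 * h ^ 2 := by positivity
  have hsqrt : Real.sqrt (1 / M ^ 2 * h ^ 2) = h / M := by
    rw [show 1 / M ^ 2 * h ^ 2 = (h / M) ^ 2 by field_simp, Real.sqrt_sq (by positivity)]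
  -- The value of `4 D ^ 2 / √A * W` for the diameter bound `D = 2 M h` and the area bound `A = (h /
  -- M) ^ 2`. The ratio `D ^ 2 / A = 4 M ^ 4` takes the role of `B`.
  obtain ⟨ε, hε⟩ : ∃ ε, ε = 16 * M ^ 3 * (h * W) := ⟨_, rfl⟩
  have hε0 : 0 ≤ ε := by rw [hε]; positivity
  have hε' : 4 * (2 * M * h) ^ 2 / Real.sqrt (1 / M ^ 2 * h ^ 2) * W ≤ ε := by
    rw [hsqrt, hε]
    apply le_of_eq
    field_simp
    ring
  have hBA : (2 * M * h) ^ 2 ≤ 4 * M ^ 4 * (1 / M ^ 2 * h ^ 2) := by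
    apply le_of_eq
    field_simp
    ring
  have hnorm : ∀ A ∈ P.neighborhood T, ∀ x ∈ A, ∀ y ∈ A, ‖x - y‖ ≤ 2 * M * h :=
    fun A hA x hx y hy => (hs A hA).norm_sub_le (hs A hA) hne hx hy
  have e : interpolationConst κ N * (h * W) =
      (169 * (4 * M ^ 4) ^ 3) ^ chainLength κ N * (5 * ε) := by
    rw [interpolationConst, ← hMdef, hε]; ring
  rw [e]
  have hM4 : 1 ≤ 4 * M ^ 4 := by linarith [one_le_pow₀ hM1 (n := 4)]
  refine neighborhood_bound hreg hκ P hN hT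
    (Q := fun m A => ∀ x ∈ convexHull ℝ (A : Set Plane), |f x - p x| ≤ m) (M₀ := 5 * ε)
    (by linarith [one_le_pow₀ hM4 (n := 3)]) (by positivity)
    (fun A m m' hm hA x hx => (hA x hx).trans hm) ?_ le_rfl ?_
  · intro A hA A' hA' hsh m hm hfm
    have hAK := neighborhood_subset P T hA
    have hAK' := neighborhood_subset P T hA'
    obtain ⟨a, b, c, d, hab, hca, hcb, hda, hdb, hcd, rfl, rfl⟩ := hsh.exists_vertices
      (Triangulation.mem_triangles.1 hAK).2 (Triangulation.mem_triangles.1 hAK').2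
    refine (hf.sub_affine p).abs_le_across hW hA0 ((hs _ hA).sq_le_cr hM rfl)
      ((hs _ hA').sq_le_cr hM rfl) (opposite_sides (Triangulation.mem_triangles.1 hAK).1
        (Triangulation.mem_triangles.1 hAK').1 hcd (hreg.cr_ne_zero hAK) (hreg.cr_ne_zero hAK'))
      (hnorm _ hA _ (by simp) _ (by simp)) (hnorm _ hA _ (by simp) _ (by simp))
      (hnorm _ hA _ (by simp) _ (by simp)) (hnorm _ hA' _ (by simp) _ (by simp))
      (hnorm _ hA' _ (by simp) _ (by simp)) hBA hε' (by linarith) (hcov _ hA) (hcov _ hA') hfm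
  · obtain ⟨a, b, c, hab, hac, hbc, hTe⟩ := Finset.card_eq_three.1 hT3
    have hTN : ({a, b, c} : Finset Plane) ∈ P.neighborhood T := by
      rw [← hTe]
      exact self_mem_neighborhood P hT
    have hmem : a ∈ T ∧ b ∈ T ∧ c ∈ T := by simp [hTe]
    rw [hTe]
    exact hf.sub_interpolant hW hA0 ((hs _ hTN).sq_le_cr hM rfl)
      (hnorm _ hTN _ (by simp) _ (by simp)) (hnorm _ hTN _ (by simp) _ (by simp))
      (hnorm _ hTN _ (by simp) _ (by simp)) hε' (hcov _ hTN) (hp _ hmem.1)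
      (hp _ hmem.2.1) (hp _ hmem.2.2)

end Plate

namespace Plate

variable {K : Triangulation} {κ : ℝ}

/-! ### Lines through a vertex -/

theorem isLine_line {z a : Plane} (h : a ≠ z) : IsLine (line[ℝ, z, a]) := by
  rw [IsLine, direction_affineSpan, vectorSpan_pair_rev]
  exact finrank_span_singleton (sub_ne_zero.2 h)

/-- The foot of the perpendicular from `w` on the line through `z` and `a`. -/
theorem exists_foot {z a : Plane} (h : a ≠ z) (w : Plane) :
    ∃ y ∈ line[ℝ, z, a], dist w y * ‖a - z‖ = |cr (a - z) (w - z)| := by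
  set u := a - z with hu
  have hu0 : 0 < ‖u‖ := norm_pos_iff.2 (sub_ne_zero.2 h)
  set t : ℝ := dt u (w - z) / ‖u‖ ^ 2 with ht
  refine ⟨AffineMap.lineMap z a t, AffineMap.lineMap_mem_affineSpan_pair t z a, ?_⟩
  have e : w - AffineMap.lineMap z a t = (w - z) - t • u := by
    rw [AffineMap.lineMap_apply, vsub_eq_sub, vadd_eq_add, hu]; abel
  rw [dist_eq_norm, e, ← abs_of_nonneg (mul_nonneg (norm_nonneg (w - z - t • u)) hu0.le)]
  rw [← sq_eq_sq_iff_abs_eq_abs, mul_pow]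
  have h1 := norm_sq_eq u
  have h2 : t * ‖u‖ ^ 2 = dt u (w - z) := by rw [ht]; field_simp
  have h3 : ‖w - z - t • u‖ ^ 2 = ‖w - z‖ ^ 2 - 2 * t * dt u (w - z) + t ^ 2 * ‖u‖ ^ 2 := by
    rw [norm_sq_eq, norm_sq_eq, norm_sq_eq]
    simp only [dt, PiLp.sub_apply, PiLp.smul_apply, smul_eq_mul]
    ring
  have h4 : ‖w - z‖ ^ 2 * ‖u‖ ^ 2 = cr u (w - z) ^ 2 + dt u (w - z) ^ 2 := by
    rw [norm_sq_eq, norm_sq_eq]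
    simp only [dt, cr]
    ring
  rw [h3]
  have h5 : (‖w - z‖ ^ 2 - 2 * t * dt u (w - z) + t ^ 2 * ‖u‖ ^ 2) * ‖u‖ ^ 2 =
      ‖w - z‖ ^ 2 * ‖u‖ ^ 2 - 2 * (t * ‖u‖ ^ 2) * dt u (w - z) + (t * ‖u‖ ^ 2) ^ 2 := by ring
  rw [h5, h2, h4]
  ring

theorem finite_patchNodes (P : PatchAssignment K) (z : Plane) : (P.patchNodes z).Finite := by
  have : P.patchNodes z = ⋃ T ∈ P.patch z, (T : Set Plane) := by
    ext w
    simp [PatchAssignment.patchNodes]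
  rw [this]
  exact (P.patch z).finite_toSet.biUnion fun T _ => T.finite_toSet

theorem IsBounded.le_norm_sub {S : Finset (Finset Plane)} {z : Plane} {h R c : ℝ}
    (hb : IsBounded S z h R c) (hR : 0 < R) {T : Finset Plane} (hT : T ∈ S) (hT3 : T.card = 3)
    {a b : Plane} (ha : a ∈ T) (hz : b ∈ T) (hab : a ≠ b) : c / R * h ≤ ‖a - b‖ := by
  classical
  have hh := hb.pos
  obtain ⟨w, hw, hwa, hwb⟩ : ∃ w ∈ T, w ≠ a ∧ w ≠ b := by
    by_contra hcon
    push Not at hcon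
    have : T ⊆ {a, b} := fun x hx => by
      by_cases hxa : x = a
      · simp [hxa]
      · simp [hcon x hx hxa]
    have := Finset.card_le_card this
    rw [hT3, Finset.card_pair hab] at this
    omega
  have h1 := hb.area_ge T hT b a w (triple_perm hT3 hz ha hw hab.symm hwb hwa)
  have h2 := abs_cr_le (a - b) (w - b)
  have h3 := mul_le_mul_of_nonneg_left (hb.diam_le T hT w hw b hz) (norm_nonneg (a - b))
  have h4 : c * h ^ 2 ≤ ‖a - b‖ * (R * h) := h1.trans (h2.trans h3)
  rw [div_mul_eq_mul_div, div_le_iff₀ hR]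
  have h5 : c * h * h ≤ ‖a - b‖ * R * h := by linarith
  exact le_of_mul_le_mul_right h5 hh

/-- A cross product is a distance from a line times an edge length. The edge is at least `c / R * h`
long, and so is the diameter of the set of patch vertices. -/
theorem awayFromAxes_of_awayFromTwoLines (P : PatchAssignment K) {z : Plane}
    (hz : z ∈ K.interiorNodes) {h R c δ : ℝ} (hb : IsBounded (P.patch z) z h R c) (hR : 0 < R)
    (hc : 0 < c) (hδ : 0 < δ) (haway : P.AwayFromTwoLines δ z) :
    AwayFromAxes P z h (δ * (c / R) ^ 2) := by
  have hh := hb.pos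
  have hkey : ∀ a, K.DirectlyConnected z a → ∀ w,
      δ * Metric.diam (P.patchNodes z) ≤ Metric.infDist w (line[ℝ, z, a] : Set Plane) →
      δ * (c / R) ^ 2 * h ^ 2 ≤ |cr (a - z) (w - z)| := by
    intro a ha w hw
    have haz : a ≠ z := ha.1.symm
    obtain ⟨T, hT, hzT, haT⟩ := DirectlyConnected.exists_triangle ha
    have hTS := P.star_subset z hz T hT hzT
    have h1 := hb.le_norm_sub hR hTS (Triangulation.mem_triangles.1 hT).2 haT hzT haz
    have h2 : ‖a - z‖ ≤ Metric.diam (P.patchNodes z) := by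
      rw [← dist_eq_norm]
      exact Metric.dist_le_diam_of_mem (finite_patchNodes P z).isBounded ⟨T, hTS, haT⟩
        ⟨T, hTS, hzT⟩
    obtain ⟨y, hy, hyd⟩ := exists_foot haz w
    have h3 : Metric.infDist w (line[ℝ, z, a] : Set Plane) ≤ dist w y :=
      Metric.infDist_le_dist_of_mem hy
    rw [← hyd]
    have h4 : δ * (c / R * h) ≤ dist w y :=
      (mul_le_mul_of_nonneg_left (h1.trans h2) hδ.le).trans (hw.trans h3)
    have h5 := mul_le_mul h4 h1 (by positivity) dist_nonneg
    calc δ * (c / R) ^ 2 * h ^ 2 = δ * (c / R * h) * (c / R * h) := by ring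
      _ ≤ _ := h5
  intro a b ha hb'
  obtain ⟨w, hw, h1, h2⟩ := haway _ _ (isLine_line ha.1.symm) (isLine_line hb'.1.symm)
  exact ⟨w, hw, hkey a ha w h1, hkey b hb' w h2⟩

theorem exists_pos_le {ι : Type*} [Finite ι] {f : ι → ℝ} (hf : ∀ i, 0 < f i) :
    ∃ δ, 0 < δ ∧ ∀ i, δ ≤ f i := by
  rcases isEmpty_or_nonempty ι with hι | hι
  · exact ⟨1, one_pos, fun i => hι.elim i⟩
  · obtain ⟨i, hi⟩ := Finite.exists_min f
    exact ⟨f i, hf i, hi⟩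

/-- There are finitely many pairs of neighbours. The resulting `δ` depends on the patch, which is
enough for uniqueness but not for uniform bounds. -/
theorem exists_awayFromAxes (P : PatchAssignment K) {z : Plane} {h : ℝ} (hh : 0 < h)
    (hP : ¬ P.OnTwoLines z) : ∃ δ, 0 < δ ∧ AwayFromAxes P z h δ := by
  have hex : ∀ i : Neighbor K z × Neighbor K z, ∃ w ∈ P.patchNodes z,
      cr (i.1.1 - z) (w - z) ≠ 0 ∧ cr (i.2.1 - z) (w - z) ≠ 0 := by
    rintro ⟨⟨a, ha⟩, ⟨b, hb⟩⟩
    by_contra hcon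
    push Not at hcon
    have hmem : ∀ a w : Plane, a ≠ z → cr (a - z) (w - z) = 0 → w ∈ line[ℝ, z, a] := by
      intro a w haz h0
      obtain ⟨y, hy, hd⟩ := exists_foot haz w
      rw [h0, abs_zero, mul_eq_zero, norm_eq_zero, sub_eq_zero, or_iff_left haz, dist_eq_zero] at hd
      rwa [hd]
    refine hP ⟨_, _, isLine_line ha.1.symm, isLine_line hb.1.symm, fun w hw => ?_⟩
    by_cases h0 : cr (a - z) (w - z) = 0
    · exact Or.inl (hmem a w ha.1.symm h0)
    · exact Or.inr (hmem b w hb.1.symm (hcon w hw h0))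
  choose w hw h1 h2 using hex
  obtain ⟨δ, hδ, hle⟩ := exists_pos_le
    (f := fun i => min |cr (i.1.1 - z) (w i - z)| |cr (i.2.1 - z) (w i - z)| / h ^ 2)
    (fun i => div_pos (lt_min (abs_pos.2 (h1 i)) (abs_pos.2 (h2 i))) (by positivity))
  refine ⟨δ, hδ, fun a b ha hb => ⟨w (⟨a, ha⟩, ⟨b, hb⟩), hw _, ?_⟩⟩
  have h3 := hle (⟨a, ha⟩, ⟨b, hb⟩)
  rw [le_div_iff₀ (by positivity), le_min_iff] at h3
  exact h3

/-! ### The least-squares problem -/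

theorem edgesOf_mono {S S' : Finset (Finset Plane)} (h : S ⊆ S') : edgesOf S ⊆ edgesOf S' := by
  classical
  exact Finset.biUnion_subset_biUnion_of_subset_left _ h

theorem mem_edgesOf {S : Finset (Finset Plane)} {e : Finset Plane} :
    e ∈ edgesOf S ↔ ∃ T ∈ S, e ⊆ T ∧ e.card = 2 := by
  classical
  simp only [edgesOf, Finset.mem_biUnion, Finset.mem_powersetCard]

theorem card_edgesOf_le {S : Finset (Finset Plane)} {N : ℕ} (hS : S.card ≤ N)
    (h3 : ∀ T ∈ S, T.card = 3) : (edgesOf S).card ≤ N * 3 := by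
  classical
  refine (Finset.card_biUnion_le_card_mul _ _ 3 fun T hT => ?_).trans
    (Nat.mul_le_mul_right 3 hS)
  rw [Finset.card_powersetCard, h3 T hT]
  rfl

theorem normalNormal_add (e : Finset Plane) (A B : Mat) :
    normalNormal e (A + B) = normalNormal e A + normalNormal e B := by
  simp only [normalNormal, Fin.sum_univ_two, Matrix.add_apply]
  ring

theorem normalNormal_smul (e : Finset Plane) (t : ℝ) (A : Mat) :
    normalNormal e (t • A) = t * normalNormal e A := by
  simp only [normalNormal, Fin.sum_univ_two, Matrix.smul_apply, smul_eq_mul]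
  ring

/-- The affine maps with values in the symmetric matrices. -/
def symmAffine : Submodule ℝ (Plane →ᵃ[ℝ] Mat) where
  carrier := {p | ∀ x, (p x).IsSymm}
  add_mem' := fun hp hq x => (hp x).add (hq x)
  zero_mem' := fun _ => Matrix.isSymm_zero
  smul_mem' := fun t _ hp x => (hp x).smul t

/-- The normal-normal components at the midpoints of the edges. -/
def edgeData (S : Finset (Finset Plane)) :
    (Plane →ᵃ[ℝ] Mat) →ₗ[ℝ] EuclideanSpace ℝ {e // e ∈ edgesOf S} where
  toFun := fun p => WithLp.toLp 2 fun e => normalNormal e.1 (p (edgeMidpoint e.1))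
  map_add' := fun p q => by
    ext e
    exact normalNormal_add _ _ _
  map_smul' := fun t p => by
    ext e
    exact normalNormal_smul _ _ _

theorem lsq_eq (S : Finset (Finset Plane)) (d : Finset Plane → ℝ) (p : Plane →ᵃ[ℝ] Mat) :
    lsq S d p = dist (WithLp.toLp 2 fun e : {e // e ∈ edgesOf S} => d e.1) (edgeData S p) ^ 2 := by
  rw [dist_comm, EuclideanSpace.dist_eq, Real.sq_sqrt (by positivity), lsq,
    ← Finset.sum_coe_sort (edgesOf S)]
  refine Finset.sum_congr rfl fun e _ => ?_
  rw [Real.dist_eq, sq_abs]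
  rfl

/-- The attainable edge data form a finite-dimensional, hence closed, subspace, which contains a
point nearest to the given data. This needs no condition on the patch. -/
theorem exists_isFit (S : Finset (Finset Plane)) (d : Finset Plane → ℝ) : ∃ p, IsFit S d p := by
  set E := symmAffine.map (edgeData S) with hE
  obtain ⟨y, hy, hmin⟩ := (Submodule.closed_of_finiteDimensional E).exists_infDist_eq_dist
    ⟨0, E.zero_mem⟩ (WithLp.toLp 2 fun e : {e // e ∈ edgesOf S} => d e.1)
  obtain ⟨p, hp, rfl⟩ := hy
  refine ⟨p, hp, fun q hq => ?_⟩
  rw [lsq_eq, lsq_eq]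
  refine pow_le_pow_left₀ dist_nonneg ?_ 2
  rw [← hmin]
  exact Metric.infDist_le_dist_of_mem ⟨q, hq, rfl⟩

/-- By the parallelogram identity the mean of two minimizers would be better than both, unless they
have the same edge values. -/
theorem IsFit.unique {S : Finset (Finset Plane)} {d : Finset Plane → ℝ} {p q : Plane →ᵃ[ℝ] Mat}
    (hp : IsFit S d p) (hq : IsFit S d q)
    (hinj : ∀ r : Plane →ᵃ[ℝ] Mat, (∀ x, (r x).IsSymm) →
      (∀ e ∈ edgesOf S, normalNormal e (r (edgeMidpoint e)) = 0) → r = 0) : p = q := by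
  have hm : ((1 / 2 : ℝ) • p + (1 / 2 : ℝ) • q) ∈ symmAffine :=
    symmAffine.add_mem (symmAffine.smul_mem _ hp.1) (symmAffine.smul_mem _ hq.1)
  have h1 := hp.2 _ hm
  have h2 := hq.2 _ hm
  have h3 : lsq S d ((1 / 2 : ℝ) • p + (1 / 2 : ℝ) • q) = (lsq S d p + lsq S d q) / 2 -
      (∑ e ∈ edgesOf S, normalNormal e ((p - q) (edgeMidpoint e)) ^ 2) / 4 := by
    rw [lsq, lsq, lsq, ← Finset.sum_add_distrib, Finset.sum_div, Finset.sum_div,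
      ← Finset.sum_sub_distrib]
    refine Finset.sum_congr rfl fun e _ => ?_
    have e1 : ((1 / 2 : ℝ) • p + (1 / 2 : ℝ) • q) (edgeMidpoint e) =
        (1 / 2 : ℝ) • p (edgeMidpoint e) + (1 / 2 : ℝ) • q (edgeMidpoint e) := rfl
    have e2 : (p - q) (edgeMidpoint e) = p (edgeMidpoint e) - q (edgeMidpoint e) := rfl
    rw [e1, e2, normalNormal_add, normalNormal_smul, normalNormal_smul, normalNormal_sub]
    ring
  have h4 : ∑ e ∈ edgesOf S, normalNormal e ((p - q) (edgeMidpoint e)) ^ 2 = 0 :=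
    le_antisymm (by linarith) (Finset.sum_nonneg fun _ _ => sq_nonneg _)
  rw [Finset.sum_eq_zero_iff_of_nonneg fun _ _ => sq_nonneg _] at h4
  exact sub_eq_zero.1 (hinj _ (symmAffine.sub_mem hp.1 hq.1)
    fun e he => pow_eq_zero_iff two_ne_zero |>.1 (h4 e he))

/-- The residual of the minimizer is at most that of `q`, which is at most `√(3 N) η ≤ (3 N + 1) η`
as a patch has at most `3 N` edges. The misfit of `q` itself adds another `η`. -/
theorem IsFit.abs_sub_le {S : Finset (Finset Plane)} {d : Finset Plane → ℝ}
    {p q : Plane →ᵃ[ℝ] Mat} (hp : IsFit S d p) (hq : ∀ x, (q x).IsSymm) {N : ℕ} (hS : S.card ≤ N)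
    (h3 : ∀ T ∈ S, T.card = 3) {η : ℝ} (hη : 0 ≤ η)
    (hd : ∀ e ∈ edgesOf S, |normalNormal e (q (edgeMidpoint e)) - d e| ≤ η) :
    ∀ e ∈ edgesOf S, |normalNormal e ((p - q) (edgeMidpoint e))| ≤ (3 * N + 2) * η := by
  intro e he
  have h1 : lsq S d q ≤ 3 * N * η ^ 2 := by
    have h2 : lsq S d q ≤ ∑ e ∈ edgesOf S, η ^ 2 := Finset.sum_le_sum fun e he => by
      rw [← sq_abs]
      exact pow_le_pow_left₀ (abs_nonneg _) (hd e he) 2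
    rw [Finset.sum_const, nsmul_eq_mul] at h2
    have h4 : ((edgesOf S).card : ℝ) ≤ N * 3 := by exact_mod_cast card_edgesOf_le hS h3
    have h5 := mul_le_mul_of_nonneg_right h4 (sq_nonneg η)
    linarith
  have h2 : (normalNormal e (p (edgeMidpoint e)) - d e) ^ 2 ≤ lsq S d p :=
    Finset.single_le_sum (f := fun e => (normalNormal e (p (edgeMidpoint e)) - d e) ^ 2)
      (fun _ _ => sq_nonneg _) he
  have h4 : |normalNormal e (p (edgeMidpoint e)) - d e| ≤ (3 * N + 1) * η := by
    refine abs_le_of_sq_le_sq ?_ (by positivity)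
    refine h2.trans ((hp.2 q hq).trans (h1.trans ?_))
    rw [mul_pow]
    refine mul_le_mul_of_nonneg_right ?_ (sq_nonneg η)
    have : (0 : ℝ) ≤ N := Nat.cast_nonneg N
    nlinarith
  have e2 : (p - q) (edgeMidpoint e) = p (edgeMidpoint e) - q (edgeMidpoint e) := rfl
  rw [e2, normalNormal_sub]
  have h5 := hd e he
  rw [abs_le] at h4 h5 ⊢
  constructor <;> linarith [h4.1, h4.2, h5.1, h5.2]

end Plate

namespace Plate

variable {K : Triangulation} {κ : ℝ}

/-! ### Stability of the recovery operator -/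

/-- Each patch contains that of an interior vertex, where the stability estimate with `η = 0`
applies; a constant that depends on the patch does no harm. The field vanishes on a triangle and
hence everywhere. -/
theorem eq_zero_of_normalNormal_eq_zero (hreg : K.ShapeRegular κ) (hκ : 1 ≤ κ)
    (P : PatchAssignment K) {N : ℕ} (hN : P.BoundedBy N)
    (hwp : ∀ z ∈ K.interiorNodes, P.WellPosedAt z) {z : Plane} (hz : z ∈ K.nodes)
    {r : Plane →ᵃ[ℝ] Mat} (hr : ∀ x, (r x).IsSymm)
    (h0 : ∀ e ∈ edgesOf (P.patch z), normalNormal e (r (edgeMidpoint e)) = 0) : r = 0 := by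
  obtain ⟨y, hy, hsub⟩ : ∃ y ∈ K.interiorNodes, P.patch y ⊆ P.patch z := by
    rcases interior_or_boundary hz with hi | hb
    · exact ⟨z, hi, subset_rfl⟩
    · exact ⟨P.source z, P.source_mem z hb, patch_source_subset P hb⟩
  obtain ⟨T, hT, hyT⟩ := exists_triangle_of_node hy.1
  have hM : 0 < sizeRatio κ N := by linarith [one_le_sizeRatio hκ N]
  have hb := isBounded_of_subset hreg hκ P hN hT hy.1 (patch_subset_neighborhood P hT hyT)
  obtain ⟨δ, hδ, haway⟩ : ∃ δ, 0 < δ ∧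
      (K.valence y = 4 → AwayFromAxes P y (meshSize T) δ) := by
    by_cases h4 : K.valence y = 4
    · obtain ⟨δ, hδ, h⟩ := exists_awayFromAxes P hb.pos ((hwp y hy).2.2 h4)
      exact ⟨δ, hδ, fun _ => h⟩
    · exact ⟨1, one_pos, fun h => absurd h h4⟩
  obtain ⟨C, -, hC⟩ := exists_stability N (R := 2 * sizeRatio κ N) (c := 1 / sizeRatio κ N ^ 2)
    (by positivity) (by positivity) hδ
  have hz0 := (hC K κ P y _ hreg hy (hN y hy.1) (hwp y hy) hb r hr 0 fun e he => by
    rw [h0 e (edgesOf_mono hsub he), abs_zero]).2 haway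
  have hval : ∀ x ∈ T, r x = (0 : Plane →ᵃ[ℝ] Mat) x := by
    intro x hx
    ext i j
    have := hz0 x (hb.dist_le T (P.star_subset y hy T hT hyT) x hx) i j
    rw [mul_zero] at this
    exact abs_nonpos_iff.1 this
  obtain ⟨a, b, c, -, -, -, rfl⟩ := Finset.card_eq_three.1 (Triangulation.mem_triangles.1 hT).2
  exact affine_ext (hreg.cr_ne_zero hT) (hval a (by simp)) (hval b (by simp)) (hval c (by simp))

theorem fit_isFit (P : PatchAssignment K) (τ : BrokenField) (z : Plane) :
    IsFit (P.patch z) (edgeValue K τ) (P.fit τ z) :=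
  Classical.epsilon_spec (exists_isFit _ _)

theorem exists_recovery_eq (hreg : K.ShapeRegular κ) (P : PatchAssignment K) (τ : BrokenField)
    {T : Finset Plane} (hT : T ∈ K.triangles) :
    ∃ p : Plane →ᵃ[ℝ] Mat, (∀ z ∈ T, p z = P.fit τ z z) ∧ ∀ x, P.recovery τ T x = p x := by
  refine ⟨_, Classical.epsilon_spec (p := fun p : Plane →ᵃ[ℝ] Mat =>
    ∀ z ∈ T, p z = P.fit τ z z) ?_, fun x => rfl⟩
  obtain ⟨a, b, c, -, -, -, rfl⟩ := Finset.card_eq_three.1 (Triangulation.mem_triangles.1 hT).2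
  obtain ⟨p, ha, hb, hc⟩ := exists_affine (hreg.cr_ne_zero hT) (P.fit τ a a) (P.fit τ b b)
    (P.fit τ c c)
  refine ⟨p, fun z hz => ?_⟩
  simp only [Finset.mem_insert, Finset.mem_singleton] at hz
  rcases hz with rfl | rfl | rfl <;> assumption

theorem abs_affine_apply_le {p : Plane →ᵃ[ℝ] Mat} {T : Finset Plane} (hT : T.card = 3) {M : ℝ}
    (h : ∀ z ∈ T, ∀ i j, |p z i j| ≤ M) :
    ∀ x ∈ convexHull ℝ (T : Set Plane), ∀ i j, |p x i j| ≤ M := by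
  obtain ⟨a, b, c, -, -, -, rfl⟩ := Finset.card_eq_three.1 hT
  intro x hx i j
  obtain ⟨s, t, hs, ht, hst, rfl⟩ := mem_hull_triple.1 hx
  rw [affine_triangle]
  exact abs_affine_le (h a (by simp) i j) (h b (by simp) i j) (h c (by simp) i j) hs ht hst

/-- The common source of both estimates. At each vertex, fit minus `q` is a symmetric affine field
with edge values at most `(3 N + 2) η`, so the stability estimate bounds it there; both fields being
affine on `T`, its vertices suffice. -/
theorem exists_recovery_bound (hκ : 1 ≤ κ) (N : ℕ) {δ : ℝ} (hδ : 0 < δ) :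
    ∃ C : ℝ, 0 < C ∧ ∀ (K : Triangulation) (P : PatchAssignment K), K.ShapeRegular κ →
      P.BoundedBy N → (∀ z ∈ K.interiorNodes, P.WellPosedAt z) → ∀ T ∈ K.triangles,
      (∀ z ∈ T, z ∈ K.boundaryNodes → K.valence (P.source z) = 4 →
        P.AwayFromTwoLines δ (P.source z)) →
      ∀ (τ : BrokenField) (q : Plane →ᵃ[ℝ] Mat), (∀ x, (q x).IsSymm) → ∀ η : ℝ, 0 ≤ η →
      (∀ e ∈ edgesOf (P.neighborhood T),
        |normalNormal e (q (edgeMidpoint e)) - edgeValue K τ e| ≤ η) →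
      ∀ x ∈ convexHull ℝ (T : Set Plane), ∀ i j, |(P.recovery τ T x - q x) i j| ≤ C * η := by
  have hM : 0 < sizeRatio κ N := by linarith [one_le_sizeRatio hκ N]
  set R := 2 * sizeRatio κ N with hR
  set c := 1 / sizeRatio κ N ^ 2 with hc
  have hR0 : 0 < R := by positivity
  have hc0 : 0 < c := by positivity
  obtain ⟨C, hC0, hC⟩ := exists_stability N hR0 hc0 (by positivity : 0 < δ * (c / R) ^ 2)
  refine ⟨C * (3 * N + 2), by positivity, ?_⟩
  intro K P hreg hN hwp T hT haway τ q hq η hη hd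
  have hT3 := (Triangulation.mem_triangles.1 hT).2
  have hne : T.Nonempty := Finset.card_pos.1 (by rw [hT3]; simp)
  have hs := sizeBound_of_mem hreg hκ P hN hT
  have hTN := self_mem_neighborhood P hT
  obtain ⟨p, hp, hpe⟩ := exists_recovery_eq hreg P τ hT
  have hvert : ∀ z ∈ T, ∀ i j, |(p - q) z i j| ≤ C * (3 * N + 2) * η := by
    intro z hz i j
    have hzn := mem_nodes hT hz
    have hsub := patch_subset_neighborhood P hT hz
    have hfit := fit_isFit P τ z
    have hres := hfit.abs_sub_le hq (hN z hzn)
      (fun A hA => (Triangulation.mem_triangles.1 (P.patch_subset z hzn hA)).2) hη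
      (fun e he => hd e (edgesOf_mono hsub he))
    have hsymm : ∀ x, ((P.fit τ z - q) x).IsSymm := symmAffine.sub_mem hfit.1 hq
    have e1 : (p - q) z = (P.fit τ z - q) z := by
      change p z - q z = P.fit τ z z - q z
      rw [hp z hz]
    rw [e1, mul_assoc]
    rcases interior_or_boundary hzn with hi | hb
    · exact (hC K κ P z _ hreg hi (hN z hzn) (hwp z hi)
        (isBounded_of_subset hreg hκ P hN hT hzn hsub) _ hsymm _ hres).1 i j
    -- The fit is evaluated at `z`, which is not the centre of the inherited patch, so the whole
    -- affine field must be controlled; this is where (*) enters.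
    · have hi := P.source_mem z hb
      have hsub' := patch_source_subset P hb
      have hbd := isBounded_of_subset hreg hκ P hN hT hi.1 (hsub'.trans hsub)
      refine (hC K κ P _ _ hreg hi (hN _ hi.1) (hwp _ hi) hbd _ hsymm _
        fun e he => hres e (edgesOf_mono hsub' he)).2 (fun h4 =>
          awayFromAxes_of_awayFromTwoLines P hi hbd hR0 hc0 hδ (haway z hz hb h4)) z ?_ i j
      obtain ⟨A, hA, hAs⟩ := exists_mem_patch P hi.1
      rw [dist_eq_norm]
      exact (hs T hTN).norm_sub_le (hs A (hsub (hsub' hA))) hne hz hAs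
  intro x hx i j
  rw [hpe]
  exact abs_affine_apply_le hT3 hvert x hx i j

/-! ### Norms -/

theorem l2Norm_singleton_le {T : Finset Plane} {τ : BrokenField} {B : ℝ} (hB : 0 ≤ B)
    (h : ∀ x ∈ convexHull ℝ (T : Set Plane), ∀ i j, |τ T x i j| ≤ B) :
    l2Norm {T} τ ≤ 2 * meshSize T * B := by
  rw [l2Norm, Finset.sum_singleton]
  refine Real.sqrt_le_iff.2 ⟨mul_nonneg (mul_nonneg zero_le_two (meshSize_nonneg T)) hB, ?_⟩
  have h1 := norm_setIntegral_le_of_norm_le_const (μ := volume) (C := 4 * B ^ 2)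
    (f := fun x => ∑ i, ∑ j, (τ T x i j) ^ 2) (isCompact_hull T).measure_lt_top
    (fun x hx => by
      have h2 : ∀ i j, (τ T x i j) ^ 2 ≤ B ^ 2 := fun i j => by
        rw [← sq_abs]; exact pow_le_pow_left₀ (abs_nonneg _) (h x hx i j) 2
      rw [Real.norm_of_nonneg (by positivity)]
      simp only [Fin.sum_univ_two]
      linarith [h2 0 0, h2 0 1, h2 1 0, h2 1 1])
  refine (le_abs_self _).trans (h1.trans (le_of_eq ?_))
  rw [Measure.real, ← sq_meshSize]
  ring

theorem abs_mul_meshSize_le {S : Finset (Finset Plane)} {τ : BrokenField} {T : Finset Plane}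
    (hT : T ∈ S) {A : Mat} (hA : ∀ x ∈ convexHull ℝ (T : Set Plane), τ T x = A) (i j : Fin 2) :
    |A i j| * meshSize T ≤ l2Norm S τ := by
  refine Real.le_sqrt_of_sq_le ?_
  have h1 : ∫ x in convexHull ℝ (T : Set Plane), ∑ i, ∑ j, (τ T x i j) ^ 2 =
      meshSize T ^ 2 * ∑ i, ∑ j, (A i j) ^ 2 := by
    rw [setIntegral_congr_fun (g := fun _ => ∑ i, ∑ j, (A i j) ^ 2)
      (isCompact_hull T).measurableSet fun x hx => by simp only [hA x hx],
      setIntegral_const, smul_eq_mul, Measure.real, ← sq_meshSize]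
  have h2 : (A i j) ^ 2 ≤ ∑ i, ∑ j, (A i j) ^ 2 :=
    (Finset.single_le_sum (f := fun j => (A i j) ^ 2) (fun _ _ => sq_nonneg _)
      (Finset.mem_univ j)).trans
      (Finset.single_le_sum (f := fun i => ∑ j, (A i j) ^ 2)
        (fun _ _ => Finset.sum_nonneg fun _ _ => sq_nonneg _) (Finset.mem_univ i))
  rw [mul_pow, sq_abs, mul_comm]
  refine (mul_le_mul_of_nonneg_left h2 (sq_nonneg _)).trans ?_
  rw [← h1]
  exact Finset.single_le_sum
    (f := fun T : Finset Plane => ∫ x in convexHull ℝ (T : Set Plane), ∑ i, ∑ j, (τ T x i j) ^ 2)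
    (fun _ _ => integral_nonneg fun _ => by positivity) hT

theorem sqrt_integral_le_h2Seminorm {U : Set Plane}
    {H : Fin 2 → Fin 2 → Fin 2 → Fin 2 → Plane → ℝ}
    (hH : ∀ k l i j, MemLp (H k l i j) 2 (volume.restrict U)) (k l : Fin 2) :
    Real.sqrt (∫ x in U, ∑ i, ∑ j, (H k l i j x) ^ 2) ≤ h2Seminorm U H := by
  have hi : ∀ k l, Integrable (fun x => ∑ i, ∑ j, (H k l i j x) ^ 2) (volume.restrict U) :=
    fun k l => integrable_finsetSum _ fun i _ => integrable_finsetSum _ fun j _ =>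
      (hH k l i j).integrable_sq
  refine Real.sqrt_le_sqrt (integral_mono (hi k l)
    (integrable_finsetSum _ fun k _ => integrable_finsetSum _ fun l _ => hi k l) fun x => ?_)
  exact (Finset.single_le_sum (f := fun l => ∑ i, ∑ j, (H k l i j x) ^ 2)
    (fun _ _ => by positivity) (Finset.mem_univ l)).trans
      (Finset.single_le_sum (f := fun k => ∑ l, ∑ i, ∑ j, (H k l i j x) ^ 2)
        (fun _ _ => by positivity) (Finset.mem_univ k))

theorem edge_cases {S : Finset (Finset Plane)} {e : Finset Plane} (he : e ∈ edgesOf S) :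
    ∃ a b : Plane, a ≠ b ∧ e = {a, b} ∧ ∃ T ∈ S, e ⊆ T ∧
      edgeMidpoint e ∈ convexHull ℝ (T : Set Plane) := by
  obtain ⟨T, hT, heT, hc⟩ := mem_edgesOf.1 he
  obtain ⟨a, b, hab, rfl⟩ := Finset.card_eq_two.1 hc
  refine ⟨a, b, hab, rfl, T, hT, heT, ?_⟩
  rw [edgeMidpoint_pair hab, smul_add]
  exact convex_convexHull ℝ _ (mem_hull (heT (by simp))) (mem_hull (heT (by simp)))
    (by norm_num) (by norm_num) (by norm_num)

/-- The data of a piecewise constant field are those of any adjacent triangle. -/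
theorem IsHHJ.edgeValue_eq {G : Set (Finset Plane)} {τ : BrokenField} (hτ : IsHHJ K G τ)
    {e T : Finset Plane} (hT : T ∈ K.triangles) (heT : e ⊆ T) (he : e ∈ edgesOf K.triangles) :
    edgeValue K τ e = normalNormal e (τ T (edgeMidpoint e)) := by
  have h := Classical.epsilon_spec
    (p := fun T : Finset Plane => T ∈ K.triangles ∧ e ⊆ T) ⟨T, hT, heT⟩
  exact hτ.single e he _ h.1 T hT h.2 heT

/-- A constant is its `L²` norm divided by the root of the area, and the triangles of the
neighbourhood are comparable in size with `T`. -/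
theorem IsHHJ.abs_edgeValue_le (hreg : K.ShapeRegular κ) (hκ : 1 ≤ κ) (P : PatchAssignment K)
    {N : ℕ} (hN : P.BoundedBy N) {T : Finset Plane} (hT : T ∈ K.triangles)
    {G : Set (Finset Plane)} {τ : BrokenField} (hτ : IsHHJ K G τ) :
    ∀ e ∈ edgesOf (P.neighborhood T), |edgeValue K τ e| ≤
      4 * (sizeRatio κ N * l2Norm (P.neighborhood T) τ / meshSize T) := by
  intro e he
  obtain ⟨a, b, hab, rfl, A, hA, heA, hmid⟩ := edge_cases he
  have hAK := neighborhood_subset P T hA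
  obtain ⟨F, -, hF⟩ := hτ.const A hAK
  rw [hτ.edgeValue_eq hAK heA (edgesOf_mono (neighborhood_subset P T) he), hF _ hmid]
  refine abs_normalNormal_le hab F fun i j => ?_
  rw [le_div_iff₀ (hreg.meshSize_pos hT)]
  have hM : 0 ≤ sizeRatio κ N := by linarith [one_le_sizeRatio hκ N]
  have h1 := mul_le_mul_of_nonneg_left (abs_mul_meshSize_le hA hF i j) hM
  have h2 := mul_le_mul_of_nonneg_left (sizeBound_of_mem hreg hκ P hN hT A hA).size_ge
    (abs_nonneg (F i j))
  linarith

/-- A smooth field is close to a symmetric affine one in the neighbourhood of a triangle. -/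
theorem exists_symm_interpolant (hreg : K.ShapeRegular κ) (hκ : 1 ≤ κ) (P : PatchAssignment K)
    {N : ℕ} (hN : P.BoundedBy N) {T : Finset Plane} (hT : T ∈ K.triangles) {σ : Plane → Mat}
    {g : Fin 2 → Fin 2 → Fin 2 → Plane → ℝ} {H : Fin 2 → Fin 2 → Fin 2 → Fin 2 → Plane → ℝ}
    (hsymm : ∀ x ∈ cover (P.neighborhood T), (σ x).IsSymm)
    (hσ : ContinuousOn σ (cover (P.neighborhood T)))
    (hH2 : ∀ k l, IsH2With (interior (cover (P.neighborhood T))) (fun x => σ x k l) (g k l)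
      (H k l)) :
    ∃ q : Plane →ᵃ[ℝ] Mat, (∀ x, (q x).IsSymm) ∧ ∀ A ∈ P.neighborhood T,
      ∀ x ∈ convexHull ℝ (A : Set Plane), ∀ i j, |(σ x - q x) i j| ≤ interpolationConst κ N *
        (meshSize T * h2Seminorm (interior (cover (P.neighborhood T))) H) := by
  have hTcov : ∀ z ∈ T, z ∈ cover (P.neighborhood T) := fun z hz =>
    Set.mem_iUnion₂.2 ⟨T, self_mem_neighborhood P hT, mem_hull hz⟩
  obtain ⟨q, hq, hqs⟩ : ∃ q : Plane →ᵃ[ℝ] Mat, (∀ z ∈ T, q z = σ z) ∧ ∀ x, (q x).IsSymm := by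
    obtain ⟨a, b, c, -, -, -, hTe⟩ := Finset.card_eq_three.1 (Triangulation.mem_triangles.1 hT).2
    have hcr := hreg.cr_ne_zero (hTe ▸ hT)
    obtain ⟨q, ha, hb, hc⟩ := exists_affine hcr (σ a) (σ b) (σ c)
    have sa := hsymm a (hTcov a (by simp [hTe]))
    have sb := hsymm b (hTcov b (by simp [hTe]))
    have sc := hsymm c (hTcov c (by simp [hTe]))
    refine ⟨q, fun z hz => ?_, fun x => ?_⟩
    · rw [hTe] at hz
      simp only [Finset.mem_insert, Finset.mem_singleton] at hz
      rcases hz with rfl | rfl | rfl <;> assumption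
    · rw [coord_eq hcr a x, affine_triangle, ha, hb, hc]
      exact (sa.add ((sb.sub sa).smul _)).add ((sc.sub sa).smul _)
  refine ⟨q, hqs, fun A hA x hx i j => ?_⟩
  have hf : HasMixedBound (cover (P.neighborhood T))
      (h2Seminorm (interior (cover (P.neighborhood T))) H) (fun x => σ x i j) :=
    ((hH2 i j).hasMixedBound (continuousOn_pi.1 (continuousOn_pi.1 hσ i) j)).mono
      (sqrt_integral_le_h2Seminorm (fun k l => (hH2 k l).memLp_hess) i j)
  exact abs_sub_interpolant_le hreg hκ P hN hT (Real.sqrt_nonneg _) hf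
    (p := (Matrix.entryLinearMap ℝ ℝ i j).toAffineMap.comp q)
    (fun z hz => congrFun (congrFun (hq z hz) i) j) A hA x hx

end Plate

end

/-! ### The theorem -/

theorem theorem4p4 (κ δ : ℝ) (N : ℕ) (hδ : 0 < δ) :
    ∃ C : ℝ, 0 < C ∧ ∀ (K : Plate.Triangulation) (P : Plate.PatchAssignment K),
      K.ShapeRegular κ → P.BoundedBy N → (∀ z ∈ K.interiorNodes, P.WellPosedAt z) →
      (∀ z ∈ K.nodes, ∀ d : Finset Plate.Plane → ℝ, ∃! p, Plate.IsFit (P.patch z) d p) ∧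
      ∀ T ∈ K.triangles,
        (∀ z ∈ T, z ∈ K.boundaryNodes → K.valence (P.source z) = 4 →
          P.AwayFromTwoLines δ (P.source z)) →
        (∀ (G : Set (Finset Plate.Plane)) (τ : Plate.BrokenField), Plate.IsHHJ K G τ →
          Plate.l2Norm {T} (P.recovery τ) ≤ C * Plate.l2Norm (P.neighborhood T) τ) ∧
        (∀ (σ : Plate.Plane → Plate.Mat) (g : Fin 2 → Fin 2 → Fin 2 → Plate.Plane → ℝ)
          (H : Fin 2 → Fin 2 → Fin 2 → Fin 2 → Plate.Plane → ℝ),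
          (∀ x ∈ Plate.cover (P.neighborhood T), (σ x).IsSymm) →
          ContinuousOn σ (Plate.cover (P.neighborhood T)) →
          (∀ k l, Plate.IsH2With (interior (Plate.cover (P.neighborhood T)))
            (fun x => σ x k l) (g k l) (H k l)) →
          Plate.l2Norm {T} (fun T' x => σ x - P.recovery (fun _ => σ) T' x) ≤
            C * Plate.meshSize T ^ 2 *
              Plate.h2Seminorm (interior (Plate.cover (P.neighborhood T))) H) := by
  -- Shape regularity is monotone in its parameter, and the constants are built for parameters of at
  -- least one.
  have hκ : 1 ≤ max κ 1 := le_max_right _ _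
  obtain ⟨C, hC0, hC⟩ := Plate.exists_recovery_bound hκ N hδ
  have hM : 0 < Plate.sizeRatio (max κ 1) N := by linarith [Plate.one_le_sizeRatio hκ N]
  have hI := Plate.interpolationConst_pos hκ N
  set M := Plate.sizeRatio (max κ 1) N with hMdef
  set I := Plate.interpolationConst (max κ 1) N with hIdef
  -- One summand for each estimate: `2 h` from the norm of a bounded field over `T`, `4` from a
  -- normal-normal component in terms of entries, and `1 + 4 C` from the triangle inequality with
  -- the interpolant.
  refine ⟨8 * C * M + 2 * (1 + 4 * C) * I, by positivity, ?_⟩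
  intro K P hreg₀ hN hwp
  have hreg := hreg₀.mono (le_max_left κ 1)
  refine ⟨fun z hz d => ?_, fun T hT haway => ⟨fun G τ hτ => ?_, fun σ g H hsymm hσ hH2 => ?_⟩⟩
  · obtain ⟨p, hp⟩ := Plate.exists_isFit (P.patch z) d
    exact ⟨p, hp, fun q hq => hq.unique hp fun r hr h0 =>
      Plate.eq_zero_of_normalNormal_eq_zero hreg hκ P hN hwp hz hr h0⟩
  · have h0 := hreg.meshSize_pos hT
    set h := Plate.meshSize T with hh
    have hL : 0 ≤ Plate.l2Norm (P.neighborhood T) τ := Real.sqrt_nonneg _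
    set L := Plate.l2Norm (P.neighborhood T) τ with hLdef
    -- Comparison with the zero field: the misfit is the size of the edge data themselves, of order
    -- `L / h`, and the factor `h` returns with the norm over `T`.
    have hrec := hC K P hreg hN hwp T hT haway τ 0 (fun _ => Matrix.isSymm_zero)
      (4 * (M * L / h)) (by positivity) (fun e he => by
        have hz : Plate.normalNormal e ((0 : Plate.Plane →ᵃ[ℝ] Plate.Mat)
            (Plate.edgeMidpoint e)) = 0 := by
          simp [Plate.normalNormal]
        rw [hz, zero_sub, abs_neg]
        exact hτ.abs_edgeValue_le hreg hκ P hN hT e he)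
    refine (Plate.l2Norm_singleton_le (B := C * (4 * (M * L / h))) (by positivity)
      fun x hx i j => ?_).trans ?_
    · simpa using hrec x hx i j
    · have e : 2 * h * (C * (4 * (M * L / h))) = 8 * C * M * L := by
        field_simp
        ring
      rw [← hh, e]
      exact mul_le_mul_of_nonneg_right (le_add_of_nonneg_right (by positivity)) hL
  · have h0 := hreg.meshSize_pos hT
    obtain ⟨q, hqs, hq⟩ := Plate.exists_symm_interpolant hreg hκ P hN hT hsymm hσ hH2
    set h := Plate.meshSize T with hh
    have hX : 0 ≤ Plate.h2Seminorm (interior (Plate.cover (P.neighborhood T))) H :=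
      Real.sqrt_nonneg _
    set X := Plate.h2Seminorm (interior (Plate.cover (P.neighborhood T))) H with hXdef
    -- Comparison with the interpolant, whose misfit at the edge midpoints is of order `h * X`; the
    -- norm over `T` contributes the second factor `h`.
    have hrec := hC K P hreg hN hwp T hT haway (fun _ => σ) q hqs (4 * (I * (h * X)))
      (by positivity) (fun e he => by
        obtain ⟨a, b, hab, rfl, A, hA, -, hmid⟩ := Plate.edge_cases he
        rw [abs_sub_comm, Plate.edgeValue, ← Plate.normalNormal_sub]
        exact Plate.abs_normalNormal_le hab _ (hq A hA _ hmid))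
    refine (Plate.l2Norm_singleton_le (B := (1 + 4 * C) * (I * (h * X))) (by positivity)
      fun x hx i j => ?_).trans ?_
    · have h1 := hq T (Plate.self_mem_neighborhood P hT) x hx i j
      have h2 := hrec x hx i j
      rw [Matrix.sub_apply, abs_le] at h1 h2 ⊢
      constructor <;> linarith [h1.1, h1.2, h2.1, h2.2]
    · have e : 2 * h * ((1 + 4 * C) * (I * (h * X))) = 2 * (1 + 4 * C) * I * h ^ 2 * X := by ring
      rw [← hh, e]
      refine mul_le_mul_of_nonneg_right (mul_le_mul_of_nonneg_right ?_ (sq_nonneg h)) hX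
      exact le_add_of_nonneg_left (by positivity)
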